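/- **Setting.** Let $\mathcal E$ be a regular category that is exact (every equivalence relation is the kernel pair of some morphism) and finitely powered (every object has finitely many subobjects). "Surjection" means regular epimorphism. Let $\Lambda$ be the finite set of subobjects of the final object $\mathbf 1$; an object $X$ has type $\lambda\in\Lambda$ if $\lambda$ is the image of $X\to\mathbf 1$. Let $\mathcal E^s$ be the category with the objects of $\mathcal E$ and the surjections as morphisms, and $\mathcal E^s_\lambda\subset\mathcal E^s$ the full subcategory of objects of type $\lambda$. A pro-object $\Omega$ of a category $\mathcal A$ (a diagram indexed by a small cofiltered category) is universal if $\mathrm{Hom}(\Omega,X)\neq\emptyset$ for all $X\in\mathcal A$, homogeneous if $\mathrm{Aut}(\Omega)$ acts transitively on $\mathrm{Hom}(\Omega,X)$ for all $X\in\mathcal A$, and sequential if it is indexed by $\mathbf N$. Given a family $\Omega=(\Omega_\lambda)_{\lambda\in\Lambda}$ of universal homogeneous pro-objects $\Omega_\lambda$ of $\mathcal E^s_\lambda$, let $\mathfrak M$ be the category with object set $\Lambda$ and $\mathrm{Hom}_{\mathfrak M}(\lambda,\mu)=\mathrm{Hom}_{\mathrm{Pro}(\mathcal E)}(\Omega_\mu,\Omega_\lambda)$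 (a monoid if $\mathbf 1$ has no proper subobject), let $\mathfrak G$ be its groupoid of invertible morphisms, and put $\mathfrak G_\lambda=\mathrm{Aut}_{\mathfrak M}(\lambda)$. An $\mathfrak M$-set (resp. $\mathfrak G$-set) is a functor from $\mathfrak M$ (resp. $\mathfrak G$) to sets. For $X\in\mathcal E$ let $\mathfrak A(X)$ be the $\mathfrak M$-set $\mathfrak A(X)_\lambda=\mathrm{Hom}_{\mathrm{Pro}(\mathcal E)}(\Omega_\lambda,X)$, and $\mathfrak B(X)$ the $\mathfrak G$-set $\mathfrak B(X)_\lambda=\mathrm{Surj}(\Omega_\lambda,X)\subset\mathfrak A(X)_\lambda$ of classes of surjections $\Omega_{\lambda,i}\to X$. The *smooth* $\mathfrak M$-sets are the smallest class containing all $\mathfrak A(X)$ and closed under subobjects, quotients, unions of families of subobjects of an $\mathfrak M$-set, and finite products. They induce on $\mathfrak G_\lambda$ the topology generated by the sets $\{\sigma:\sigma z=z'\}$, with $z,z'\in\mathfrak Z_\lambda$ and $\mathfrak Z$ smooth; a $\mathfrak G$-set is *smooth* if all point stabilizers in the groups $\mathfrak G_\lambda$ are open. That $\mathfrak M$ is *pro-oligomorphic*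 means: it has finitely many objects; distinct parallel morphisms act differently on some smooth $\mathfrak M$-set; each $\mathfrak G_\lambda$ is a Hausdorff topological group in which the open subgroups form a neighborhood basis of the identity and $U\backslash\mathfrak G_\lambda/V$ is finite for all open subgroups $U,V$; and if $\mathfrak Z$ is a smooth $\mathfrak M$-set generated by finitely many elements, then $\mathfrak G_\lambda$ has finitely many orbits on $\mathfrak Z_\lambda$ for every $\lambda$. An $\mathfrak M$-set is *monogenic* if it is generated by one element; its generic locus consists of the elements that generate it. A monogenic smooth $\mathfrak M$-set $\mathfrak Z$ is *simply connected* if every surjection $\mathfrak Z'\to\mathfrak Z$ from a monogenic smooth $\mathfrak M$-set that has finite fibers between the generic loci is an isomorphism. A $\mathfrak G$-set is *transitive* if it has exactly one orbit. A transitive smooth $\mathfrak G$-set $\mathfrak Z$ is *simply connected* if every map $\mathfrak Y\to\mathfrak Z$ with finite fibers and $\mathfrak Y$ smooth is isomorphic over $\mathfrak Z$ to $\mathfrak Z^{\amalg n}\to\mathfrak Z$ for some $n\ge 0$. **Theorem.** (0) For every family $\Omega$ of universal homogeneous pro-objects, $\mathfrak M$ is pro-oligomorphic, and the topology on each $\mathfrak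 G_\lambda$ is the one generated by the sets $\{\sigma:\sigma x=y\}$ with $x,y\in\mathfrak B(X)_\lambda$, $X\in\mathcal E$. Such a family exists; if $\mathcal E$ has countably many isomorphism classes of objects, there is one consisting of sequential pro-objects. (a) The family $\Omega$ can be chosen so that $X\mapsto\mathfrak A(X)$ is a fully faithful functor from $\mathcal E$ to $\mathfrak M$-sets, whose essential image consists of the smooth, monogenic, simply connected $\mathfrak M$-sets. This holds for every family $\Omega$ of sequential universal homogeneous pro-objects. (b) For every family $\Omega$ of universal homogeneous pro-objects, $X\mapsto\mathfrak B(X)$ is a fully faithful functor from $\mathcal E^s$ to $\mathfrak G$-sets, whose essential image consists of the smooth, transitive, simply connected $\mathfrak G$-sets. (c) For every family $\Omega$ of universal homogeneous pro-objects and every $X\in\mathcal E$, the inclusions $Y\subset X$ induce an isomorphism $\coprod_{Y\subset X}\mathfrak B(Y)\to\mathfrak A(X)|_{\mathfrak G}$ of $\mathfrak G$-sets. -/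

import Mathlib

open CategoryTheory CategoryTheory.Limits Opposite Topology

universe w v u v₁ u₁

noncomputable section

namespace ProOlig

/-! ### Finitely-powered exact regular categories -/

section Regular

variable (E : Type u) [Category.{v} E]

/-- Every equivalence relation is effective, i.e. is the kernel pair of some morphism.
An exact category is a regular category with this property. -/
def EquivalenceRelationsEffective : Prop :=
  ∀ ⦃R X : E⦄ (p₁ p₂ : R ⟶ X), IsEquivalenceRelation p₁ p₂ →
    ∃ (Y : E) (f : X ⟶ Y), IsKernelPair f p₁ p₂

/-- Every object has finitely many subobjects. -/
def FinitelyPowered : Prop := ∀ X : E, Finite (Subobject X)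

/-- There are countably many isomorphism classes of objects. -/
def CountablyManyIsoClasses : Prop := Countable (Quotient (isIsomorphicSetoid E))

variable [Regular E]

instance regularEpi_isStableUnderComposition :
    (MorphismProperty.regularEpi E).IsStableUnderComposition where
  comp_mem f g hf hg := by
    simp only [MorphismProperty.regularEpi_iff] at hf hg ⊢
    have : StrongEpi (f ≫ g) := strongEpi_comp f g
    infer_instance

instance regularEpi_isMultiplicative : (MorphismProperty.regularEpi E).IsMultiplicative where

/-- The category `E^s`: the objects of `E`, with the surjections (i.e. the regular epimorphisms)
as morphisms. -/
abbrev Surj : Type u := WideSubcategory (MorphismProperty.regularEpi E)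

variable {E} in
/-- The type of an object `X`: the image of `X ⟶ 1`, a subobject of the final object. -/
def objType (X : E) : Subobject (⊤_ E) := imageSubobject (terminal.from X)

variable {E} in
/-- The category `E^s_λ`: the full subcategory of `E^s` on the objects of type `l`. -/
abbrev SurjOfType (l : Subobject (⊤_ E)) : Type u :=
  ObjectProperty.FullSubcategory (fun X : Surj E => objType X.obj = l)

variable {E} in
/-- The inclusion of `E^s_λ` in `E`. -/
abbrev SurjOfType.incl (l : Subobject (⊤_ E)) : SurjOfType l ⥤ E :=
  ObjectProperty.ι _ ⋙ wideSubcategoryInclusion _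

end Regular

/-! ### Pro-objects -/

/-- A pro-object of `C`: a diagram in `C` indexed by a small cofiltered category. -/
structure ProObj (C : Type u) [Category.{v} C] where
  /-- the index category -/
  J : Type w
  [cat : SmallCategory J]
  [cofiltered : IsCofiltered J]
  /-- the diagram -/
  diag : J ⥤ C

attribute [instance] ProObj.cat ProObj.cofiltered

namespace ProObj

section

variable {C : Type u} [Category.{v} C]

/-- Morphisms `f : P_i ⟶ X` and `g : P_j ⟶ X` are equivalent if they become equal on some `P_k`. -/
instance homSetoid (P : ProObj.{w} C) (X : C) : Setoid (Σ j : P.J, P.diag.obj j ⟶ X) where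
  r p q := ∃ (k : P.J) (a : k ⟶ p.1) (b : k ⟶ q.1), P.diag.map a ≫ p.2 = P.diag.map b ≫ q.2
  iseqv :=
    { refl := fun p => ⟨p.1, 𝟙 _, 𝟙 _, rfl⟩
      symm := fun ⟨k, a, b, h⟩ => ⟨k, b, a, h.symm⟩
      trans := by
        rintro p q r ⟨k, a, b, h⟩ ⟨l, c, d, h'⟩
        obtain ⟨m, s, t, e⟩ := IsCofiltered.cospan b c
        refine ⟨m, s ≫ a, t ≫ d, ?_⟩
        rw [Functor.map_comp, Functor.map_comp, Category.assoc, Category.assoc, h, ← h',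
          ← Category.assoc, ← Category.assoc, ← Functor.map_comp, ← Functor.map_comp, e] }

/-- The set of morphisms from the pro-object `P = (P_j)` to an object `X` of `C`:
the direct limit of the sets `P_j ⟶ X`. -/
def HomTo (P : ProObj.{w} C) (X : C) : Type (max w v) := Quotient (P.homSetoid X)

/-- The class of `f : P_j ⟶ X`. -/
def HomTo.mk (P : ProObj.{w} C) {X : C} (j : P.J) (f : P.diag.obj j ⟶ X) : P.HomTo X :=
  Quotient.mk _ ⟨j, f⟩

lemma HomTo.ind {P : ProObj.{w} C} {X : C} (x : P.HomTo X) :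
    ∃ (j : P.J) (f : P.diag.obj j ⟶ X), HomTo.mk P j f = x := by
  obtain ⟨⟨j, f⟩, h⟩ := Quotient.exists_rep x
  exact ⟨j, f, h⟩

lemma HomTo.mk_eq_iff {P : ProObj.{w} C} {X : C} {i j : P.J} (f : P.diag.obj i ⟶ X)
    (g : P.diag.obj j ⟶ X) : HomTo.mk P i f = HomTo.mk P j g ↔
      ∃ (k : P.J) (a : k ⟶ i) (b : k ⟶ j), P.diag.map a ≫ f = P.diag.map b ≫ g :=
  Quotient.eq

/-- Composition of a morphism from a pro-object to `X` with a morphism `X ⟶ Y`. -/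
def HomTo.post {P : ProObj.{w} C} {X Y : C} (f : X ⟶ Y) (x : P.HomTo X) : P.HomTo Y :=
  Quotient.map (fun p => ⟨p.1, p.2 ≫ f⟩) (by
    rintro ⟨i, p⟩ ⟨j, q⟩ ⟨k, a, b, h⟩
    refine ⟨k, a, b, ?_⟩
    dsimp only at h ⊢
    rw [← Category.assoc, h, Category.assoc]) x

@[simp]
lemma HomTo.post_mk {P : ProObj.{w} C} {X Y : C} (f : X ⟶ Y) (j : P.J)
    (x : P.diag.obj j ⟶ X) : (HomTo.mk P j x).post f = HomTo.mk P j (x ≫ f) := rfl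

@[simp]
lemma HomTo.post_id {P : ProObj.{w} C} {X : C} (x : P.HomTo X) : x.post (𝟙 X) = x := by
  obtain ⟨j, f, rfl⟩ := HomTo.ind x
  simp

lemma HomTo.post_comp {P : ProObj.{w} C} {X Y Z : C} (f : X ⟶ Y) (g : Y ⟶ Z) (x : P.HomTo X) :
    x.post (f ≫ g) = (x.post f).post g := by
  obtain ⟨j, h, rfl⟩ := HomTo.ind x
  simp

/-- A morphism of pro-objects `P ⟶ Q`: an element of the inverse limit over `k` of the sets
`Hom(P, Q_k)`, each of which is the direct limit over `j` of the sets `P_j ⟶ Q_k`. -/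
@[ext]
structure Hom (P Q : ProObj.{w} C) where
  /-- the compatible family of morphisms `P ⟶ Q_k` -/
  app : ∀ k : Q.J, P.HomTo (Q.diag.obj k)
  compat : ∀ {k k' : Q.J} (a : k ⟶ k'), (app k).post (Q.diag.map a) = app k'

/-- Composition of `s : P ⟶ Q` with `x : Q ⟶ X`, where `X` is an object of `C`: if `x` is the class
of `f : Q_k ⟶ X`, this is `P ⟶ Q_k ⟶ X`. -/
def Hom.pull {P Q : ProObj.{w} C} (s : Hom P Q) {X : C} (x : Q.HomTo X) : P.HomTo X :=
  Quotient.lift (fun p : (Σ k : Q.J, Q.diag.obj k ⟶ X) => (s.app p.1).post p.2) (by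
    rintro ⟨i, p⟩ ⟨j, q⟩ ⟨k, a, b, h⟩
    dsimp only at h ⊢
    rw [← s.compat a, ← s.compat b, ← HomTo.post_comp, ← HomTo.post_comp, h]) x

@[simp]
lemma Hom.pull_mk {P Q : ProObj.{w} C} (s : Hom P Q) {X : C} (k : Q.J) (f : Q.diag.obj k ⟶ X) :
    s.pull (HomTo.mk Q k f) = (s.app k).post f := rfl

lemma Hom.pull_post {P Q : ProObj.{w} C} (s : Hom P Q) {X Y : C} (f : X ⟶ Y) (x : Q.HomTo X) :
    s.pull (x.post f) = (s.pull x).post f := by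
  obtain ⟨k, g, rfl⟩ := HomTo.ind x
  simp [HomTo.post_comp]

/-- The identity of a pro-object. -/
def Hom.id (P : ProObj.{w} C) : Hom P P where
  app k := HomTo.mk P k (𝟙 _)
  compat {k k'} a := by
    rw [HomTo.post_mk, HomTo.mk_eq_iff]
    exact ⟨k, 𝟙 _, a, by simp⟩

/-- Composition of morphisms of pro-objects. -/
def Hom.comp {P Q R : ProObj.{w} C} (s : Hom P Q) (t : Hom Q R) : Hom P R where
  app k := s.pull (t.app k)
  compat a := by rw [← Hom.pull_post, t.compat]

lemma Hom.pull_id (P : ProObj.{w} C) {X : C} (x : P.HomTo X) : (Hom.id P).pull x = x := by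
  obtain ⟨j, g, rfl⟩ := HomTo.ind x
  simp [Hom.id]

lemma Hom.pull_comp {P Q R : ProObj.{w} C} (s : Hom P Q) (t : Hom Q R) {X : C} (x : R.HomTo X) :
    (s.comp t).pull x = s.pull (t.pull x) := by
  obtain ⟨j, g, rfl⟩ := HomTo.ind x
  simp [Hom.comp, Hom.pull_post]

/-- The category `Pro(C)`. -/
instance : Category.{max w v} (ProObj.{w} C) where
  Hom P Q := Hom P Q
  id P := Hom.id P
  comp s t := Hom.comp s t
  id_comp s := Hom.ext (funext fun k => Hom.pull_id _ (s.app k))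
  comp_id s := Hom.ext (funext fun k => HomTo.post_id (s.app k))
  assoc s t r := Hom.ext (funext fun k => Hom.pull_comp s t (r.app k))

variable (C) in
/-- The functor `(P, X) ↦ Hom(P, X)`, contravariant in the pro-object `P` and covariant in the
object `X`. -/
def homBifunctor : (ProObj.{w} C)ᵒᵖ ⥤ C ⥤ Type (max w v) where
  obj P :=
    { obj := fun X => P.unop.HomTo X
      map := fun f => ↾(HomTo.post f)
      map_id := fun X => by
        ext x
        exact HomTo.post_id x
      map_comp := fun f g => by
        ext x
        exact HomTo.post_comp f g x }
  map s :=
    { app := fun X => ↾(Hom.pull s.unop)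
      naturality := fun X Y f => by
        ext x
        exact Hom.pull_post s.unop f x }
  map_id P := by
    ext X x
    exact Hom.pull_id P.unop x
  map_comp s t := by
    ext X x
    exact Hom.pull_comp t.unop s.unop x

/-- The pro-object is indexed by the natural numbers (with their reversed order). -/
def IsSequential (P : ProObj.{w} C) : Prop := Nonempty (P.J ≌ ℕᵒᵖ)

/-- `P` is universal: it maps to every object of `C`. -/
def IsUniversal (P : ProObj.{w} C) : Prop := ∀ X : C, Nonempty (P.HomTo X)

/-- `P` is homogeneous: its automorphism group acts transitively on `Hom(P, X)` for every `X`. -/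
def IsHomogeneous (P : ProObj.{w} C) : Prop :=
  ∀ (X : C) (x y : P.HomTo X), ∃ s : P ≅ P, Hom.pull s.hom x = y

/-- The image of a pro-object under a functor. -/
def push {D : Type u₁} [Category.{v₁} D] (F : C ⥤ D) (P : ProObj.{w} C) : ProObj.{w} D where
  J := P.J
  diag := P.diag ⋙ F

/-- A morphism from a pro-object (with surjective transition maps) to an object `X` is surjective if
it is the class of some regular epimorphism `P_j ⟶ X`. -/
def HomTo.IsSurj {P : ProObj.{w} C} {X : C} (x : P.HomTo X) : Prop :=
  ∃ (j : P.J) (f : P.diag.obj j ⟶ X), IsRegularEpi f ∧ HomTo.mk P j f = x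

end

/-- Isomorphisms of pro-objects with surjective transition maps preserve surjectivity. -/
lemma HomTo.IsSurj.pull {E : Type u} [Category.{v} E] [Regular E] {P Q : ProObj.{w} E}
    (hQ : ∀ {i j : Q.J} (a : i ⟶ j), IsRegularEpi (Q.diag.map a)) (s : P ≅ Q) {X : E}
    {x : Q.HomTo X} (hx : x.IsSurj) : HomTo.IsSurj (Hom.pull s.hom x) := by
  obtain ⟨k, f, hf, rfl⟩ := hx
  obtain ⟨j, g, hg⟩ := HomTo.ind (Hom.app s.hom k)
  refine ⟨j, g ≫ f, ?_, by rw [Hom.pull_mk, ← hg]; rfl⟩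
  have key : Hom.app (s.inv ≫ s.hom) k = HomTo.mk Q k (𝟙 _) := by
    rw [s.inv_hom_id]
    rfl
  change Hom.pull s.inv (Hom.app s.hom k) = _ at key
  rw [← hg, Hom.pull_mk] at key
  obtain ⟨l, h, hl⟩ := HomTo.ind (Hom.app s.inv j)
  rw [← hl, HomTo.post_mk, HomTo.mk_eq_iff] at key
  obtain ⟨m, a, b, e⟩ := key
  have hb := hQ b
  have h1 : StrongEpi ((Q.diag.map a ≫ h) ≫ g) := by
    rw [Category.assoc, e, Category.comp_id]
    infer_instance
  have h2 : StrongEpi g := strongEpi_of_strongEpi (Q.diag.map a ≫ h) g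
  have h3 : StrongEpi (g ≫ f) := strongEpi_comp g f
  infer_instance

end ProObj

/-! ### Sets with an action of a category, and non-archimedean structures

For a category `M`, an `M`-set is a functor `M ⥤ Type`; for a category with one object this is
a set with an action of a monoid. -/

section MSets

variable {M : Type u₁} [Category.{v₁} M]

/-- A non-archimedean structure on `M`: a class of `M`-sets, called smooth, that is stable under
subobjects, quotients, arbitrary unions of subobjects of an `M`-set, and finite products. -/
structure NonArchStructure (M : Type u₁) [Category.{v₁} M] where
  /-- the smooth `M`-sets -/
  Smooth : (M ⥤ Type w) → Prop
  of_injective : ∀ {Z Z' : M ⥤ Type w} (f : Z' ⟶ Z), (∀ l, Function.Injective (f.app l)) →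
    Smooth Z → Smooth Z'
  of_surjective : ∀ {Z Z' : M ⥤ Type w} (f : Z ⟶ Z'), (∀ l, Function.Surjective (f.app l)) →
    Smooth Z → Smooth Z'
  sSup : ∀ {Z : M ⥤ Type w} (S : Set (Subfunctor Z)), (∀ Y ∈ S, Smooth Y.toFunctor) →
    Smooth (sSup S).toFunctor
  prod : ∀ {ι : Type} [Finite ι] (Z : ι → M ⥤ Type w), (∀ i, Smooth (Z i)) → Smooth (∏ᶜ Z)

/-- The minimal non-archimedean structure for which the members of `S` are smooth. -/
def NonArchStructure.generate (S : Set (M ⥤ Type w)) : NonArchStructure.{w} M where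
  Smooth Z := ∀ N : NonArchStructure.{w} M, (∀ Y ∈ S, N.Smooth Y) → N.Smooth Z
  of_injective f hf h N hN := N.of_injective f hf (h N hN)
  of_surjective f hf h N hN := N.of_surjective f hf (h N hN)
  sSup T h N hN := N.sSup T (fun Y hY => h Y hY N hN)
  prod Z h N hN := N.prod Z (fun i => h i N hN)

/-- The structure is Hausdorff: smooth `M`-sets separate the morphisms of `M`. -/
def NonArchStructure.IsHausdorff (N : NonArchStructure.{w} M) : Prop :=
  ∀ ⦃l m : M⦄ (s t : l ⟶ m), s ≠ t →
    ∃ Z : M ⥤ Type w, N.Smooth Z ∧ ∃ z : Z.obj l, Z.map s z ≠ Z.map t z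

/-- The topology on `Aut(l)` induced by a non-archimedean structure on `M`: the coarsest one for
which the sets `{s | s z = z'}` are open, for `z` and `z'` in `Z_l` with `Z` smooth. Thus the
stabilizers of the points of the sets `Z_l` form a neighborhood basis of the identity. -/
@[reducible]
def NonArchStructure.autTopology (N : NonArchStructure.{w} M) (l : M) :
    TopologicalSpace (Aut l) :=
  TopologicalSpace.generateFrom
    {U | ∃ Z : M ⥤ Type w, N.Smooth Z ∧ ∃ z z' : Z.obj l, U = {s : Aut l | Z.map s.hom z = z'}}

/-- An `M`-set is finitary if it is generated by finitely many elements. -/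
def IsFinitary (Z : M ⥤ Type w) : Prop :=
  ∃ S : Set (Σ l, Z.obj l), S.Finite ∧
    ∀ (m : M) (z : Z.obj m), ∃ y ∈ S, ∃ s : y.1 ⟶ m, Z.map s y.2 = z

/-- `Aut(l)` has finitely many orbits on `Z_l`. -/
def IsFinitaryAt (Z : M ⥤ Type w) (l : M) : Prop :=
  ∃ S : Set (Z.obj l), S.Finite ∧ ∀ z : Z.obj l, ∃ y ∈ S, ∃ s : Aut l, Z.map s.hom y = z

/-- A topological group is pro-oligomorphic if it is Hausdorff, non-archimedean (the open subgroups
form a neighborhood basis of the identity) and Roelcke-precompact (`U \ G / V` is finite for all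
open subgroups `U` and `V`). -/
structure IsProOligomorphicGroup (G : Type*) [Group G] [TopologicalSpace G] : Prop where
  t2 : T2Space G
  nonarchimedean : NonarchimedeanGroup G
  roelcke : ∀ U V : Subgroup G, IsOpen (U : Set G) → IsOpen (V : Set G) →
    Finite (DoubleCoset.Quotient (U : Set G) (V : Set G))

/-- A category with a non-archimedean structure is pro-oligomorphic. For a category with one object
this is the notion of pro-oligomorphic monoid. -/
structure IsProOligomorphic (N : NonArchStructure.{w} M) : Prop where
  hausdorff : N.IsHausdorff
  finite_objects : Finite M
  aut : ∀ l : M, @IsProOligomorphicGroup (Aut l) _ (N.autTopology l)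
  finitary : ∀ Z : M ⥤ Type w, N.Smooth Z → IsFinitary Z → ∀ l : M, IsFinitaryAt Z l

/-- The element `z` of `Z_l` generates the `M`-set `Z`. -/
def Generates (Z : M ⥤ Type w) {l : M} (z : Z.obj l) : Prop :=
  ∀ (m : M) (y : Z.obj m), ∃ s : l ⟶ m, Z.map s z = y

/-- An `M`-set is monogenic if it is generated by a single element. -/
def IsMonogenic (Z : M ⥤ Type w) : Prop := ∃ (l : M) (z : Z.obj l), Generates Z z

/-- A map `f : Z' ⟶ Z` of monogenic smooth `M`-sets is generically finite if the map it induces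
between the generic loci has finite fibers; the generic locus of a monogenic `M`-set is the set of
the elements that generate it. -/
def IsGenericallyFinite {Z' Z : M ⥤ Type w} (f : Z' ⟶ Z) : Prop :=
  ∀ (l : M) (z : Z.obj l), Generates Z z → {z' : Z'.obj l | Generates Z' z' ∧ f.app l z' = z}.Finite

/-- A monogenic smooth `M`-set `Z` is simply connected if every generically finite surjection to `Z`
from a monogenic smooth `M`-set is an isomorphism. -/
def IsSimplyConnected (N : NonArchStructure.{w} M) (Z : M ⥤ Type w) : Prop :=
  ∀ (Z' : M ⥤ Type w) (f : Z' ⟶ Z), N.Smooth Z' → IsMonogenic Z' →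
    (∀ l, Function.Surjective (f.app l)) → IsGenericallyFinite f → IsIso f

end MSets

/-! ### Sets with an action of the groupoid of invertible morphisms -/

section CoreSets

variable {M : Type u₁} [Category.{v₁} M]

/-- A set with an action of the groupoid `Core M` is smooth if all its points have open stabilizers
in the groups `Aut(l)`, with the topologies induced by the non-archimedean structure of `M`. -/
def IsSmoothCoreSet (N : NonArchStructure.{w} M) (Z : Core M ⥤ Type w) : Prop :=
  ∀ (c : Core M) (z : Z.obj c),
    IsOpen[N.autTopology c.of] {s : Aut c.of | Z.map (CoreHom.mk s : c ⟶ c) z = z}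

/-- The groupoid action is transitive: there is exactly one orbit. -/
def IsTransitiveCoreSet (Z : Core M ⥤ Type w) : Prop :=
  (∃ c : Core M, Nonempty (Z.obj c)) ∧
    ∀ (c d : Core M) (z : Z.obj c) (y : Z.obj d), ∃ s : c ⟶ d, Z.map s z = y

/-- A finite cover: a map with finite fibers from a smooth set. -/
def IsFiniteCover (N : NonArchStructure.{w} M) {Y Z : Core M ⥤ Type w} (f : Y ⟶ Z) : Prop :=
  IsSmoothCoreSet N Y ∧ ∀ (c : Core M) (z : Z.obj c), {y : Y.obj c | f.app c y = z}.Finite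

/-- A cover of `Z` is trivial if it is isomorphic, over `Z`, to the disjoint union of `n` copies of
`Z` for some natural number `n`. -/
def IsTrivialCover {Y Z : Core M ⥤ Type w} (f : Y ⟶ Z) : Prop :=
  ∃ (n : ℕ) (e : Y ≅ ∐ (fun _ : Fin n => Z)), e.hom ≫ Sigma.desc (fun _ => 𝟙 Z) = f

/-- A transitive smooth set is simply connected if all its finite covers are trivial. -/
def IsSimplyConnectedCoreSet (N : NonArchStructure.{w} M) (Z : Core M ⥤ Type w) : Prop :=
  ∀ (Y : Core M ⥤ Type w) (f : Y ⟶ Z), IsFiniteCover N f → IsTrivialCover f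

end CoreSets

/-! ### The objects attached to a regular category -/

section Main

variable {E : Type u} [Category.{v} E] [Regular E]

variable (E) in
/-- A family of pro-objects, one in each of the categories `E^s_λ`. -/
abbrev ProFamily : Type _ := ∀ l : Subobject (⊤_ E), ProObj.{max u v} (SurjOfType l)

/-- Each member of the family is a universal homogeneous pro-object of `E^s_λ`. -/
def ProFamily.IsUniversalHomogeneous (Ω : ProFamily E) : Prop :=
  ∀ l, (Ω l).IsUniversal ∧ (Ω l).IsHomogeneous

/-- Each member of the family is indexed by the natural numbers. -/
def ProFamily.IsSequential (Ω : ProFamily E) : Prop := ∀ l, (Ω l).IsSequential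

variable (Ω : ProFamily E)

/-- `Ω_λ` as a pro-object of `E`. -/
def proInE (l : Subobject (⊤_ E)) : ProObj.{max u v} E := (Ω l).push (SurjOfType.incl l)

/-- The category `𝔐`: the opposite of the full subcategory of `Pro(E)` on the `Ω_λ`. Its objects
are the subobjects of the final object. -/
abbrev MCat : Type (max u v) :=
  InducedCategory (ProObj.{max u v} E)ᵒᵖ (fun l : Subobject (⊤_ E) => op (proInE Ω l))

/-- The functor `𝔄`, which sends `X` to the `𝔐`-set with `𝔄(X)_λ = Hom(Ω_λ, X)`. -/
def setA : E ⥤ MCat Ω ⥤ Type (max u v) :=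
  (inducedFunctor (fun l : Subobject (⊤_ E) => op (proInE Ω l)) ⋙ ProObj.homBifunctor E).flip

/-- The non-archimedean structure on `𝔐` generated by the sets `𝔄(X)`. -/
def nonArch : NonArchStructure.{max u v} (MCat Ω) :=
  NonArchStructure.generate (Set.range (setA Ω).obj)

/-- The element `x` of `𝔄(X)_λ` is a surjection `Ω_λ ⟶ X`. -/
def IsSurjAt {X : E} {l : MCat Ω} (x : ((setA Ω).obj X).obj l) : Prop :=
  ProObj.HomTo.IsSurj (P := proInE Ω l) (X := X) x

/-- The surjections, as a subset of the restriction of `𝔄(X)` to the groupoid of invertible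
morphisms of `𝔐`. -/
def subB (X : E) : Subfunctor (Core.inclusion (MCat Ω) ⋙ (setA Ω).obj X) where
  obj c := {x | IsSurjAt Ω (l := c.of) x}
  map {c d} s x hx := by
    have hQ : ∀ {i j : (proInE Ω c.of).J} (a : i ⟶ j),
        IsRegularEpi ((proInE Ω c.of).diag.map a) :=
      fun a => ((Ω c.of).diag.map a).hom.property
    exact ProObj.HomTo.IsSurj.pull hQ
      ((inducedFunctor (fun l : Subobject (⊤_ E) => op (proInE Ω l))).mapIso s.iso).unop hx

/-- The functor `𝔅` on `E^s`, which sends `X` to the set with an action of the groupoid of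
invertible morphisms of `𝔐` given by `𝔅(X)_λ = Surj(Ω_λ, X)` (so that `𝔅(X)_λ` is empty unless `X`
has type `λ`). -/
def setB : Surj E ⥤ Core (MCat Ω) ⥤ Type (max u v) where
  obj X := (subB Ω X.obj).toFunctor
  map {X Y} f :=
    { app := fun c => ↾(fun x => ⟨((setA Ω).map f.hom).app c.of x.1, by
        obtain ⟨x, j, g, hg, rfl⟩ := x
        have hf : IsRegularEpi f.hom := f.property
        have : StrongEpi (g ≫ f.hom) := strongEpi_comp g f.hom
        exact ⟨j, g ≫ f.hom, inferInstance, rfl⟩⟩)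
      naturality := fun c d s => by
        ext x
        apply Subtype.ext
        exact NatTrans.naturality_apply ((setA Ω).map f.hom) s.iso.hom x.1 }
  map_id X := by
    ext c x
    apply Subtype.ext
    change ((setA Ω).map (𝟙 X.obj)).app c.of x.1 = x.1
    rw [CategoryTheory.Functor.map_id]
    rfl
  map_comp f g := by
    ext c x
    apply Subtype.ext
    change ((setA Ω).map (f.hom ≫ g.hom)).app c.of x.1 = _
    rw [CategoryTheory.Functor.map_comp]
    rfl

/-- The topology on `𝔊_λ` defined by the sets `𝔅(X)`: it is generated by the sets of the `s` with
`s x = y`, where `x` and `y` are surjections `Ω_λ ⟶ X`. -/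
@[reducible]
def surjTopology (l : MCat Ω) : TopologicalSpace (Aut l) :=
  TopologicalSpace.generateFrom
    {U | ∃ (X : E) (x y : ((setA Ω).obj X).obj l), IsSurjAt Ω x ∧ IsSurjAt Ω y ∧
      U = {s : Aut l | ((setA Ω).obj X).map s.hom x = y}}

/-- For a subobject `Y` of `X`, the map `𝔅(Y) ⟶ 𝔄(X)` given by composition with the inclusion. -/
def inclB (X : E) (Y : Subobject X) :
    (setB Ω).obj ⟨(Y : E)⟩ ⟶ Core.inclusion (MCat Ω) ⋙ (setA Ω).obj X :=
  (subB Ω (Y : E)).ι ≫ Functor.whiskerLeft (Core.inclusion (MCat Ω)) ((setA Ω).map Y.arrow)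

/-- The canonical map to the restriction of `𝔄(X)` from the disjoint union of the `𝔅(Y)`, over the
subobjects `Y` of `X`. -/
def decompositionMap (X : E) :
    (∐ fun Y : Subobject X => (setB Ω).obj ⟨(Y : E)⟩) ⟶
      Core.inclusion (MCat Ω) ⋙ (setA Ω).obj X :=
  Sigma.desc (inclB Ω X)

/-- The functor `𝔄` is fully faithful, and its essential image consists of the smooth, monogenic,
simply connected `𝔐`-sets. -/
structure EmbeddingA : Prop where
  full : (setA Ω).Full
  faithful : (setA Ω).Faithful
  essImage_iff : ∀ Z : MCat Ω ⥤ Type (max u v), (setA Ω).essImage Z ↔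
    (nonArch Ω).Smooth Z ∧ IsMonogenic Z ∧ IsSimplyConnected (nonArch Ω) Z

/-- The functor `𝔅` is fully faithful, and its essential image consists of the smooth, transitive,
simply connected sets over the groupoid of invertible morphisms of `𝔐`. -/
structure EmbeddingB : Prop where
  full : (setB Ω).Full
  faithful : (setB Ω).Faithful
  essImage_iff : ∀ Z : Core (MCat Ω) ⥤ Type (max u v), (setB Ω).essImage Z ↔
    IsSmoothCoreSet (nonArch Ω) Z ∧ IsTransitiveCoreSet Z ∧
      IsSimplyConnectedCoreSet (nonArch Ω) Z

end Main

end ProOlig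

end

/-!
A pro-object `P` of `E` is determined by its functor of points `Hom(P, -)`, a flat functor from `E`
to sets, and the proof works with flat functors throughout. If the transition maps of `P` are
surjective, a morphism `P ⟶ X` is a surjection if and only if it is *generic*, i.e. does not come
from a proper subobject of `X`. As objects have finitely many subobjects, each element of a flat
functor comes from a generic one (`IsFlat.exists_generic`); this is the decomposition of `𝔄(X)` into
the `𝔅(Y)`. The functor of points of a universal homogeneous pro-object of `E^s_λ` is *rich*
(`IsRich`): its generic elements live on objects of type `λ` and lift along surjections. Conversely,
a rich functor with enough automorphisms comes from a universal homogeneous pro-object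
(`isUniversal_and_isHomogeneous`).

*Topology.* Each point of a smooth `𝔐`-set is controlled by a point of some `𝔄(X)`
(`nonArch_controlled`), which gives the description of the topology. Pairs of points of `𝔄(X)` and
`𝔄(Y)` are points of `𝔄(X ⨯ Y)`, and homogeneity shows that orbits are bounded by the number of
subobjects; this is pro-oligomorphicity.

*The embeddings.* Full faithfulness follows from the fact that surjections are effective
epimorphisms: a point `y` fixed by the stabilizer of a surjection `x` factors through `x`
(`exists_map_eq_of_stab_le`). For the essential image, a point `z` of a smooth set is controlled by
a surjection `w : Ω_λ ⟶ W`, and the fibres of the map `s w ↦ s z` form an invariant equivalence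
relation on the surjections `Ω_λ ⟶ W`. There are two key facts about such a relation. An equivalence
relation with finitely many classes in some fibre of a quotient `W ⟶ X` is trivial on the fibres
(`InvariantRel.of_finite`), so that the sets `𝔄(X)` and `𝔅(X)` are simply connected. By exactness,
every invariant relation is, up to finite fibres, the kernel pair of a quotient `W ⟶ X`
(`InvariantRel.exists_quotient`): take a maximal reflexive relation `D ⊂ W ⨯ W` whose generic
elements are related pairs; maximality makes it an equivalence relation and bounds the fibres. Hence
each transitive smooth set has a finite cover of the form `𝔅(X)`, and similarly for `𝔄`. For `𝔄` one
also needs that each `𝔄(X)` is generated by any surjection to `X` (`PointsLift`), which holds for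
sequential pro-objects (`pointsLift_of_isSequential`) by a step-by-step construction.

*Existence.* A sequence of surjections in which countably many lifting problems are solved, one
after the other, gives a sequential pro-object that lifts along countably many surjections
(`exists_sequential_lift`). If `E` has countably many isomorphism classes, this pro-object is
universal, and homogeneous by back-and-forth. In general, an ultraproduct of such pro-objects gives
a rich functor (`exists_isRich`). Partially defined morphisms between rich functors extend to an
ultrapower of the target (`exists_extension`), because finite approximations exist; genericity
passes to ultraproducts since objects have finitely many subobjects
(`isGeneric_ultraproduct_iff`). In the union of a sequence of ultrapowers, the extensions can be
continued indefinitely, forward and backward, so that the union is homogeneous and satisfies the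
lifting property (`exists_homogeneous_family`).
-/

noncomputable section

namespace ProOlig

/-! ### Regular epimorphisms and finiteness in a finitely powered regular category -/

section RegularEpi

variable {E : Type u} [Category.{v} E] [Regular E]

lemma isRegularEpi_comp {X Y Z : E} {f : X ⟶ Y} {g : Y ⟶ Z} (hf : IsRegularEpi f)
    (hg : IsRegularEpi g) : IsRegularEpi (f ≫ g) := by
  have : StrongEpi (f ≫ g) := strongEpi_comp f g
  infer_instance

lemma isRegularEpi_of_comp {X Y Z : E} {f : X ⟶ Y} {g : Y ⟶ Z} (h : IsRegularEpi (f ≫ g)) :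
    IsRegularEpi g := by
  have : StrongEpi g := strongEpi_of_strongEpi f g
  infer_instance

omit [Regular E] in
lemma isIso_of_isRegularEpi_of_mono {X Y : E} {f : X ⟶ Y} (hf : IsRegularEpi f) [Mono f] :
    IsIso f := isIso_of_mono_of_strongEpi f

lemma exists_isRegularEpi_mono_fac {X Y : E} (f : X ⟶ Y) :
    ∃ (I : E) (e : X ⟶ I) (m : I ⟶ Y), IsRegularEpi e ∧ Mono m ∧ e ≫ m = f :=
  ⟨_, (Regular.strongEpiMonoFactorisation f).e, (Regular.strongEpiMonoFactorisation f).m,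
    inferInstance, inferInstance, (Regular.strongEpiMonoFactorisation f).fac⟩

/-- An object has type `l` if and only if it has a surjection to the underlying object of `l`. -/
lemma objType_eq_iff {X : E} {l : Subobject (⊤_ E)} :
    objType X = l ↔ ∃ e : X ⟶ (l : E), IsRegularEpi e := by
  constructor
  · rintro rfl
    have : IsRegularEpi (imageSubobjectIso (terminal.from X)).inv :=
      Regular.isRegularEpi_of_extremalEpi _
    exact ⟨factorThruImage (terminal.from X) ≫ (imageSubobjectIso (terminal.from X)).inv,
      isRegularEpi_comp inferInstance this⟩
  · rintro ⟨e, he⟩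
    apply le_antisymm
    · exact imageSubobject_le _ e (Subsingleton.elim _ _)
    · have sq : CommSq (factorThruImageSubobject (terminal.from X)) e
          (imageSubobject (terminal.from X)).arrow l.arrow := ⟨Subsingleton.elim _ _⟩
      exact Subobject.le_of_comm sq.lift sq.fac_right

lemma objType_eq_of_isRegularEpi {X Y : E} {f : X ⟶ Y} (hf : IsRegularEpi f) :
    objType X = objType Y := by
  obtain ⟨e, he⟩ := objType_eq_iff.1 (rfl : objType Y = objType Y)
  exact objType_eq_iff.2 ⟨f ≫ e, isRegularEpi_comp hf he⟩

lemma isRegularEpi_prod_fst {X Y : E} (h : objType X = objType Y) :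
    IsRegularEpi (prod.fst : X ⨯ Y ⟶ X) := by
  obtain ⟨a, ha⟩ := objType_eq_iff.1 h
  obtain ⟨b, hb⟩ := objType_eq_iff.1 (rfl : objType Y = objType Y)
  have h1 : IsRegularEpi (pullback.fst a b) := inferInstance
  have h2 : pullback.fst a b = prod.lift (pullback.fst a b) (pullback.snd a b) ≫ prod.fst :=
    (prod.lift_fst _ _).symm
  rw [h2] at h1
  exact isRegularEpi_of_comp h1

lemma isRegularEpi_prod_snd {X Y : E} (h : objType X = objType Y) :
    IsRegularEpi (prod.snd : X ⨯ Y ⟶ Y) := by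
  have h1 := isRegularEpi_comp (f := (prod.braiding X Y).hom) inferInstance
    (isRegularEpi_prod_fst h.symm)
  rwa [prod.braiding_hom, prod.lift_fst] at h1

/-- A base change of `e` in disguise: `W ×_X B ⟶ W ×_X W` is obtained from `e : B ⟶ W`. -/
lemma isRegularEpi_pullback_lift {W X B : E} (q : W ⟶ X) {e : B ⟶ W} (he : IsRegularEpi e)
    {b : B ⟶ X} (h : e ≫ q = b) :
    IsRegularEpi (pullback.lift (pullback.fst q b) (pullback.snd q b ≫ e)
      (by rw [Category.assoc, h, pullback.condition]) : pullback q b ⟶ pullback q q) := by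
  subst h
  have hp : IsPullback (pullback.lift (pullback.fst q (e ≫ q)) (pullback.snd q (e ≫ q) ≫ e)
      (by rw [Category.assoc, pullback.condition]) : pullback q (e ≫ q) ⟶ pullback q q)
      (pullback.snd q (e ≫ q)) (pullback.snd q q) e := by
    refine IsPullback.of_right (h₁₂ := pullback.fst q q) (h₂₂ := q) (v₁₃ := q) ?_
      (pullback.lift_snd _ _ _) (IsPullback.of_hasPullback q q)
    simpa only [pullback.lift_fst] using IsPullback.of_hasPullback q (e ≫ q)
  exact Regular.regularEpiIsStableUnderBaseChange.of_isPullback hp.flip he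

lemma finite_hom (hfin : FinitelyPowered E) (X Y : E) : Finite (X ⟶ Y) := by
  have := hfin (X ⨯ Y)
  refine Finite.of_injective
    (fun f : X ⟶ Y => Subobject.mk (prod.lift (𝟙 X) f)) (fun f g h => ?_)
  obtain ⟨h1, h2⟩ : ∃ i : X ≅ X, i.hom ≫ prod.lift (𝟙 X) g = prod.lift (𝟙 X) f :=
    ⟨Subobject.isoOfMkEqMk _ _ h, Subobject.ofMkLEMk_comp _⟩
  have a := congrArg (· ≫ prod.fst) h2
  have b := congrArg (· ≫ prod.snd) h2
  simp only [Category.assoc, prod.lift_fst, prod.lift_snd, Category.comp_id] at a b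
  rw [← b, a, Category.id_comp]

end RegularEpi

/-! ### Flat functors and their generic elements -/

/-- A functor `A : E ⥤ Type` is flat if its category of elements is cofiltered, i.e. if it is of the
form `Hom(P, -)` for a pro-object `P` of `E`. -/
structure IsFlat {E : Type u} [Category.{v} E] (A : E ⥤ Type w) : Prop where
  nonempty : ∃ X, Nonempty (A.obj X)
  dominate : ∀ {X Y : E} (a : A.obj X) (b : A.obj Y), ∃ (Z : E) (c : A.obj Z) (f : Z ⟶ X)
    (g : Z ⟶ Y), A.map f c = a ∧ A.map g c = b
  equalize : ∀ {X Y : E} (f g : X ⟶ Y) (a : A.obj X), A.map f a = A.map g a →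
    ∃ (Z : E) (c : A.obj Z) (h : Z ⟶ X), A.map h c = a ∧ h ≫ f = h ≫ g

/-- An element `a` of `A(X)` is generic if it does not come from a proper subobject of `X`. For
`A = Hom(P, -)` with a pro-object `P` whose transition maps are surjective, the generic elements are
the surjections `P ⟶ X`. -/
def IsGeneric {E : Type u} [Category.{v} E] (A : E ⥤ Type w) {X : E} (a : A.obj X) : Prop :=
  ∀ ⦃Y : E⦄ (f : Y ⟶ X) (b : A.obj Y), A.map f b = a → IsRegularEpi f

section Flat

variable {E : Type u} [Category.{v} E] {A : E ⥤ Type w}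

lemma map_map {X Y Z : E} (f : X ⟶ Y) (g : Y ⟶ Z) (a : A.obj X) :
    A.map g (A.map f a) = A.map (f ≫ g) a := by simp

variable [Regular E]

lemma IsFlat.exists_pullback (hA : IsFlat A) {X Y Z : E} (f : X ⟶ Z) (g : Y ⟶ Z) (a : A.obj X)
    (b : A.obj Y) (h : A.map f a = A.map g b) : ∃ c : A.obj (pullback f g),
      A.map (pullback.fst f g) c = a ∧ A.map (pullback.snd f g) c = b := by
  obtain ⟨W, c, p, q, rfl, rfl⟩ := hA.dominate a b
  rw [map_map, map_map] at h
  obtain ⟨V, d, r, rfl, hr⟩ := hA.equalize _ _ c h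
  refine ⟨A.map (pullback.lift (r ≫ p) (r ≫ q) (by simpa using hr)) d, ?_, ?_⟩
  all_goals rw [map_map, map_map]; simp only [pullback.lift_fst, pullback.lift_snd]

lemma IsFlat.mono_injective (hA : IsFlat A) {X Y : E} (f : X ⟶ Y) [Mono f] :
    Function.Injective (A.map f) := by
  intro a b h
  obtain ⟨c, rfl, rfl⟩ := hA.exists_pullback f f a b h
  have : pullback.fst f f = pullback.snd f f := by
    rw [← cancel_mono f, pullback.condition]
  rw [this]

lemma IsGeneric.map (hA : IsFlat A) {X Y : E} {a : A.obj X} (ha : IsGeneric A a) {f : X ⟶ Y}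
    (hf : IsRegularEpi f) : IsGeneric A (A.map f a) := by
  intro Z g b h
  obtain ⟨c, rfl, rfl⟩ := hA.exists_pullback f g a b h.symm
  have h1 := ha _ c rfl
  have h2 := isRegularEpi_comp h1 hf
  rw [pullback.condition] at h2
  exact isRegularEpi_of_comp h2

omit [Regular E] in
lemma IsGeneric.hom_ext (hA : IsFlat A) {X Y : E} {a : A.obj X} (ha : IsGeneric A a)
    {f g : X ⟶ Y} (h : A.map f a = A.map g a) : f = g := by
  obtain ⟨Z, c, r, hr, e⟩ := hA.equalize _ _ a h
  have := ha r c hr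
  exact (cancel_epi r).1 e

lemma IsFlat.exists_generic (hfin : FinitelyPowered E) {X : E} (a : A.obj X) :
    ∃ (Y : E) (m : Y ⟶ X) (b : A.obj Y), Mono m ∧ IsGeneric A b ∧ A.map m b = a := by
  have := hfin X
  let S : Set (Subobject X) := {Y | ∃ b : A.obj (Y : E), A.map Y.arrow b = a}
  have hS : S.Nonempty := ⟨⊤, A.map (inv (⊤ : Subobject X).arrow) a, by
    rw [map_map]; simp⟩
  obtain ⟨Y, ⟨b, hb⟩, hmin⟩ := S.toFinite.exists_minimal hS
  refine ⟨Y, Y.arrow, b, inferInstance, fun Z f c hc => ?_, hb⟩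
  obtain ⟨I, e, m, he, hm, rfl⟩ := exists_isRegularEpi_mono_fac f
  let T : Subobject X := Subobject.mk (m ≫ Y.arrow)
  have hT : T ∈ S := ⟨A.map (e ≫ (Subobject.underlyingIso (m ≫ Y.arrow)).inv) c, by
    rw [map_map, ← hb, ← hc, map_map]; simp [T]⟩
  have hle : T ≤ Y := Subobject.mk_le_of_comm m rfl
  have hle' : Y ≤ T := hmin hT hle
  have hiso : IsSplitEpi m := by
    refine ⟨⟨⟨Subobject.ofLEMk Y _ hle', ?_⟩⟩⟩
    rw [← cancel_mono Y.arrow, Category.assoc, Subobject.ofLEMk_comp, Category.id_comp]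
  exact isRegularEpi_comp he inferInstance

lemma IsFlat.exists_generic_dominate (hfin : FinitelyPowered E) (hA : IsFlat A) {X Y : E}
    (a : A.obj X) (b : A.obj Y) : ∃ (Z : E) (c : A.obj Z) (f : Z ⟶ X) (g : Z ⟶ Y),
      IsGeneric A c ∧ A.map f c = a ∧ A.map g c = b := by
  obtain ⟨Z, c, f, g, rfl, rfl⟩ := hA.dominate a b
  obtain ⟨W, m, d, -, hd, rfl⟩ := IsFlat.exists_generic hfin c
  exact ⟨W, d, m ≫ f, m ≫ g, hd, by rw [map_map], by rw [map_map]⟩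

lemma IsFlat.exists_generic_dominate_finite (hfin : FinitelyPowered E) (hA : IsFlat A) {X : E}
    (x : A.obj X) {K : Type*} [Finite K] (W : K → E) (a : ∀ k, A.obj (W k)) :
    ∃ (Z : E) (c : A.obj Z) (p : Z ⟶ X) (f : ∀ k, Z ⟶ W k), IsGeneric A c ∧ A.map p c = x ∧
      ∀ k, A.map (f k) c = a k := by
  classical
  have key : ∀ s : Set K, s.Finite → ∃ (Z : E) (c : A.obj Z) (p : Z ⟶ X), IsGeneric A c ∧
      A.map p c = x ∧ ∀ k ∈ s, ∃ f : Z ⟶ W k, A.map f c = a k := by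
    intro s hs
    induction s, hs using Set.Finite.induction_on with
    | empty =>
      obtain ⟨Z, m, c, -, hc, h⟩ := IsFlat.exists_generic hfin x
      exact ⟨Z, c, m, hc, h, by simp⟩
    | insert _ _ ih =>
      rename_i k s _ _
      obtain ⟨Z, c, p, -, rfl, hf⟩ := ih
      obtain ⟨V, d, g, h, hd, rfl, h2⟩ := hA.exists_generic_dominate hfin c (a k)
      refine ⟨V, d, g ≫ p, hd, by rw [map_map], ?_⟩
      intro k' hk'
      obtain rfl | hk' := hk'
      · exact ⟨h, h2⟩
      · obtain ⟨f, hf⟩ := hf k' hk'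
        exact ⟨g ≫ f, by rw [← hf, map_map]⟩
  obtain ⟨Z, c, p, hc, hp, hf⟩ := key Set.univ Set.finite_univ
  choose f hf using fun k => hf k trivial
  exact ⟨Z, c, p, f, hc, hp, hf⟩

/-- A flat functor all of whose generic elements live on objects of type `l`, and whose generic
elements lift to generic elements along surjections. -/
structure IsRich (l : Subobject (⊤_ E)) (A : E ⥤ Type w) : Prop where
  flat : IsFlat A
  objType_eq : ∀ {X : E} (a : A.obj X), IsGeneric A a → objType X = l
  lift : ∀ {X Z : E} (f : Z ⟶ X), IsRegularEpi f → ∀ a : A.obj X, IsGeneric A a →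
    ∃ b : A.obj Z, IsGeneric A b ∧ A.map f b = a

variable {l : Subobject (⊤_ E)}

lemma IsRich.exists_lift (hfin : FinitelyPowered E) (hA : IsRich l A) {X Z : E} (f : Z ⟶ X)
    (hf : IsRegularEpi f) (a : A.obj X) : ∃ b : A.obj Z, A.map f b = a := by
  obtain ⟨Y, m, b, -, hb, rfl⟩ := IsFlat.exists_generic hfin a
  obtain ⟨c, -, hc⟩ := hA.lift (pullback.snd f m) inferInstance b hb
  refine ⟨A.map (pullback.fst f m) c, ?_⟩
  rw [← hc, map_map, map_map, pullback.condition]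

lemma IsRich.exists_lift_generic (hfin : FinitelyPowered E) (hA : IsRich l A) {X Z : E} (f : Z ⟶ X)
    (hf : IsRegularEpi f) (a : A.obj X) :
    ∃ b : A.obj Z, (IsGeneric A a → IsGeneric A b) ∧ A.map f b = a := by
  by_cases ha : IsGeneric A a
  · obtain ⟨b, hb, h⟩ := hA.lift f hf a ha
    exact ⟨b, fun _ => hb, h⟩
  · obtain ⟨b, h⟩ := hA.exists_lift hfin f hf a
    exact ⟨b, fun h => absurd h ha, h⟩

lemma IsRich.exists_generic_of_objType (hfin : FinitelyPowered E) (hA : IsRich l A) {X : E}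
    (hX : objType X = l) : ∃ a : A.obj X, IsGeneric A a := by
  obtain ⟨Y, ⟨a⟩⟩ := hA.flat.nonempty
  obtain ⟨Z, m, b, -, hb, -⟩ := IsFlat.exists_generic hfin a
  obtain ⟨c, hc, -⟩ := hA.lift (prod.fst : Z ⨯ X ⟶ Z)
    (isRegularEpi_prod_fst ((hA.objType_eq b hb).trans hX.symm)) b hb
  exact ⟨A.map prod.snd c, hc.map hA.flat
    (isRegularEpi_prod_snd ((hA.objType_eq b hb).trans hX.symm))⟩

end Flat

/-! ### Invariant equivalence relations on generic elements -/

section InvariantRel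

variable {E : Type u} [Category.{v} E]

/-- An equivalence relation on the generic elements of `A(W)` that is invariant in the following
sense: whether a pair is related depends only on the smallest subobject of `W ⨯ W` containing it.
If a group of automorphisms of `A` acts transitively on the generic elements of each `A(X)`,
this is invariance under the group. -/
structure InvariantRel (A : E ⥤ Type w) {W : E} (R : A.obj W → A.obj W → Prop) : Prop where
  generic : ∀ {a b}, R a b → IsGeneric A a
  refl : ∀ {a}, IsGeneric A a → R a a
  symm : ∀ {a b}, R a b → R b a
  trans : ∀ {a b c}, R a b → R b c → R a c
  inv : ∀ {T : E} (p₁ p₂ : T ⟶ W) {t t' : A.obj T}, IsGeneric A t → IsGeneric A t' →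
    R (A.map p₁ t) (A.map p₂ t) → R (A.map p₁ t') (A.map p₂ t')

variable [Regular E] {A : E ⥤ Type w} {l : Subobject (⊤_ E)} {W : E} {R : A.obj W → A.obj W → Prop}

/-- If one generic element of `W ×_X W` is a related pair, then any two generic elements of `W` with
the same image in `X` are related: they have a common partner with which they both form generic
elements of `W ×_X W`. -/
lemma InvariantRel.of_generic_pair (hfin : FinitelyPowered E) (hA : IsRich l A)
    (hR : InvariantRel A R) {X : E} {q : W ⟶ X} (hq : IsRegularEpi q) {c : A.obj (pullback q q)}
    (hc : IsGeneric A c) (h : R (A.map (pullback.fst q q) c) (A.map (pullback.snd q q) c))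
    {a b : A.obj W} (ha : IsGeneric A a) (hb : IsGeneric A b) (hab : A.map q a = A.map q b) :
    R a b := by
  obtain ⟨B, d, e, e', hd, rfl, rfl⟩ := hA.flat.exists_generic_dominate hfin a b
  have he : IsRegularEpi e := ha e d rfl
  have he' : IsRegularEpi e' := hb e' d rfl
  rw [map_map, map_map] at hab
  have hee := hd.hom_ext hA.flat hab
  obtain ⟨f, hf, rfl⟩ := hA.lift (pullback.snd q (e ≫ q)) inferInstance d hd
  have key : ∀ (g : B ⟶ W) (hg : IsRegularEpi g) (h' : g ≫ q = e ≫ q),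
      R (A.map (pullback.fst q (e ≫ q)) f) (A.map g (A.map (pullback.snd q (e ≫ q)) f)) := by
    intro g hg h'
    have h1 := hR.inv _ _ hc (hf.map hA.flat (isRegularEpi_pullback_lift q hg h')) h
    simpa only [map_map, pullback.lift_fst, pullback.lift_snd] using h1
  exact hR.trans (hR.symm (key e he rfl)) (key e' he' hee.symm)

/-- If the fibre of `q : W ⟶ X` over some generic element of `X` meets only finitely many classes,
then it is contained in one class: an element of the fibre that is generic relative to
representatives of all classes in the fibre is related to one of them. -/
lemma InvariantRel.of_finite (hfin : FinitelyPowered E) (hA : IsRich l A)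
    (hR : InvariantRel A R) {X : E} {q : W ⟶ X} (hq : IsRegularEpi q) {x : A.obj X}
    (hx : IsGeneric A x) {K : Type*} [Finite K] (ψ : {a : A.obj W // A.map q a = x} → K)
    (hψ : ∀ a b, IsGeneric A a.1 → IsGeneric A b.1 → ψ a = ψ b → R a.1 b.1)
    {a b : A.obj W} (ha : IsGeneric A a) (hb : IsGeneric A b) (hab : A.map q a = A.map q b) :
    R a b := by
  let K' := {k : K // ∃ a, IsGeneric A a.1 ∧ ψ a = k}
  choose r hr hr' using fun k : K' => k.2
  obtain ⟨B, d, p, f, hd, hp, hf⟩ :=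
    hA.flat.exists_generic_dominate_finite hfin x (fun _ : K' => W) (fun k => (r k).1)
  have hp' : IsRegularEpi p := hx p d hp
  obtain ⟨c, hc, hcd⟩ := hA.lift (pullback.snd q p) inferInstance d hd
  have hfst : IsRegularEpi (pullback.fst q p) := inferInstance
  have hgen := hc.map hA.flat hfst
  have hcx : A.map q (A.map (pullback.fst q p) c) = x := by
    rw [map_map, pullback.condition, ← map_map, hcd, hp]
  let k : K' := ⟨ψ ⟨_, hcx⟩, ⟨_, hcx⟩, hgen, rfl⟩
  have hk : R (A.map (pullback.fst q p) c) (r k).1 :=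
    hψ ⟨_, hcx⟩ _ hgen (hr k) (hr' k).symm
  have hfk : IsRegularEpi (f k) := hr k (f k) d (hf k)
  have hfq : f k ≫ q = p := by
    apply hd.hom_ext hA.flat
    rw [← map_map, hf, hp, (r k).2]
  refine hR.of_generic_pair hfin hA hq
    (hc.map hA.flat (isRegularEpi_pullback_lift q hfk hfq)) ?_ ha hb hab
  simpa only [map_map, pullback.lift_fst, pullback.lift_snd, ← hf, ← hcd] using hk

/-- A pair of morphisms `T ⟶ W` that sends generic elements to related pairs. -/
def IsGoodSpan (R : A.obj W → A.obj W → Prop) {T : E} (p₁ p₂ : T ⟶ W) : Prop :=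
  ∃ t : A.obj T, IsGeneric A t ∧ R (A.map p₁ t) (A.map p₂ t)

omit [Regular E] in
lemma IsGoodSpan.regularEpi (hR : InvariantRel A R) {T : E} {p₁ p₂ : T ⟶ W}
    (h : IsGoodSpan R p₁ p₂) : IsRegularEpi p₁ ∧ IsRegularEpi p₂ := by
  obtain ⟨t, ht, h⟩ := h
  exact ⟨hR.generic h p₁ t rfl, hR.generic (hR.symm h) p₂ t rfl⟩

omit [Regular E] in
lemma IsGoodSpan.rel (hR : InvariantRel A R) {T : E} {p₁ p₂ : T ⟶ W} (h : IsGoodSpan R p₁ p₂)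
    {t : A.obj T} (ht : IsGeneric A t) : R (A.map p₁ t) (A.map p₂ t) := by
  obtain ⟨t', ht', h⟩ := h
  exact hR.inv _ _ ht' ht h

/-- The subobjects of `W ⨯ W` that contain the diagonal and whose generic elements are related
pairs. -/
def goodReflexive (R : A.obj W → A.obj W → Prop) : Set (Subobject (W ⨯ W)) :=
  {D | (∃ r : W ⟶ (D : E), r ≫ D.arrow = prod.lift (𝟙 W) (𝟙 W)) ∧
    IsGoodSpan R (D.arrow ≫ prod.fst) (D.arrow ≫ prod.snd)}

/-- Let `D` be a maximal element of `goodReflexive R`. For every good span `T`, the composite of `T`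
with its transpose is contained in `D`: composing it with `D` gives a relation in
`goodReflexive R` that contains `D`. -/
lemma exists_factor_of_maximal (hA : IsRich l A) (hR : InvariantRel A R) {D : Subobject (W ⨯ W)}
    (hD : Maximal (· ∈ goodReflexive R) D) {T : E} {p₁ p₂ : T ⟶ W} (hT : IsGoodSpan R p₁ p₂) :
    ∃ j : pullback p₂ p₂ ⟶ (D : E), j ≫ D.arrow ≫ prod.fst = pullback.fst p₂ p₂ ≫ p₁ ∧
      j ≫ D.arrow ≫ prod.snd = pullback.snd p₂ p₂ ≫ p₁ := by
  obtain ⟨⟨r, hr⟩, hgood⟩ := hD.prop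
  obtain ⟨hp₁, hp₂⟩ := hT.regularEpi hR
  obtain ⟨hd₁, hd₂⟩ := hgood.regularEpi hR
  set d₁ := D.arrow ≫ prod.fst with hd₁_def
  set d₂ := D.arrow ≫ prod.snd with hd₂_def
  have hr₁ : r ≫ d₁ = 𝟙 W := by rw [hd₁_def, ← Category.assoc, hr, prod.lift_fst]
  have hr₂ : r ≫ d₂ = 𝟙 W := by rw [hd₂_def, ← Category.assoc, hr, prod.lift_snd]
  have hf₁ : IsRegularEpi (pullback.fst p₂ p₂) := inferInstance
  have hf₂ : IsRegularEpi (pullback.snd p₂ p₂) := inferInstance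
  have hu : IsRegularEpi (pullback.fst p₂ p₂ ≫ p₁) := isRegularEpi_comp hf₁ hp₁
  -- the composite relation
  let s₁ := pullback.fst d₂ (pullback.fst p₂ p₂ ≫ p₁)
  let s₂ := pullback.snd d₂ (pullback.fst p₂ p₂ ≫ p₁)
  have hs : s₁ ≫ d₂ = s₂ ≫ pullback.fst p₂ p₂ ≫ p₁ := pullback.condition
  have hs₁ : IsRegularEpi s₁ := inferInstance
  have hs₂ : IsRegularEpi s₂ := inferInstance
  obtain ⟨t, ht, -⟩ := hgood
  have hgood := hD.prop.2
  obtain ⟨c, hc, rfl⟩ := hA.lift s₁ hs₁ t ht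
  have hR₁ : R (A.map (s₁ ≫ d₁) c) (A.map (s₂ ≫ pullback.snd p₂ p₂ ≫ p₁) c) := by
    have h1 := hgood.rel hR (hc.map hA.flat hs₁)
    have h2 := hT.rel hR ((hc.map hA.flat hs₂).map hA.flat hf₁)
    have h3 := hT.rel hR ((hc.map hA.flat hs₂).map hA.flat hf₂)
    simp only [map_map, Category.assoc] at h1 h2 h3
    rw [← hd₁_def, ← hd₂_def, hs] at h1
    rw [pullback.condition] at h2
    exact hR.trans h1 (hR.trans h2 (hR.symm h3))
  obtain ⟨I, e, m, he, hm, hem⟩ :=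
    exists_isRegularEpi_mono_fac (prod.lift (s₁ ≫ d₁) (s₂ ≫ pullback.snd p₂ p₂ ≫ p₁))
  let D' : Subobject (W ⨯ W) := Subobject.mk m
  -- `D` is contained in the image `D'` of the composite relation
  have hDD' : D ≤ D' := by
    let h := pullback.fst d₂ p₁
    have hh : IsRegularEpi h := inferInstance
    let k : pullback d₂ p₁ ⟶ pullback d₂ (pullback.fst p₂ p₂ ≫ p₁) :=
      pullback.lift h (pullback.snd d₂ p₁ ≫ pullback.lift (𝟙 T) (𝟙 T) rfl) (by
        rw [Category.assoc, pullback.lift_fst_assoc, Category.id_comp]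
        exact pullback.condition)
    have hk₁ : k ≫ s₁ = h := pullback.lift_fst _ _ _
    have hk₂ : k ≫ s₂ = pullback.snd d₂ p₁ ≫ pullback.lift (𝟙 T) (𝟙 T) rfl :=
      pullback.lift_snd _ _ _
    have sq : CommSq (k ≫ e) h m D.arrow := by
      refine ⟨?_⟩
      rw [Category.assoc, hem]
      apply prod.hom_ext
      · rw [Category.assoc, prod.lift_fst, ← Category.assoc, hk₁, Category.assoc]
      · rw [Category.assoc, prod.lift_snd, ← Category.assoc, hk₂, Category.assoc,
          pullback.lift_snd_assoc, Category.id_comp, Category.assoc]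
        exact pullback.condition.symm
    exact Subobject.le_mk_of_comm sq.lift sq.fac_right
  have hD' : D' ∈ goodReflexive R := by
    refine ⟨⟨r ≫ Subobject.ofLE _ _ hDD', by rw [Category.assoc, Subobject.ofLE_arrow, hr]⟩, ?_⟩
    let i := (Subobject.underlyingIso m).inv
    have hi : i ≫ D'.arrow = m := Subobject.underlyingIso_arrow m
    have hiE : IsRegularEpi (e ≫ i) := isRegularEpi_comp he (Regular.isRegularEpi_of_extremalEpi _)
    refine ⟨A.map (e ≫ i) c, hc.map hA.flat hiE, ?_⟩
    rw [map_map, map_map]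
    have hei : (e ≫ i) ≫ D'.arrow = prod.lift (s₁ ≫ d₁) (s₂ ≫ pullback.snd p₂ p₂ ≫ p₁) := by
      rw [Category.assoc, hi, hem]
    rw [← Category.assoc, ← Category.assoc, hei, prod.lift_fst, prod.lift_snd]
    exact hR₁
  have hle : D' ≤ D := hD.le_of_ge hD' hDD'
  let k : pullback p₂ p₂ ⟶ pullback d₂ (pullback.fst p₂ p₂ ≫ p₁) :=
    pullback.lift ((pullback.fst p₂ p₂ ≫ p₁) ≫ r) (𝟙 _) (by
      rw [Category.assoc, hr₂, Category.comp_id, Category.id_comp])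
  have hk₁ : k ≫ s₁ = (pullback.fst p₂ p₂ ≫ p₁) ≫ r := pullback.lift_fst _ _ _
  have hk₂ : k ≫ s₂ = 𝟙 _ := pullback.lift_snd _ _ _
  have harr : (k ≫ e ≫ Subobject.ofMkLE m D hle) ≫ D.arrow =
      prod.lift (pullback.fst p₂ p₂ ≫ p₁) (pullback.snd p₂ p₂ ≫ p₁) := by
    rw [Category.assoc, Category.assoc, Subobject.ofMkLE_arrow, hem]
    apply prod.hom_ext
    · rw [Category.assoc, prod.lift_fst, prod.lift_fst, ← Category.assoc, hk₁, Category.assoc, hr₁,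
        Category.comp_id]
    · rw [Category.assoc, prod.lift_snd, prod.lift_snd, ← Category.assoc, hk₂, Category.id_comp]
  refine ⟨k ≫ e ≫ Subobject.ofMkLE m D hle, ?_, ?_⟩
  · exact (Category.assoc _ _ _).symm.trans (by rw [harr, prod.lift_fst])
  · exact (Category.assoc _ _ _).symm.trans (by rw [harr, prod.lift_snd])

/-- In an exact category, an invariant relation on the generic elements of `W` contains the
relation of having the same image in a suitable quotient `X` of `W`, in such a way that each class
has finite image in `X`. -/
theorem InvariantRel.exists_quotient (hexact : EquivalenceRelationsEffective E)
    (hfin : FinitelyPowered E) (hA : IsRich l A) (hR : InvariantRel A R)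
    {w₀ : A.obj W} (hw₀ : IsGeneric A w₀) :
    ∃ (X : E) (q : W ⟶ X), IsRegularEpi q ∧
      (∀ a b, IsGeneric A a → IsGeneric A b → A.map q a = A.map q b → R a b) ∧
      ∀ a, {x | ∃ b, R a b ∧ A.map q b = x}.Finite := by
  have := hfin (W ⨯ W)
  have hne : (goodReflexive R).Nonempty := by
    refine ⟨Subobject.mk (prod.lift (𝟙 W) (𝟙 W)),
      ⟨(Subobject.underlyingIso _).inv, Subobject.underlyingIso_arrow _⟩,
      A.map (Subobject.underlyingIso _).inv w₀,
      hw₀.map hA.flat (Regular.isRegularEpi_of_extremalEpi _), ?_⟩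
    rw [map_map, map_map, ← Category.assoc, ← Category.assoc, Subobject.underlyingIso_arrow,
      prod.lift_fst, prod.lift_snd]
    simpa using hR.refl hw₀
  obtain ⟨D, hD⟩ := (goodReflexive R).toFinite.exists_maximal hne
  obtain ⟨⟨r, hr⟩, hgood⟩ := hD.prop
  set d₁ := D.arrow ≫ prod.fst with hd₁_def
  set d₂ := D.arrow ≫ prod.snd with hd₂_def
  have hr₁ : r ≫ d₁ = 𝟙 W := by rw [hd₁_def, ← Category.assoc, hr, prod.lift_fst]
  have hr₂ : r ≫ d₂ = 𝟙 W := by rw [hd₂_def, ← Category.assoc, hr, prod.lift_snd]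
  have hgood' : IsGoodSpan R d₂ d₁ := by
    obtain ⟨t, ht, h⟩ := hgood
    exact ⟨t, ht, hR.symm h⟩
  -- `D` is symmetric and transitive
  obtain ⟨j, hj₁, hj₂⟩ := exists_factor_of_maximal hA hR hD hgood'
  rw [← hd₁_def] at hj₁
  rw [← hd₂_def] at hj₂
  let s : (D : E) ⟶ D := pullback.lift (𝟙 _) (d₁ ≫ r) (by
    rw [Category.assoc, hr₁, Category.comp_id, Category.id_comp]) ≫ j
  have hs₁ : s ≫ d₁ = d₂ := by
    rw [Category.assoc, hj₁, pullback.lift_fst_assoc, Category.id_comp]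
  have hs₂ : s ≫ d₂ = d₁ := by
    rw [Category.assoc, hj₂, pullback.lift_snd_assoc, Category.assoc, hr₂, Category.comp_id]
  let t : pullback d₂ d₁ ⟶ D :=
    pullback.lift (pullback.fst d₂ d₁ ≫ s) (pullback.snd d₂ d₁) (by
      rw [Category.assoc, hs₁, pullback.condition]) ≫ j
  have ht₁ : t ≫ d₁ = pullback.fst d₂ d₁ ≫ d₁ := by
    rw [Category.assoc, hj₁, pullback.lift_fst_assoc, Category.assoc, hs₂]
  have ht₂ : t ≫ d₂ = pullback.snd d₂ d₁ ≫ d₂ := by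
    rw [Category.assoc, hj₂, pullback.lift_snd_assoc]
  have heq : EquivalenceRelation d₁ d₂ :=
    { right_cancellation := fun Y f g h₁ h₂ => by
        rw [← cancel_mono D.arrow]
        apply prod.hom_ext
        · simpa [hd₁_def] using h₁
        · simpa [hd₂_def] using h₂
      r := r
      reflexivity₁ := hr₁
      reflexivity₂ := hr₂
      s := s
      symmetry₁ := hs₁
      symmetry₂ := hs₂
      c := PullbackCone.mk _ _ pullback.condition
      isLimit := pullbackIsPullback d₂ d₁
      t := t
      transitivity₁ := ht₁
      transitivity₂ := ht₂ }
  obtain ⟨Y, f, hf⟩ := hexact d₁ d₂ heq.isEquivalenceRelation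
  obtain ⟨X, q, m, hq, hm, rfl⟩ := exists_isRegularEpi_mono_fac f
  have hqw : d₁ ≫ q = d₂ ≫ q := by
    rw [← cancel_mono m]
    simpa using hf.w
  have hker : IsPullback d₁ d₂ q q := IsKernelPair.cancel_right_of_mono hf
  refine ⟨X, q, hq, fun a b ha hb hab => ?_, fun a => ?_⟩
  · obtain ⟨t, ht, h⟩ := hgood
    refine hR.of_generic_pair hfin hA hq (c := A.map hker.isoPullback.hom t)
      (ht.map hA.flat (Regular.isRegularEpi_of_extremalEpi _)) ?_ ha hb hab
    simpa only [map_map, IsPullback.isoPullback_hom_fst, IsPullback.isoPullback_hom_snd] using h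
  · have := finite_hom hfin W X
    refine (Set.finite_range (fun g : W ⟶ X => A.map g a)).subset ?_
    rintro _ ⟨b, hab, rfl⟩
    obtain ⟨T, t, p₁, p₂, ht, rfl, rfl⟩ := hA.flat.exists_generic_dominate hfin a b
    have hT : IsGoodSpan R p₂ p₁ := ⟨t, ht, hR.symm hab⟩
    have hp₁ := (hT.regularEpi hR).2
    -- `p₂ ≫ q` factors through the quotient `p₁` of `T`
    obtain ⟨j, hj₁, hj₂⟩ := exists_factor_of_maximal hA hR hD hT
    rw [← hd₁_def] at hj₁
    rw [← hd₂_def] at hj₂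
    have hcoeq : pullback.fst p₁ p₁ ≫ p₂ ≫ q = pullback.snd p₁ p₁ ≫ p₂ ≫ q := by
      rw [← Category.assoc, ← Category.assoc, ← hj₁, ← hj₂, Category.assoc j d₁ q,
        Category.assoc j d₂ q, hqw]
    obtain ⟨g, hg⟩ := IsRegularEpi.exists_of_isKernelPair p₁ (.of_hasPullback p₁) _ hcoeq
    exact ⟨g, by dsimp only; rw [map_map, map_map, hg]⟩

end InvariantRel

/-! ### Pro-objects as flat functors -/

namespace ProObj

section

variable {C : Type u} [Category.{v} C]

/-- The functor `Hom(P, -)` of points of a pro-object `P`. -/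
abbrev points (P : ProObj.{w} C) : C ⥤ Type (max w v) := (homBifunctor C).obj (op P)

lemma points_isFlat (P : ProObj.{w} C) : IsFlat P.points where
  nonempty := ⟨_, ⟨HomTo.mk P (Classical.choice IsCofiltered.nonempty) (𝟙 _)⟩⟩
  dominate a b := by
    obtain ⟨i, f, rfl⟩ := HomTo.ind a
    obtain ⟨j, g, rfl⟩ := HomTo.ind b
    obtain ⟨k, s, t, -⟩ := IsCofilteredOrEmpty.cone_objs i j
    refine ⟨P.diag.obj k, HomTo.mk P k (𝟙 _), P.diag.map s ≫ f, P.diag.map t ≫ g, ?_, ?_⟩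
    · exact (HomTo.mk_eq_iff _ _).2 ⟨k, 𝟙 _, s, by simp⟩
    · exact (HomTo.mk_eq_iff _ _).2 ⟨k, 𝟙 _, t, by simp⟩
  equalize {X Y} f g a h := by
    obtain ⟨i, p, rfl⟩ := HomTo.ind a
    obtain ⟨k, s, t, e⟩ := (HomTo.mk_eq_iff _ _).1 (show HomTo.mk P i (p ≫ f) = HomTo.mk P i (p ≫ g)
      from h)
    obtain ⟨m, r, hr⟩ := IsCofilteredOrEmpty.cone_maps s t
    refine ⟨P.diag.obj m, HomTo.mk P m (𝟙 _), P.diag.map (r ≫ s) ≫ p, ?_, ?_⟩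
    · exact (HomTo.mk_eq_iff _ _).2 ⟨m, 𝟙 _, r ≫ s, by simp⟩
    · rw [Category.assoc, Category.assoc]
      conv_rhs => rw [hr]
      rw [P.diag.map_comp, P.diag.map_comp, Category.assoc, Category.assoc, e]

/-- The canonical morphism from a pro-object `P = (P_j)` to `P_j`. -/
def proj (P : ProObj.{w} C) (j : P.J) : P.points.obj (P.diag.obj j) := HomTo.mk P j (𝟙 _)

lemma map_proj (P : ProObj.{w} C) {j : P.J} {X : C} (f : P.diag.obj j ⟶ X) :
    P.points.map f (P.proj j) = HomTo.mk P j f := by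
  change HomTo.mk P j (𝟙 _ ≫ f) = _
  rw [Category.id_comp]

lemma map_map_proj (P : ProObj.{w} C) {i j : P.J} (a : i ⟶ j) :
    P.points.map (P.diag.map a) (P.proj i) = P.proj j := by
  rw [map_proj]
  exact (HomTo.mk_eq_iff _ _).2 ⟨i, 𝟙 _, a, by simp⟩

lemma exists_map_proj {P : ProObj.{w} C} {X : C} (x : P.points.obj X) :
    ∃ (j : P.J) (f : P.diag.obj j ⟶ X), P.points.map f (P.proj j) = x := by
  obtain ⟨j, f, rfl⟩ := HomTo.ind x
  exact ⟨j, f, map_proj P f⟩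

/-- The morphism of pro-objects given by a map between the functors of points. -/
def homOfNatTrans {P Q : ProObj.{w} C} (s : Q.points ⟶ P.points) : P ⟶ Q where
  app k := s.app _ (Q.proj k)
  compat {k k'} a := by
    refine (NatTrans.naturality_apply s (Q.diag.map a) (Q.proj k)).symm.trans ?_
    rw [map_map_proj]

lemma homOfNatTrans_pull {P Q : ProObj.{w} C} (s : Q.points ⟶ P.points) {X : C} (x : Q.HomTo X) :
    Hom.pull (homOfNatTrans s) x = s.app X x := by
  obtain ⟨j, f, rfl⟩ := exists_map_proj (P := Q) x
  refine Eq.trans ?_ (NatTrans.naturality_apply s f (Q.proj j)).symm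
  rw [map_proj]
  rfl

lemma hom_ext_pull {P Q : ProObj.{w} C} {s t : P ⟶ Q}
    (h : ∀ (X : C) (x : Q.HomTo X), Hom.pull s x = Hom.pull t x) : s = t := by
  refine Hom.ext (funext fun k => ?_)
  have := h _ (HomTo.mk Q k (𝟙 _))
  rwa [Hom.pull_mk, Hom.pull_mk, HomTo.post_id, HomTo.post_id] at this

/-- The isomorphism of pro-objects given by an isomorphism between the functors of points. -/
def isoOfNatIso {P Q : ProObj.{w} C} (s : Q.points ≅ P.points) : P ≅ Q where
  hom := homOfNatTrans s.hom
  inv := homOfNatTrans s.inv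
  hom_inv_id := hom_ext_pull fun X x => by
    refine (Hom.pull_comp _ _ x).trans ?_
    rw [homOfNatTrans_pull, homOfNatTrans_pull]
    exact (s.inv_hom_id_app_apply X x).trans (Hom.pull_id P x).symm
  inv_hom_id := hom_ext_pull fun X x => by
    refine (Hom.pull_comp _ _ x).trans ?_
    rw [homOfNatTrans_pull, homOfNatTrans_pull]
    exact (s.hom_inv_id_app_apply X x).trans (Hom.pull_id Q x).symm

/-- The image of a morphism `P ⟶ X` under a functor. -/
def HomTo.push {D : Type u₁} [Category.{v₁} D] (F : C ⥤ D) {P : ProObj.{w} C} {X : C}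
    (x : P.HomTo X) : (P.push F).HomTo (F.obj X) :=
  Quotient.map (fun p => ⟨p.1, F.map p.2⟩) (by
    rintro ⟨i, p⟩ ⟨j, q⟩ ⟨k, a, b, h⟩
    refine ⟨k, a, b, ?_⟩
    dsimp only [ProObj.push, Functor.comp_map] at h ⊢
    rw [← F.map_comp, h, F.map_comp]) x

variable {D : Type u₁} [Category.{v₁} D] (F : C ⥤ D)

@[simp]
lemma HomTo.push_mk {P : ProObj.{w} C} {X : C} (j : P.J) (f : P.diag.obj j ⟶ X) :
    (HomTo.mk P j f).push F = HomTo.mk (P.push F) j (F.map f) := rfl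

lemma HomTo.push_post {P : ProObj.{w} C} {X Y : C} (f : X ⟶ Y) (x : P.HomTo X) :
    (x.post f).push F = (x.push F).post (F.map f) := by
  obtain ⟨j, g, rfl⟩ := HomTo.ind x
  rw [HomTo.post_mk, HomTo.push_mk, HomTo.push_mk, F.map_comp]
  rfl

/-- The image of a morphism of pro-objects under a functor. -/
def Hom.push {P Q : ProObj.{w} C} (s : P ⟶ Q) : P.push F ⟶ Q.push F where
  app k := (Hom.app s k).push F
  compat a := by
    rw [← Hom.compat s a]
    exact (HomTo.push_post F _ _).symm

lemma Hom.push_pull {P Q : ProObj.{w} C} (s : P ⟶ Q) {X : C} (x : Q.HomTo X) :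
    Hom.pull (Hom.push F s) (x.push F) = (Hom.pull s x).push F := by
  obtain ⟨j, g, rfl⟩ := HomTo.ind x
  exact (HomTo.push_post F _ _).symm

/-- The image of an isomorphism of pro-objects under a functor. -/
def pushIso {P Q : ProObj.{w} C} (s : P ≅ Q) : P.push F ≅ Q.push F where
  hom := Hom.push F s.hom
  inv := Hom.push F s.inv
  hom_inv_id := by
    refine Hom.ext (funext fun k => ?_)
    change Hom.pull (Hom.push F s.hom) ((Hom.app s.inv k).push F) = _
    rw [Hom.push_pull]
    change (Hom.app (s.hom ≫ s.inv) k).push F = _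
    rw [s.hom_inv_id]
    exact congrArg (HomTo.mk (P.push F) k) (F.map_id _)
  inv_hom_id := by
    refine Hom.ext (funext fun k => ?_)
    change Hom.pull (Hom.push F s.inv) ((Hom.app s.hom k).push F) = _
    rw [Hom.push_pull]
    change (Hom.app (s.inv ≫ s.hom) k).push F = _
    rw [s.inv_hom_id]
    exact congrArg (HomTo.mk (Q.push F) k) (F.map_id _)

end

variable {E : Type u} [Category.{v} E] [Regular E] {l : Subobject (⊤_ E)}

omit [Regular E] in
lemma _root_.ProOlig.IsGeneric.iso_iff {A B : E ⥤ Type w} (s : A ≅ B) {X : E} (a : A.obj X) :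
    IsGeneric B (s.hom.app X a) ↔ IsGeneric A a := by
  constructor
  · intro h Y f b hb
    refine h f (s.hom.app Y b) ?_
    rw [← NatTrans.naturality_apply, hb]
  · intro h Y f b hb
    refine h f (s.inv.app Y b) ?_
    rw [← NatTrans.naturality_apply, hb, s.hom_inv_id_app_apply]

/-- Among the morphisms from a pro-object with surjective transition maps, the generic ones are the
surjections. -/
lemma HomTo.isSurj_iff_isGeneric {P : ProObj.{w} E}
    (hP : ∀ {i j : P.J} (a : i ⟶ j), IsRegularEpi (P.diag.map a)) {X : E} (x : P.HomTo X) :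
    x.IsSurj ↔ IsGeneric P.points (X := X) x := by
  constructor
  · rintro ⟨j, g, hg, rfl⟩ Y f b h
    obtain ⟨i, p, rfl⟩ := HomTo.ind b
    obtain ⟨k, s, t, e⟩ := (HomTo.mk_eq_iff _ _).1
      (show HomTo.mk P i (p ≫ f) = HomTo.mk P j g from h)
    have h1 := isRegularEpi_comp (hP t) hg
    rw [← e, ← Category.assoc] at h1
    exact isRegularEpi_of_comp h1
  · intro h
    obtain ⟨j, f, rfl⟩ := exists_map_proj (P := P) x
    exact ⟨j, f, h f _ rfl, (map_proj P f).symm⟩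

lemma isRegularEpi_push_map (P : ProObj.{w} (SurjOfType l)) {i j : P.J} (a : i ⟶ j) :
    IsRegularEpi ((P.push (SurjOfType.incl l)).diag.map a) :=
  (P.diag.map a).hom.property

/-- The morphism in `E^s_λ` given by a surjection. -/
def surjMk {X Y : SurjOfType l} (f : X.obj.obj ⟶ Y.obj.obj) (hf : IsRegularEpi f) : X ⟶ Y :=
  ObjectProperty.homMk ⟨f, hf⟩

lemma HomTo.push_injective (P : ProObj.{w} (SurjOfType l)) (X : SurjOfType l) :
    Function.Injective (HomTo.push (SurjOfType.incl l) : P.HomTo X → _) := by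
  intro x y h
  obtain ⟨i, f, rfl⟩ := HomTo.ind x
  obtain ⟨j, g, rfl⟩ := HomTo.ind y
  obtain ⟨k, s, t, e⟩ := (HomTo.mk_eq_iff _ _).1 h
  refine (HomTo.mk_eq_iff _ _).2 ⟨k, s, t, ?_⟩
  exact (SurjOfType.incl l).map_injective e

lemma HomTo.push_isGeneric (P : ProObj.{w} (SurjOfType l)) {X : SurjOfType l} (x : P.HomTo X) :
    IsGeneric (P.push (SurjOfType.incl l)).points (x.push (SurjOfType.incl l)) := by
  rw [← HomTo.isSurj_iff_isGeneric (isRegularEpi_push_map P)]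
  obtain ⟨i, f, rfl⟩ := HomTo.ind x
  exact ⟨i, _, f.hom.property, rfl⟩

lemma objType_eq_of_isGeneric (P : ProObj.{w} (SurjOfType l)) {X : E}
    (x : (P.push (SurjOfType.incl l)).points.obj X)
    (hx : IsGeneric (P.push (SurjOfType.incl l)).points x) : objType X = l := by
  obtain ⟨j, f, hf, rfl⟩ := (HomTo.isSurj_iff_isGeneric (isRegularEpi_push_map P) x).2 hx
  exact (objType_eq_of_isRegularEpi hf).symm.trans (P.diag.obj j).property

lemma HomTo.exists_push_eq (P : ProObj.{w} (SurjOfType l)) {X : SurjOfType l}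
    (x : (P.push (SurjOfType.incl l)).points.obj X.obj.obj)
    (hx : IsGeneric (P.push (SurjOfType.incl l)).points x) :
    ∃ y : P.HomTo X, y.push (SurjOfType.incl l) = x := by
  obtain ⟨j, f, hf, rfl⟩ := (HomTo.isSurj_iff_isGeneric (isRegularEpi_push_map P) x).2 hx
  exact ⟨HomTo.mk P j (surjMk f hf), rfl⟩

/-- A universal homogeneous pro-object of `E^s_λ` gives a rich functor of points. -/
lemma isRich_points (P : ProObj.{w} (SurjOfType l)) (hU : P.IsUniversal) (hH : P.IsHomogeneous) :
    IsRich l (P.push (SurjOfType.incl l)).points where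
  flat := points_isFlat _
  objType_eq := objType_eq_of_isGeneric P
  lift {X Z} f hf a ha := by
    have hX := objType_eq_of_isGeneric P a ha
    let X' : SurjOfType l := ⟨⟨X⟩, hX⟩
    let Z' : SurjOfType l := ⟨⟨Z⟩, (objType_eq_of_isRegularEpi hf).trans hX⟩
    obtain ⟨x, rfl⟩ := HomTo.exists_push_eq P (X := X') a ha
    obtain ⟨z⟩ := hU Z'
    let f' : Z' ⟶ X' := surjMk f hf
    obtain ⟨s, rfl⟩ := hH X' (z.post f') x
    refine ⟨(Hom.pull s.hom z).push _, HomTo.push_isGeneric P _, ?_⟩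
    rw [Hom.pull_post]
    exact (HomTo.push_post _ f' _).symm

/-- The morphisms from `P` to `X` in `E^s_λ` are the generic elements of the functor of points in
`E`. -/
def surjEquiv (P : ProObj.{w} (SurjOfType l)) (X : SurjOfType l) :
    P.HomTo X ≃ {a : (P.push (SurjOfType.incl l)).points.obj X.obj.obj //
      IsGeneric (P.push (SurjOfType.incl l)).points a} :=
  Equiv.ofBijective (fun x => ⟨x.push _, HomTo.push_isGeneric P x⟩)
    ⟨fun _ _ h => HomTo.push_injective P X (congrArg Subtype.val h), fun a => by
      obtain ⟨y, hy⟩ := HomTo.exists_push_eq P a.1 a.2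
      exact ⟨y, Subtype.ext hy⟩⟩

lemma push_surjEquiv_symm (P : ProObj.{w} (SurjOfType l)) (X : SurjOfType l)
    (a : {a : (P.push (SurjOfType.incl l)).points.obj X.obj.obj //
      IsGeneric (P.push (SurjOfType.incl l)).points a}) :
    ((surjEquiv P X).symm a).push (SurjOfType.incl l) = a.1 :=
  congrArg Subtype.val ((surjEquiv P X).apply_symm_apply a)

/-- An automorphism of the functor of points, restricted to surjections. -/
def surjAut (P : ProObj.{w} (SurjOfType l))
    (s : (P.push (SurjOfType.incl l)).points ≅ (P.push (SurjOfType.incl l)).points) :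
    P.points ≅ P.points :=
  NatIso.ofComponents (fun X =>
    ((surjEquiv P X).trans (((s.app X.obj.obj).toEquiv.subtypeEquiv
      (fun a => (IsGeneric.iso_iff s a).symm)).trans (surjEquiv P X).symm)).toIso)
    (fun {X Y} f => by
      ext x
      apply HomTo.push_injective P Y
      refine (push_surjEquiv_symm P Y _).trans ?_
      refine Eq.trans ?_ (HomTo.push_post (SurjOfType.incl l) f _).symm
      refine Eq.trans ?_ (congrArg (HomTo.post ((SurjOfType.incl l).map f))
        (push_surjEquiv_symm P X _).symm)
      refine Eq.trans ?_ (NatTrans.naturality_apply s.hom ((SurjOfType.incl l).map f) _)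
      exact congrArg (s.hom.app _) (HomTo.push_post (SurjOfType.incl l) f x))

lemma push_surjAut (P : ProObj.{w} (SurjOfType l))
    (s : (P.push (SurjOfType.incl l)).points ≅ (P.push (SurjOfType.incl l)).points)
    {X : SurjOfType l} (x : P.HomTo X) :
    ((surjAut P s).hom.app X x).push (SurjOfType.incl l) =
      s.hom.app X.obj.obj (x.push (SurjOfType.incl l)) :=
  push_surjEquiv_symm P X _

/-- A pro-object of `E^s_λ` is universal and homogeneous if its functor of points is rich and has
enough automorphisms. -/
lemma isUniversal_and_isHomogeneous (hfin : FinitelyPowered E) (P : ProObj.{w} (SurjOfType l))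
    (hP : IsRich l (P.push (SurjOfType.incl l)).points)
    (hhom : ∀ {X : E} (x y : (P.push (SurjOfType.incl l)).points.obj X),
      IsGeneric (P.push (SurjOfType.incl l)).points x →
      IsGeneric (P.push (SurjOfType.incl l)).points y →
      ∃ s : (P.push (SurjOfType.incl l)).points ≅ (P.push (SurjOfType.incl l)).points,
        s.hom.app X x = y) : P.IsUniversal ∧ P.IsHomogeneous := by
  refine ⟨fun X => ?_, fun X x y => ?_⟩
  · obtain ⟨a, ha⟩ := hP.exists_generic_of_objType hfin X.property
    obtain ⟨y, -⟩ := HomTo.exists_push_eq P a ha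
    exact ⟨y⟩
  · obtain ⟨s, hs⟩ := hhom _ _ (HomTo.push_isGeneric P x) (HomTo.push_isGeneric P y)
    refine ⟨isoOfNatIso (surjAut P s), ?_⟩
    refine (homOfNatTrans_pull _ x).trans (HomTo.push_injective P X ?_)
    rw [← hs]
    exact push_surjAut P s x

end ProObj

/-! ### The action of `𝔐` on points -/

section Action

variable {E : Type u} [Category.{v} E] [Regular E] (Ω : ProFamily E)

/-- The functor `λ ↦ Hom(Ω_λ, -)`; the functor `𝔄` is obtained from it by exchanging the two
arguments. -/
abbrev pts : MCat Ω ⥤ E ⥤ Type (max u v) :=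
  inducedFunctor (fun l : Subobject (⊤_ E) => op (proInE Ω l)) ⋙ ProObj.homBifunctor E

variable {Ω}

/-- The action of a morphism of `𝔐` on points. -/
def act {l m : MCat Ω} (s : l ⟶ m) {X : E} (x : ((pts Ω).obj l).obj X) : ((pts Ω).obj m).obj X :=
  ((pts Ω).map s).app X x

lemma act_id (l : MCat Ω) {X : E} (x : ((pts Ω).obj l).obj X) : act (𝟙 l) x = x := by
  simp [act]

lemma act_act {l m n : MCat Ω} (s : l ⟶ m) (t : m ⟶ n) {X : E} (x : ((pts Ω).obj l).obj X) :
    act t (act s x) = act (s ≫ t) x := by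
  simp [act]

lemma map_act {l m : MCat Ω} (s : l ⟶ m) {X Y : E} (f : X ⟶ Y) (x : ((pts Ω).obj l).obj X) :
    ((pts Ω).obj m).map f (act s x) = act s (((pts Ω).obj l).map f x) :=
  (NatTrans.naturality_apply ((pts Ω).map s) f x).symm

lemma act_inv_act {l m : MCat Ω} (s : l ≅ m) {X : E} (x : ((pts Ω).obj l).obj X) :
    act s.inv (act s.hom x) = x := by
  rw [act_act, s.hom_inv_id, act_id]

lemma act_act_inv {l m : MCat Ω} (s : l ≅ m) {X : E} (x : ((pts Ω).obj m).obj X) :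
    act s.hom (act s.inv x) = x := by
  rw [act_act, s.inv_hom_id, act_id]

lemma isGeneric_act_iff {l m : MCat Ω} (s : l ≅ m) {X : E} (x : ((pts Ω).obj l).obj X) :
    IsGeneric ((pts Ω).obj m) (act s.hom x) ↔ IsGeneric ((pts Ω).obj l) x :=
  IsGeneric.iso_iff ((pts Ω).mapIso s) x

lemma hom_ext_act {l m : MCat Ω} {s t : l ⟶ m}
    (h : ∀ (X : E) (x : ((pts Ω).obj l).obj X), act s x = act t x) : s = t := by
  apply InducedCategory.hom_ext
  apply Quiver.Hom.unop_inj
  exact ProObj.hom_ext_pull h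

/-- Every natural map between functors of points is given by a morphism of `𝔐`. -/
lemma exists_act_eq {l m : MCat Ω} (s : (pts Ω).obj l ⟶ (pts Ω).obj m) :
    ∃ t : l ⟶ m, ∀ (X : E) (x : ((pts Ω).obj l).obj X), act t x = s.app X x :=
  ⟨InducedCategory.homMk (Quiver.Hom.op (ProObj.homOfNatTrans s)),
    fun _ x => ProObj.homOfNatTrans_pull s x⟩

lemma isSurjAt_iff {X : E} {l : MCat Ω} (x : ((setA Ω).obj X).obj l) :
    IsSurjAt Ω x ↔ IsGeneric ((pts Ω).obj l) (X := X) x :=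
  ProObj.HomTo.isSurj_iff_isGeneric (ProObj.isRegularEpi_push_map (Ω l)) _

lemma pts_flat (l : MCat Ω) : IsFlat ((pts Ω).obj l) := ProObj.points_isFlat _

lemma objType_eq {l : MCat Ω} {X : E} (x : ((pts Ω).obj l).obj X)
    (hx : IsGeneric ((pts Ω).obj l) x) : objType X = l :=
  ProObj.objType_eq_of_isGeneric (Ω l) x hx

lemma pts_rich (hΩ : Ω.IsUniversalHomogeneous) (l : MCat Ω) : IsRich l ((pts Ω).obj l) :=
  ProObj.isRich_points (Ω l) (hΩ l).1 (hΩ l).2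

/-- The group `𝔊_λ` acts transitively on the surjections `Ω_λ ⟶ X`. -/
lemma exists_aut (hΩ : Ω.IsUniversalHomogeneous) {l : MCat Ω} {X : E}
    {x y : ((pts Ω).obj l).obj X} (hx : IsGeneric ((pts Ω).obj l) x)
    (hy : IsGeneric ((pts Ω).obj l) y) : ∃ s : l ≅ l, act s.hom x = y := by
  have hX := objType_eq x hx
  let X' : SurjOfType l := ⟨⟨X⟩, hX⟩
  obtain ⟨x, rfl⟩ := ProObj.HomTo.exists_push_eq (Ω l) (X := X') x hx
  obtain ⟨y, rfl⟩ := ProObj.HomTo.exists_push_eq (Ω l) (X := X') y hy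
  obtain ⟨s, rfl⟩ := (hΩ l).2 X' x y
  refine ⟨InducedCategory.isoMk (ProObj.pushIso (SurjOfType.incl l) s).op, ?_⟩
  exact ProObj.Hom.push_pull (SurjOfType.incl l) s.hom x

lemma exists_generic (hΩ : Ω.IsUniversalHomogeneous) (hfin : FinitelyPowered E) {l : MCat Ω}
    {X : E} (hX : objType X = l) :
    ∃ x : ((pts Ω).obj l).obj X, IsGeneric ((pts Ω).obj l) x :=
  (pts_rich hΩ l).exists_generic_of_objType hfin hX

/-- An equivalence relation given by a map on the generic elements is invariant if it is invariant
under the group. -/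
lemma invariantRel_of_act (hΩ : Ω.IsUniversalHomogeneous) {l : MCat Ω} {W : E} {S : Type*}
    (f : ((pts Ω).obj l).obj W → S)
    (hf : ∀ (s : l ≅ l) (a b : ((pts Ω).obj l).obj W), IsGeneric _ a → IsGeneric _ b →
      f a = f b → f (act s.hom a) = f (act s.hom b)) :
    InvariantRel ((pts Ω).obj l) (fun a b => IsGeneric _ a ∧ IsGeneric _ b ∧ f a = f b) where
  generic h := h.1
  refl h := ⟨h, h, rfl⟩
  symm h := ⟨h.2.1, h.1, h.2.2.symm⟩
  trans h h' := ⟨h.1, h'.2.1, h.2.2.trans h'.2.2⟩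
  inv {T} p₁ p₂ t t' ht ht' h := by
    obtain ⟨s, rfl⟩ := exists_aut hΩ ht ht'
    rw [map_act, map_act]
    exact ⟨(isGeneric_act_iff s _).2 h.1, (isGeneric_act_iff s _).2 h.2.1, hf s _ _ h.1 h.2.1 h.2.2⟩

/-- The group `𝔊_λ` has finitely many orbits on `𝔄(X)_λ`: an orbit is determined by the smallest
subobject of `X` from which its points come. -/
lemma exists_orbit_invariant (hΩ : Ω.IsUniversalHomogeneous) (hfin : FinitelyPowered E)
    (l : MCat Ω) (X : E) : ∃ κ : ((pts Ω).obj l).obj X → Subobject X,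
      ∀ x y, κ x = κ y → ∃ s : l ≅ l, act s.hom x = y := by
  choose Y m b hm hb h using fun x : ((pts Ω).obj l).obj X => IsFlat.exists_generic hfin x
  refine ⟨fun x => Subobject.mk (m x), fun x y hxy => ?_⟩
  let i := Subobject.isoOfMkEqMk _ _ hxy
  have hi : i.hom ≫ m y = m x := Subobject.ofMkLEMk_comp _
  obtain ⟨s, hs⟩ := exists_aut hΩ ((hb x).map (pts_flat l) (f := i.hom)
    (Regular.isRegularEpi_of_extremalEpi _)) (hb y)
  refine ⟨s, ?_⟩
  rw [← h x, ← hi, ← map_map, ← map_act, hs, h]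

end Action

/-! ### Smooth `𝔐`-sets -/

section Smooth

variable {E : Type u} [Category.{v} E] [Regular E] (Ω : ProFamily E)

/-- The `𝔐`-sets `Z` such that each point `z` of `Z` is controlled by a point `x` of some `𝔄(X)`,
in the sense that `s z` only depends on `s x`. -/
def controlledStructure (hfin : FinitelyPowered E) : NonArchStructure.{max u v} (MCat Ω) where
  Smooth Z := ∀ (l : MCat Ω) (z : Z.obj l), ∃ (X : E) (x : ((pts Ω).obj l).obj X),
    ∀ (m : MCat Ω) (s t : l ⟶ m), act s x = act t x → Z.map s z = Z.map t z
  of_injective {Z Z'} f hf h l z := by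
    obtain ⟨X, x, hx⟩ := h l (f.app l z)
    refine ⟨X, x, fun m s t hst => hf m ?_⟩
    rw [NatTrans.naturality_apply, NatTrans.naturality_apply, hx m s t hst]
  of_surjective {Z Z'} f hf h l z := by
    obtain ⟨z, rfl⟩ := hf l z
    obtain ⟨X, x, hx⟩ := h l z
    refine ⟨X, x, fun m s t hst => ?_⟩
    rw [← NatTrans.naturality_apply, ← NatTrans.naturality_apply, hx m s t hst]
  sSup {Z} S h l z := by
    obtain ⟨z, hz⟩ := z
    rw [Subfunctor.sSup_obj] at hz
    obtain ⟨_, ⟨Y, hY, rfl⟩, hz⟩ := hz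
    obtain ⟨X, x, hx⟩ := h Y hY l ⟨z, hz⟩
    refine ⟨X, x, fun m s t hst => Subtype.ext ?_⟩
    have h' := congrArg Subtype.val (hx m s t hst)
    exact h'
  prod {ι} _ Z h l z := by
    choose X x hx using fun i => h i l ((Pi.π Z i).app l z)
    obtain ⟨X₀, ⟨x₀⟩⟩ := (pts_flat l).nonempty
    obtain ⟨Y, y, -, f, -, -, hf⟩ := (pts_flat l).exists_generic_dominate_finite hfin x₀ X x
    refine ⟨Y, y, fun m s t hst => ?_⟩
    refine Concrete.isLimit_ext _ (isLimitOfPreserves ((evaluation _ _).obj m)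
      (limit.isLimit (Discrete.functor Z))) _ _ ?_
    rintro ⟨i⟩
    change (Pi.π Z i).app m _ = (Pi.π Z i).app m _
    rw [NatTrans.naturality_apply, NatTrans.naturality_apply]
    refine hx i m s t ?_
    rw [← hf, ← map_act, ← map_act, hst]

lemma smooth_setA (X : E) : (nonArch Ω).Smooth ((setA Ω).obj X) :=
  fun _ hN => hN _ ⟨X, rfl⟩

lemma nonArch_controlled (hfin : FinitelyPowered E) {Z : MCat Ω ⥤ Type (max u v)}
    (hZ : (nonArch Ω).Smooth Z) (l : MCat Ω) (z : Z.obj l) : ∃ (X : E) (x : ((pts Ω).obj l).obj X),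
      ∀ (m : MCat Ω) (s t : l ⟶ m), act s x = act t x → Z.map s z = Z.map t z :=
  hZ (controlledStructure Ω hfin) (by
    rintro _ ⟨X, rfl⟩ l x
    exact ⟨X, x, fun m s t h => h⟩) l z

/-- The controlling point can be taken to be a surjection. -/
lemma exists_generic_control (hfin : FinitelyPowered E) {Z : MCat Ω ⥤ Type (max u v)}
    (hZ : (nonArch Ω).Smooth Z) {l : MCat Ω} (z : Z.obj l) :
    ∃ (X : E) (x : ((pts Ω).obj l).obj X), IsGeneric _ x ∧
      ∀ (m : MCat Ω) (s t : l ⟶ m), act s x = act t x → Z.map s z = Z.map t z := by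
  obtain ⟨X, x, hx⟩ := nonArch_controlled Ω hfin hZ l z
  obtain ⟨Y, m, y, -, hy, rfl⟩ := IsFlat.exists_generic hfin x
  refine ⟨Y, y, hy, fun n s t h => hx n s t ?_⟩
  rw [← map_act, ← map_act, h]

end Smooth

/-! ### The topology of the groups `𝔊_λ` -/

section Topology

variable {E : Type u} [Category.{v} E] [Regular E] {Ω : ProFamily E}

lemma aut_mul_act {l : MCat Ω} (s t : Aut l) {X : E} (x : ((pts Ω).obj l).obj X) :
    act (s * t).hom x = act s.hom (act t.hom x) := (act_act _ _ _).symm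

lemma aut_inv_act_eq_iff {l : MCat Ω} (s : Aut l) {X : E} (x y : ((pts Ω).obj l).obj X) :
    act (s⁻¹).hom x = y ↔ act s.hom y = x := by
  constructor
  · rintro rfl
    exact act_act_inv s x
  · rintro rfl
    exact act_inv_act s y

/-- The sets `{t | t x = s x}`, with `x` a surjection, form a neighborhood basis of `s`. -/
lemma isOpen_surjTopology_iff (hfin : FinitelyPowered E) {l : MCat Ω} {U : Set (Aut l)} :
    IsOpen[surjTopology Ω l] U ↔ ∀ s ∈ U, ∃ (X : E) (x : ((pts Ω).obj l).obj X),
      IsGeneric _ x ∧ ∀ t : Aut l, act t.hom x = act s.hom x → t ∈ U := by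
  constructor
  · intro h
    induction h with
    | basic U hU =>
      obtain ⟨X, x, y, hx, hy, rfl⟩ := hU
      exact fun s hs => ⟨X, x, (isSurjAt_iff x).1 hx, fun t ht => ht.trans hs⟩
    | univ =>
      obtain ⟨X, ⟨x⟩⟩ := (pts_flat l).nonempty
      obtain ⟨Y, m, y, -, hy, -⟩ := IsFlat.exists_generic hfin x
      exact fun _ _ => ⟨Y, y, hy, fun _ _ => trivial⟩
    | inter U V _ _ hU hV =>
      rintro s ⟨hs, hs'⟩
      obtain ⟨X, x, -, hx⟩ := hU s hs
      obtain ⟨Y, y, -, hy⟩ := hV s hs'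
      obtain ⟨Z, z, f, g, hz, rfl, rfl⟩ := (pts_flat l).exists_generic_dominate hfin x y
      refine ⟨Z, z, hz, fun t ht => ⟨hx t ?_, hy t ?_⟩⟩
      · rw [← map_act, ht, map_act]
      · rw [← map_act, ht, map_act]
    | sUnion S _ ih =>
      rintro s ⟨U, hU, hs⟩
      obtain ⟨X, x, hx, h⟩ := ih U hU s hs
      exact ⟨X, x, hx, fun t ht => ⟨U, hU, h t ht⟩⟩
  · intro h
    have hU : U = ⋃₀ {V | IsOpen[surjTopology Ω l] V ∧ V ⊆ U} := by
      apply Set.Subset.antisymm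
      · intro s hs
        obtain ⟨X, x, hx, hxU⟩ := h s hs
        refine ⟨{t : Aut l | act t.hom x = act s.hom x}, ⟨?_, hxU⟩, rfl⟩
        exact .basic _ ⟨X, x, act s.hom x, (isSurjAt_iff x).2 hx,
          (isSurjAt_iff _).2 ((isGeneric_act_iff s x).2 hx), rfl⟩
      · exact Set.sUnion_subset fun V hV => hV.2
    rw [hU]
    exact .sUnion _ fun V hV => hV.1

lemma isOpen_setOf_act_eq (hfin : FinitelyPowered E) {l : MCat Ω} {X : E}
    (x y : ((pts Ω).obj l).obj X) : IsOpen[surjTopology Ω l] {s : Aut l | act s.hom x = y} := by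
  rw [isOpen_surjTopology_iff hfin]
  rintro s rfl
  obtain ⟨Y, m, z, -, hz, rfl⟩ := IsFlat.exists_generic hfin x
  refine ⟨Y, z, hz, fun t ht => ?_⟩
  change act t.hom _ = act s.hom _
  rw [← map_act, ht, map_act]

/-- The topology induced by all smooth `𝔐`-sets agrees with the one defined by surjections. -/
lemma autTopology_eq (hfin : FinitelyPowered E) (l : MCat Ω) :
    (nonArch Ω).autTopology l = surjTopology Ω l := by
  apply le_antisymm
  · apply le_generateFrom
    rintro _ ⟨X, x, y, -, -, rfl⟩
    exact .basic _ ⟨_, smooth_setA Ω X, x, y, rfl⟩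
  · apply le_generateFrom
    rintro _ ⟨Z, hZ, z, z', rfl⟩
    rw [isOpen_surjTopology_iff hfin]
    rintro s rfl
    obtain ⟨X, x, hx, h⟩ := exists_generic_control Ω hfin hZ z
    exact ⟨X, x, hx, fun t ht => h l t.hom s.hom ht⟩

/-- The stabilizer of a point. -/
def stab {l : MCat Ω} {X : E} (x : ((pts Ω).obj l).obj X) : Subgroup (Aut l) where
  carrier := {s | act s.hom x = x}
  mul_mem' {s t} hs ht := by
    change act (s * t).hom x = x
    rw [aut_mul_act, show act t.hom x = x from ht, show act s.hom x = x from hs]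
  one_mem' := act_id l x
  inv_mem' {s} hs := (aut_inv_act_eq_iff s x x).2 hs

lemma isProOligomorphicGroup_surjTopology (hΩ : Ω.IsUniversalHomogeneous) (hfin : FinitelyPowered E)
    (l : MCat Ω) : @IsProOligomorphicGroup (Aut l) _ (surjTopology Ω l) := by
  let T := surjTopology Ω l
  have hgrp : IsTopologicalGroup (Aut l) :=
    { continuous_mul := by
        refine continuous_generateFrom_iff.2 ?_
        rintro _ ⟨X, x, y, hx, hy, rfl⟩
        rw [isOpen_prod_iff]
        intro s t hst
        refine ⟨{s | act s.hom (act t.hom x) = y}, {t' | act t'.hom x = act t.hom x},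
          isOpen_setOf_act_eq hfin _ _, isOpen_setOf_act_eq hfin _ _, ?_, rfl, ?_⟩
        · exact (aut_mul_act s t x).symm.trans hst
        · rintro ⟨s', t'⟩ ⟨hs', ht'⟩
          exact (aut_mul_act s' t' x).trans ((congrArg (act s'.hom) ht').trans hs')
      continuous_inv := by
        refine continuous_generateFrom_iff.2 ?_
        rintro _ ⟨X, x, y, hx, hy, rfl⟩
        convert isOpen_setOf_act_eq hfin y x using 1
        ext s
        exact aut_inv_act_eq_iff s x y }
  refine ⟨⟨fun s t hst => ?_⟩, ⟨fun U hU => ?_⟩, fun U V hU hV => ?_⟩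
  · obtain ⟨X, x, hx⟩ : ∃ (X : E) (x : ((pts Ω).obj l).obj X), act s.hom x ≠ act t.hom x := by
      by_contra! h
      exact hst (Aut.ext (hom_ext_act h))
    refine ⟨{r | act r.hom x = act s.hom x}, {r | act r.hom x = act t.hom x},
      isOpen_setOf_act_eq hfin _ _, isOpen_setOf_act_eq hfin _ _, rfl, rfl, ?_⟩
    rw [Set.disjoint_left]
    exact fun r hr hr' => hx (hr.symm.trans hr')
  · obtain ⟨V, hVU, hV, h1⟩ := mem_nhds_iff.1 hU
    obtain ⟨X, x, hx, h⟩ := (isOpen_surjTopology_iff hfin).1 hV 1 h1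
    refine ⟨⟨stab x, isOpen_setOf_act_eq hfin x x⟩, fun s hs => hVU (h s ?_)⟩
    exact (show act s.hom x = x from hs).trans (act_id l x).symm
  · obtain ⟨X, x, -, hx⟩ := (isOpen_surjTopology_iff hfin).1 hU 1 U.one_mem
    obtain ⟨Y, y, -, hy⟩ := (isOpen_surjTopology_iff hfin).1 hV 1 V.one_mem
    obtain ⟨Z, z, f, g, hz, rfl, rfl⟩ := (pts_flat l).exists_generic_dominate hfin x y
    have hU' : ∀ s : Aut l, act s.hom z = z → s ∈ U := fun s hs => hx s (by
      rw [← map_act, ← map_act, hs]; congr 1; exact (act_id l z).symm)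
    have hV' : ∀ s : Aut l, act s.hom z = z → s ∈ V := fun s hs => hy s (by
      rw [← map_act, ← map_act, hs]; congr 1; exact (act_id l z).symm)
    -- the double coset of `s` is determined by the orbit of the pair `(z, s z)`
    have hpair : ∀ s : Aut l, ∃ c : ((pts Ω).obj l).obj (Z ⨯ Z),
        ((pts Ω).obj l).map prod.fst c = z ∧ ((pts Ω).obj l).map prod.snd c = act s.hom z := by
      intro s
      obtain ⟨W, d, p, q, hp, hq⟩ := (pts_flat l).dominate z (act s.hom z)
      refine ⟨((pts Ω).obj l).map (prod.lift p q) d, ?_, ?_⟩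
      · rw [map_map, prod.lift_fst, hp]
      · rw [map_map, prod.lift_snd, hq]
    choose c hc₁ hc₂ using hpair
    obtain ⟨κ, hκ⟩ := exists_orbit_invariant hΩ hfin l (Z ⨯ Z)
    have := hfin (Z ⨯ Z)
    have key : ∀ s t : Aut l, κ (c s) = κ (c t) →
        DoubleCoset.mk U V s = DoubleCoset.mk U V t := by
      intro s t hst
      obtain ⟨r, hr⟩ := hκ _ _ hst
      have h₁ : act r.hom z = z := by
        have := congrArg (((pts Ω).obj l).map prod.fst) hr
        rwa [map_act, hc₁, hc₁] at this
      have h₂ : act r.hom (act s.hom z) = act t.hom z := by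
        have := congrArg (((pts Ω).obj l).map prod.snd) hr
        rwa [map_act, hc₂, hc₂] at this
      let r' : Aut l := r
      rw [DoubleCoset.eq]
      refine ⟨r', hU' r h₁, (r' * s)⁻¹ * t, hV' _ ?_, by group⟩
      rw [aut_mul_act, aut_inv_act_eq_iff, aut_mul_act]
      exact h₂
    refine Finite.of_injective (fun q : DoubleCoset.Quotient (U : Set (Aut l)) V => κ (c q.out)) ?_
    intro q q' h
    rw [← DoubleCoset.out_eq' U V q, ← DoubleCoset.out_eq' U V q']
    exact key _ _ h

lemma isProOligomorphic_nonArch (hΩ : Ω.IsUniversalHomogeneous) (hfin : FinitelyPowered E) :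
    IsProOligomorphic (nonArch Ω) where
  hausdorff l m s t hst := by
    obtain ⟨X, x, hx⟩ : ∃ (X : E) (x : ((pts Ω).obj l).obj X), act s x ≠ act t x := by
      by_contra! h
      exact hst (hom_ext_act h)
    exact ⟨_, smooth_setA Ω X, x, hx⟩
  finite_objects := hfin _
  aut l := by
    rw [autTopology_eq hfin]
    exact isProOligomorphicGroup_surjTopology hΩ hfin l
  finitary Z hZ hZ' l := by
    obtain ⟨S, hS, hgen⟩ := hZ'
    choose X x hx using fun y : S => nonArch_controlled Ω hfin hZ y.1.1 y.1.2
    choose κ hκ using fun y : S => exists_orbit_invariant hΩ hfin l (X y)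
    choose g hg s hs using hgen l
    have := hS.to_subtype
    have := fun y : S => hfin (X y)
    -- the orbit of `z = s y`, with `y` a generator, is determined by `y` and the orbit of `s x_y`
    let φ : Z.obj l → Σ y : S, Subobject (X y) :=
      fun z => ⟨⟨g z, hg z⟩, κ ⟨g z, hg z⟩ (act (s z) (x ⟨g z, hg z⟩))⟩
    have key : ∀ (y y' : S) (s : y.1.1 ⟶ l) (s' : y'.1.1 ⟶ l),
        (⟨y, κ y (act s (x y))⟩ : Σ y : S, Subobject (X y)) = ⟨y', κ y' (act s' (x y'))⟩ →
        ∃ σ : Aut l, Z.map σ.hom (Z.map s y.1.2) = Z.map s' y'.1.2 := by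
      intro y y' s s' h
      obtain ⟨rfl, h⟩ := Sigma.mk.inj_iff.1 h
      obtain ⟨σ, hσ⟩ := hκ y _ _ (eq_of_heq h)
      refine ⟨σ, ?_⟩
      rw [← Functor.map_comp_apply]
      exact hx y l _ _ (by rw [← act_act, hσ])
    have hφ : ∀ z z', φ z = φ z' → ∃ σ : Aut l, Z.map σ.hom z = z' := by
      intro z z' h
      obtain ⟨σ, hσ⟩ := key _ _ _ _ h
      rw [hs, hs] at hσ
      exact ⟨σ, hσ⟩
    refine ⟨Set.range (fun k : Set.range φ => k.2.choose), Set.finite_range _, fun z => ?_⟩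
    let k : Set.range φ := ⟨φ z, z, rfl⟩
    exact ⟨_, ⟨k, rfl⟩, hφ _ _ k.2.choose_spec⟩

end Topology

/-! ### Disjoint unions of functors to types -/

section Sigma

variable {C : Type u₁} [Category.{v₁} C] {ι : Type v} (F : ι → C ⥤ Type (max v w))

/-- The disjoint union of a family of functors to types. -/
def sigmaFunctor : C ⥤ Type (max v w) where
  obj c := Σ i, (F i).obj c
  map f := ↾(fun p => ⟨p.1, (F p.1).map f p.2⟩)

/-- The inclusions in the disjoint union. -/
def sigmaCofan : Cofan F := Cofan.mk (sigmaFunctor F) fun i =>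
  { app := fun c => ↾(fun x => ⟨i, x⟩) }

/-- The disjoint union is a coproduct. -/
def isColimitSigmaCofan : IsColimit (sigmaCofan F) :=
  Cofan.IsColimit.mk _
    (fun s => { app := fun c => ↾(fun p => (s.inj p.1).app c p.2)
                naturality := fun c d f => by
                  ext p
                  exact NatTrans.naturality_apply (s.inj p.1) f p.2 })
    (fun s i => rfl)
    (fun s m h => by
      ext c p
      have := congrArg (fun α => α.app c p.2) (h p.1)
      exact this)

variable {F} in
/-- A map from a coproduct of functors to types is an isomorphism if it is bijective on the
disjoint unions of values. -/
lemma isIso_sigma_desc [HasCoproduct F] {Z : C ⥤ Type (max v w)} (g : ∀ i, F i ⟶ Z)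
    (hg : ∀ c, Function.Bijective (fun p : Σ i, (F i).obj c => (g p.1).app c p.2)) :
    IsIso (Sigma.desc g) := by
  let e := (coproductIsCoproduct F).coconePointUniqueUpToIso (isColimitSigmaCofan F)
  let d : sigmaFunctor F ⟶ Z := (isColimitSigmaCofan F).desc (Cofan.mk Z g)
  have hd : IsIso d := by
    have : ∀ c, IsIso (d.app c) := fun c => (isIso_iff_bijective _).2 (hg c)
    exact NatIso.isIso_of_isIso_app d
  have : Sigma.desc g = e.hom ≫ d := by
    apply Sigma.hom_ext
    intro i
    rw [Sigma.ι_desc]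
    have h := (coproductIsCoproduct F).comp_coconePointUniqueUpToIso_hom
      (isColimitSigmaCofan F) ⟨i⟩
    change Sigma.ι F i ≫ e.hom = _ at h
    rw [← Category.assoc, h]
    exact ((isColimitSigmaCofan F).fac (Cofan.mk Z g) ⟨i⟩).symm
  rw [this]
  exact IsIso.comp_isIso' inferInstance hd

lemma exists_sigma_ι [HasCoproduct F] {c : C} (x : (∐ F).obj c) :
    ∃ (i : ι) (y : (F i).obj c), (Sigma.ι F i).app c y = x := by
  let e := (coproductIsCoproduct F).coconePointUniqueUpToIso (isColimitSigmaCofan F)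
  have h := fun i => (coproductIsCoproduct F).comp_coconePointUniqueUpToIso_inv
    (isColimitSigmaCofan F) ⟨i⟩
  obtain ⟨⟨i, y⟩, hx⟩ : ∃ p : (sigmaFunctor F).obj c, e.hom.app c x = p := ⟨_, rfl⟩
  refine ⟨i, y, ?_⟩
  have h1 := congrArg (fun α => α.app c y) (h i)
  refine h1.symm.trans ?_
  change e.inv.app c ⟨i, y⟩ = x
  rw [← hx]
  exact e.hom_inv_id_app_apply c x

lemma sigma_ι_index_eq [HasCoproduct F] {c : C} {i j : ι} {y : (F i).obj c} {z : (F j).obj c}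
    (hyz : (Sigma.ι F i).app c y = (Sigma.ι F j).app c z) : i = j := by
  let e := (coproductIsCoproduct F).coconePointUniqueUpToIso (isColimitSigmaCofan F)
  have h := fun i => (coproductIsCoproduct F).comp_coconePointUniqueUpToIso_hom
    (isColimitSigmaCofan F) ⟨i⟩
  have h1 := congrArg (fun α => α.app c y) (h i)
  have h2 := congrArg (fun α => α.app c z) (h j)
  have h3 := congrArg (e.hom.app c) hyz
  exact congrArg Sigma.fst ((h1.symm.trans h3).trans h2)

end Sigma

/-! ### The decomposition of `𝔄(X)` -/

section Decomposition

variable {E : Type u} [Category.{v} E] [Regular E] {Ω : ProFamily E}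

lemma isIso_decompositionMap (hfin : FinitelyPowered E) (X : E) :
    IsIso (decompositionMap Ω X) := by
  refine isIso_sigma_desc _ fun c => ⟨?_, fun x => ?_⟩
  · have key : ∀ (Y Y' : Subobject X) (y : ((pts Ω).obj c.of).obj (Y : E))
        (y' : ((pts Ω).obj c.of).obj (Y' : E)), IsGeneric _ y →
        ((pts Ω).obj c.of).map Y.arrow y = ((pts Ω).obj c.of).map Y'.arrow y' → Y ≤ Y' := by
      intro Y Y' y y' hy h
      obtain ⟨z, rfl, -⟩ := (pts_flat c.of).exists_pullback _ _ y y' h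
      have := hy _ z rfl
      have := isIso_of_isRegularEpi_of_mono this
      refine Subobject.le_of_comm (inv (pullback.fst Y.arrow Y'.arrow) ≫
        pullback.snd Y.arrow Y'.arrow) ?_
      rw [Category.assoc, IsIso.inv_comp_eq, pullback.condition]
    rintro ⟨Y, y, hy⟩ ⟨Y', y', hy'⟩ h
    change ((pts Ω).obj c.of).map Y.arrow y = ((pts Ω).obj c.of).map Y'.arrow y' at h
    obtain rfl : Y = Y' := le_antisymm (key _ _ _ _ ((isSurjAt_iff y).1 hy) h)
      (key _ _ _ _ ((isSurjAt_iff y').1 hy') h.symm)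
    obtain rfl := (pts_flat c.of).mono_injective _ h
    rfl
  · obtain ⟨Y, m, y, hm, hy, rfl⟩ := IsFlat.exists_generic (A := (pts Ω).obj c.of) hfin x
    have hy' := hy.map (pts_flat c.of) (f := (Subobject.underlyingIso m).inv)
      (Regular.isRegularEpi_of_extremalEpi _)
    refine ⟨⟨Subobject.mk m, _, (isSurjAt_iff _).2 hy'⟩, ?_⟩
    refine (map_map (A := (pts Ω).obj c.of) _ _ y).trans ?_
    rw [Subobject.underlyingIso_arrow]

end Decomposition

/-! ### The embedding `𝔅` -/

section EmbeddingB

variable {E : Type u} [Category.{v} E] [Regular E] {Ω : ProFamily E}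

/-- If the stabilizer of a surjection `x : Ω_λ ⟶ X` fixes `y : Ω_λ ⟶ Y`, then `y` factors
through `x`. -/
lemma exists_map_eq_of_stab_le (hΩ : Ω.IsUniversalHomogeneous) (hfin : FinitelyPowered E)
    {l : MCat Ω} {X Y : E} {x : ((pts Ω).obj l).obj X} {y : ((pts Ω).obj l).obj Y}
    (hx : IsGeneric _ x) (h : ∀ s : l ≅ l, act s.hom x = x → act s.hom y = y) :
    ∃ f : X ⟶ Y, ((pts Ω).obj l).map f x = y := by
  obtain ⟨Z, z, p, q, hz, rfl, rfl⟩ := (pts_flat l).exists_generic_dominate hfin x y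
  have hp : IsRegularEpi p := hx p z rfl
  obtain ⟨c, hc, hcz⟩ := (pts_rich hΩ l).lift (pullback.fst p p) inferInstance z hz
  have hb := hc.map (pts_flat l) (f := pullback.snd p p) inferInstance
  obtain ⟨s, hs⟩ := exists_aut hΩ hz hb
  have hsx : act s.hom (((pts Ω).obj l).map p z) = ((pts Ω).obj l).map p z := by
    rw [← map_act, hs, map_map, ← pullback.condition, ← map_map, hcz]
  have hsy := h s hsx
  rw [← map_act, hs, ← hcz, map_map, map_map] at hsy
  obtain ⟨g, hg⟩ := IsRegularEpi.exists_of_isKernelPair p (.of_hasPullback p) q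
    (hc.hom_ext (pts_flat l) hsy.symm)
  exact ⟨g, by rw [map_map, hg]⟩

/-- The morphism of the groupoid given by an isomorphism of `𝔐`. -/
abbrev coreMk {l m : MCat Ω} (s : l ≅ m) : (⟨l⟩ : Core (MCat Ω)) ⟶ ⟨m⟩ := CoreHom.mk s

/-- The surjection `Ω_λ ⟶ X` underlying a point of `𝔅(X)`. -/
def valB {c : Core (MCat Ω)} {X : Surj E} (x : ((setB Ω).obj X).obj c) :
    ((pts Ω).obj c.of).obj X.obj := x.1

/-- The point of `𝔅(X)` given by a surjection. -/
def ptB {l : MCat Ω} {X : Surj E} (x : ((pts Ω).obj l).obj X.obj) (hx : IsGeneric _ x) :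
    ((setB Ω).obj X).obj ⟨l⟩ := ⟨x, (isSurjAt_iff x).2 hx⟩

lemma valB_injective {c : Core (MCat Ω)} {X : Surj E} {x y : ((setB Ω).obj X).obj c}
    (h : valB x = valB y) : x = y := Subtype.ext h

lemma valB_generic {c : Core (MCat Ω)} {X : Surj E} (x : ((setB Ω).obj X).obj c) :
    IsGeneric ((pts Ω).obj c.of) (valB x) := (isSurjAt_iff x.1).1 x.2

lemma valB_map {X : Surj E} {c d : Core (MCat Ω)} (s : c ⟶ d) (x : ((setB Ω).obj X).obj c) :
    valB (((setB Ω).obj X).map s x) = act s.iso.hom (valB x) := rfl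

lemma valB_map_app {X Y : Surj E} (f : X ⟶ Y) {c : Core (MCat Ω)} (x : ((setB Ω).obj X).obj c) :
    valB (((setB Ω).map f).app c x) = ((pts Ω).obj c.of).map f.hom (valB x) := rfl

lemma setB_transitive (hΩ : Ω.IsUniversalHomogeneous) (hfin : FinitelyPowered E) (X : Surj E) :
    IsTransitiveCoreSet ((setB Ω).obj X) := by
  constructor
  · obtain ⟨x, hx⟩ := exists_generic hΩ hfin (X := X.obj) (l := objType X.obj) rfl
    exact ⟨⟨objType X.obj⟩, ⟨ptB x hx⟩⟩
  · rintro ⟨c⟩ ⟨d⟩ z y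
    obtain rfl : c = d :=
      (objType_eq _ (valB_generic z)).symm.trans (objType_eq _ (valB_generic y))
    obtain ⟨s, hs⟩ := exists_aut hΩ (valB_generic z) (valB_generic y)
    exact ⟨coreMk s, valB_injective hs⟩

lemma setB_smooth (hfin : FinitelyPowered E) (X : Surj E) :
    IsSmoothCoreSet (nonArch Ω) ((setB Ω).obj X) := by
  rintro ⟨c⟩ z
  rw [autTopology_eq hfin]
  have h : {s : Aut c | ((setB Ω).obj X).map (coreMk s) z = z} =
      {s : Aut c | act s.hom (valB z) = valB z} :=
    Set.ext fun s => ⟨fun h => congrArg valB h, fun h => valB_injective h⟩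
  exact h ▸ isOpen_setOf_act_eq hfin (valB z) (valB z)

lemma setB_faithful (hΩ : Ω.IsUniversalHomogeneous) (hfin : FinitelyPowered E) :
    (setB Ω).Faithful where
  map_injective {X Y} f g h := by
    obtain ⟨x, hx⟩ := exists_generic hΩ hfin (X := X.obj) (l := objType X.obj) rfl
    apply WideSubcategory.hom_ext
    have h1 := congrArg (fun α => valB (α.app ⟨objType X.obj⟩ (ptB x hx))) h
    exact hx.hom_ext (pts_flat _) h1

lemma setB_full (hΩ : Ω.IsUniversalHomogeneous) (hfin : FinitelyPowered E) :
    (setB Ω).Full where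
  map_surjective {X Y} φ := by
    obtain ⟨x, hx⟩ := exists_generic hΩ hfin (X := X.obj) (l := objType X.obj) rfl
    have hnat : ∀ {c d} (s : c ⟶ d) (z : ((setB Ω).obj X).obj c),
        valB (φ.app d (((setB Ω).obj X).map s z)) = act s.iso.hom (valB (φ.app c z)) := by
      intro c d s z
      rw [NatTrans.naturality_apply, valB_map]
    obtain ⟨f, hf⟩ := exists_map_eq_of_stab_le hΩ hfin (y := valB (φ.app _ (ptB x hx))) hx (by
      intro s hs
      refine (hnat (coreMk s) (ptB x hx)).symm.trans ?_
      congr 2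
      exact valB_injective hs)
    have hf' : IsRegularEpi f := valB_generic (φ.app _ (ptB x hx)) f x hf
    let f' : X ⟶ Y := ⟨f, hf'⟩
    refine ⟨f', NatTrans.ext (funext fun c => ?_)⟩
    ext z
    obtain ⟨s, rfl⟩ := (setB_transitive hΩ hfin X).2 _ _ (ptB x hx) z
    apply valB_injective
    refine (valB_map_app f' _).trans (Eq.trans ?_ (hnat s (ptB x hx)).symm)
    rw [← hf, valB_map]
    exact map_act s.iso.hom f x

/-- A map from a transitive set is given by the image of a point. -/
lemma exists_hom_of_stab_le {M : Type u₁} [Category.{v₁} M] {T Y : Core M ⥤ Type w}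
    (hT : IsTransitiveCoreSet T) {c : Core M} {t : T.obj c} {y : Y.obj c}
    (h : ∀ s : c ⟶ c, T.map s t = t → Y.map s y = y) : ∃ φ : T ⟶ Y, φ.app c t = y := by
  have key : ∀ {d : Core M} (r s : c ⟶ d), T.map r t = T.map s t → Y.map r y = Y.map s y := by
    intro d r s hrs
    have h1 := h (r ≫ inv s) (by
      rw [Functor.map_comp_apply, hrs, ← Functor.map_comp_apply, IsIso.hom_inv_id,
        Functor.map_id_apply])
    have h2 := congrArg (Y.map s) h1
    rwa [← Functor.map_comp_apply, Category.assoc, IsIso.inv_hom_id, Category.comp_id] at h2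
  choose s hs using fun d (z : T.obj d) => hT.2 c d t z
  refine ⟨{ app := fun d => ↾(fun z => Y.map (s d z) y)
            naturality := fun d e r => ?_ }, ?_⟩
  · ext z
    change Y.map (s e (T.map r z)) y = Y.map r (Y.map (s d z) y)
    rw [← Functor.map_comp_apply]
    apply key
    rw [hs, Functor.map_comp_apply, hs]
  · change Y.map (s c t) y = y
    exact h _ (hs c t)

/-- Points of smooth sets are controlled by surjections. -/
lemma exists_generic_stab_le (hfin : FinitelyPowered E) {Y : Core (MCat Ω) ⥤ Type (max u v)}
    (hY : IsSmoothCoreSet (nonArch Ω) Y) {l : MCat Ω} (y : Y.obj ⟨l⟩) {X : E}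
    (x : ((pts Ω).obj l).obj X) :
    ∃ (W : E) (w : ((pts Ω).obj l).obj W) (q : W ⟶ X), IsGeneric _ w ∧
      ((pts Ω).obj l).map q w = x ∧ ∀ s : l ≅ l, act s.hom w = w → Y.map (coreMk s) y = y := by
  have h := hY ⟨l⟩ y
  rw [autTopology_eq hfin, isOpen_surjTopology_iff hfin] at h
  obtain ⟨V, v, -, hv⟩ := h 1 (Y.map_id_apply ⟨l⟩ y :)
  obtain ⟨W, w, p, q, hw, rfl, rfl⟩ := (pts_flat l).exists_generic_dominate hfin v x
  refine ⟨W, w, q, hw, rfl, fun s hs => hv s ?_⟩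
  rw [← map_act, hs, ← map_act]
  exact congrArg _ (act_id l w).symm

/-- The map from surjections `Ω_λ ⟶ W` to the orbit of `y`, if the stabilizer of `w` fixes `y`. -/
lemma exists_orbit_map (hΩ : Ω.IsUniversalHomogeneous)
    {Y : Core (MCat Ω) ⥤ Type w} {l : MCat Ω} {y : Y.obj ⟨l⟩} {W : E}
    {w : ((pts Ω).obj l).obj W} (hw : IsGeneric _ w)
    (hwy : ∀ s : l ≅ l, act s.hom w = w → Y.map (coreMk s) y = y) :
    ∃ F : ((pts Ω).obj l).obj W → Y.obj ⟨l⟩, (∀ a, ¬ IsGeneric _ a → F a = y) ∧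
      (∀ s : l ≅ l, F (act s.hom w) = Y.map (coreMk s) y) ∧
      InvariantRel ((pts Ω).obj l) (fun a b => IsGeneric _ a ∧ IsGeneric _ b ∧ F a = F b) := by
  classical
  have hex : ∀ a, IsGeneric ((pts Ω).obj l) a → ∃ s : l ≅ l, act s.hom w = a :=
    fun a ha => exists_aut hΩ hw ha
  let F : ((pts Ω).obj l).obj W → Y.obj ⟨l⟩ := fun a =>
    if ha : IsGeneric ((pts Ω).obj l) a then Y.map (coreMk (hex a ha).choose) y else y
  have hF : ∀ s : l ≅ l, F (act s.hom w) = Y.map (coreMk s) y := by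
    intro s
    have ha := (isGeneric_act_iff s w).2 hw
    have hr := (hex _ ha).choose_spec
    simp only [F, dif_pos ha]
    set r := (hex _ ha).choose
    have h1 := hwy (r ≪≫ s.symm) (by
      change act (r.hom ≫ s.inv) w = w
      rw [← act_act, hr, act_inv_act])
    have h2 := congrArg (Y.map (coreMk s)) h1
    rw [← Functor.map_comp_apply] at h2
    rw [← h2]
    refine congrArg (fun t => Y.map t y) (Core.hom_ext ?_)
    change r.hom = (r.hom ≫ s.inv) ≫ s.hom
    simp
  refine ⟨F, fun a ha => dif_neg ha, hF, invariantRel_of_act hΩ F ?_⟩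
  have hcomp : ∀ (s r : l ≅ l), F (act s.hom (act r.hom w)) = Y.map (coreMk s) (F (act r.hom w)) := by
    intro s r
    rw [hF, ← Functor.map_comp_apply, act_act]
    exact hF (r ≪≫ s)
  intro s a b ha hb hab
  obtain ⟨r, rfl⟩ := hex a ha
  obtain ⟨r', rfl⟩ := hex b hb
  rw [hcomp, hcomp, hab]

/-- If the orbit of `y` under the stabilizer of a surjection `x : Ω_λ ⟶ X` is finite, then this
stabilizer fixes `y`. -/
lemma stab_le_of_finite (hΩ : Ω.IsUniversalHomogeneous) (hfin : FinitelyPowered E)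
    {Y : Core (MCat Ω) ⥤ Type w} {l : MCat Ω} {y : Y.obj ⟨l⟩} {W X : E}
    {w : ((pts Ω).obj l).obj W} (hw : IsGeneric _ w)
    (hwy : ∀ s : l ≅ l, act s.hom w = w → Y.map (coreMk s) y = y) {q : W ⟶ X}
    (hq : IsRegularEpi q)
    (hY : {y' | ∃ s : l ≅ l, act s.hom (((pts Ω).obj l).map q w) = ((pts Ω).obj l).map q w ∧
      Y.map (coreMk s) y = y'}.Finite) (s : l ≅ l)
    (hs : act s.hom (((pts Ω).obj l).map q w) = ((pts Ω).obj l).map q w) :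
    Y.map (coreMk s) y = y := by
  obtain ⟨F, hF₀, hF, hinv⟩ := exists_orbit_map hΩ hw hwy
  have := hY.to_subtype
  have hF₁ : F w = y := by
    have := hF (Iso.refl l)
    rw [show act (Iso.refl l).hom w = w from act_id l w] at this
    exact this.trans (Y.map_id_apply _ y)
  have hmem : ∀ a, ((pts Ω).obj l).map q a = ((pts Ω).obj l).map q w →
      ∃ s : l ≅ l, act s.hom (((pts Ω).obj l).map q w) = ((pts Ω).obj l).map q w ∧
        Y.map (coreMk s) y = F a := by
    intro a ha
    by_cases hga : IsGeneric ((pts Ω).obj l) a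
    · obtain ⟨r, rfl⟩ := exists_aut hΩ hw hga
      exact ⟨r, by rwa [← map_act], (hF r).symm⟩
    · exact ⟨Iso.refl l, act_id _ _, (Y.map_id_apply _ y).trans (hF₀ a hga).symm⟩
  have h := hinv.of_finite hfin (pts_rich hΩ l) hq (hw.map (pts_flat l) hq)
    (fun a => (⟨F a.1, hmem a.1 a.2⟩ : {y' | ∃ s : l ≅ l, act s.hom (((pts Ω).obj l).map q w) =
      ((pts Ω).obj l).map q w ∧ Y.map (coreMk s) y = y'}))
    (fun a b ha hb hab => ⟨ha, hb, congrArg Subtype.val hab⟩) hw ((isGeneric_act_iff s w).2 hw)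
    (by rw [map_act, hs])
  rw [← hF, ← h.2.2, hF₁]

/-- Every point `y` that is fixed by the stabilizer of a surjection `w : Ω_λ ⟶ W` is fixed by the
stabilizer of a surjection to a quotient of `W`, of finite index in the stabilizer of `y`. -/
lemma exists_quotient_stab (hexact : EquivalenceRelationsEffective E)
    (hΩ : Ω.IsUniversalHomogeneous) (hfin : FinitelyPowered E)
    {Y : Core (MCat Ω) ⥤ Type w} {l : MCat Ω} {y : Y.obj ⟨l⟩} {W : E}
    {w : ((pts Ω).obj l).obj W} (hw : IsGeneric _ w)
    (hwy : ∀ s : l ≅ l, act s.hom w = w → Y.map (coreMk s) y = y) :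
    ∃ (X : E) (q : W ⟶ X), IsRegularEpi q ∧
      (∀ s : l ≅ l, act s.hom (((pts Ω).obj l).map q w) = ((pts Ω).obj l).map q w →
        Y.map (coreMk s) y = y) ∧
      {x | ∃ s : l ≅ l, Y.map (coreMk s) y = y ∧
        act s.hom (((pts Ω).obj l).map q w) = x}.Finite := by
  obtain ⟨F, -, hF, hinv⟩ := exists_orbit_map hΩ hw hwy
  have hF₁ : F w = y := by
    have := hF (Iso.refl l)
    rw [show act (Iso.refl l).hom w = w from act_id l w] at this
    exact this.trans (Y.map_id_apply _ y)
  obtain ⟨X, q, hq, h₁, h₂⟩ := hinv.exists_quotient hexact hfin (pts_rich hΩ l) hw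
  refine ⟨X, q, hq, fun s hs => ?_, (h₂ w).subset ?_⟩
  · have h := h₁ w (act s.hom w) hw ((isGeneric_act_iff s w).2 hw) (by rw [map_act, hs])
    rw [← hF, ← h.2.2, hF₁]
  · rintro _ ⟨s, hs, rfl⟩
    exact ⟨act s.hom w, ⟨hw, (isGeneric_act_iff s w).2 hw, by rw [hF, hs, hF₁]⟩, map_act _ _ _⟩

/-- A finite cover of `𝔅(X)` is trivial: the stabilizer of a point of `𝔅(X)` acts trivially on the
fibre over it, so that each point of the fibre defines a section. -/
lemma isSimplyConnected_of_iso_setB (hΩ : Ω.IsUniversalHomogeneous) (hfin : FinitelyPowered E)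
    {X : Surj E} {Z : Core (MCat Ω) ⥤ Type (max u v)} (e : (setB Ω).obj X ≅ Z)
    (hZ : IsTransitiveCoreSet Z) :
    IsSimplyConnectedCoreSet (nonArch Ω) Z := by
  intro Y f ⟨hY, hf⟩
  obtain ⟨l, hl⟩ : ∃ l : MCat Ω, objType X.obj = l := ⟨_, rfl⟩
  obtain ⟨x, hx⟩ := exists_generic hΩ hfin hl
  let z : Z.obj ⟨l⟩ := e.hom.app _ (ptB x hx)
  have hzx : ∀ s : l ≅ l, Z.map (coreMk s) z = z ↔ act s.hom x = x := by
    intro s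
    rw [← NatTrans.naturality_apply]
    constructor
    · intro h
      have h1 := congrArg (e.inv.app ⟨l⟩) h
      rw [e.hom_inv_id_app_apply, e.hom_inv_id_app_apply] at h1
      exact congrArg valB h1
    · intro h
      exact congrArg _ (valB_injective h)
  have hsec : ∀ y : Y.obj ⟨l⟩, f.app _ y = z → ∃ g : Z ⟶ Y, g.app _ z = y := by
    intro y hy
    refine exists_hom_of_stab_le hZ fun s hs => ?_
    obtain ⟨W, w, q, hw, hwx, hwy⟩ := exists_generic_stab_le hfin hY y x
    subst hwx
    refine stab_le_of_finite hΩ hfin hw hwy (hx _ _ rfl) ((hf ⟨l⟩ z).subset ?_) s.iso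
      ((hzx s.iso).1 hs)
    rintro _ ⟨r, hr, rfl⟩
    change f.app _ (Y.map _ y) = z
    rw [NatTrans.naturality_apply, hy, hzx, hr]
  have := (hf ⟨l⟩ z).to_subtype
  obtain ⟨n, ⟨i⟩⟩ := Finite.exists_equiv_fin {y | f.app ⟨l⟩ y = z}
  choose g hg using fun k : Fin n => hsec (i.symm k).1 (i.symm k).2
  have hgf : ∀ k, g k ≫ f = 𝟙 Z := by
    intro k
    ext c z'
    obtain ⟨s, rfl⟩ := hZ.2 _ _ z z'
    change f.app c ((g k).app c (Z.map s z)) = Z.map s z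
    rw [NatTrans.naturality_apply, NatTrans.naturality_apply, hg, (i.symm k).2]
  have hbij : ∀ c, Function.Bijective
      (fun p : Σ _ : Fin n, Z.obj c => (g p.1).app c p.2) := by
    intro c
    constructor
    · rintro ⟨k, a⟩ ⟨k', a'⟩ h
      change (g k).app c a = (g k').app c a' at h
      have h1 : ∀ k a, f.app c ((g k).app c a) = a := fun k a =>
        congrArg (fun α => α.app c a) (hgf k)
      obtain rfl : a = a' := by rw [← h1 k a, h, h1]
      obtain ⟨s, rfl⟩ := hZ.2 _ _ z a
      rw [NatTrans.naturality_apply, NatTrans.naturality_apply, hg, hg] at h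
      have h2 := congrArg (Y.map (inv s)) h
      rw [← Functor.map_comp_apply, ← Functor.map_comp_apply, IsIso.hom_inv_id,
        Functor.map_id_apply, Functor.map_id_apply] at h2
      rw [i.symm.injective (Subtype.ext h2)]
    · intro y
      obtain ⟨s, hs⟩ := hZ.2 _ _ (f.app c y) z
      have hy : f.app _ (Y.map s y) = z := by rw [NatTrans.naturality_apply, hs]
      refine ⟨⟨i ⟨_, hy⟩, f.app c y⟩, ?_⟩
      change (g _).app c (f.app c y) = y
      have h1 : f.app c y = Z.map (inv s) z := by
        rw [← hs, ← Functor.map_comp_apply, IsIso.hom_inv_id, Functor.map_id_apply]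
      rw [h1, NatTrans.naturality_apply, hg, Equiv.symm_apply_apply, ← Functor.map_comp_apply,
        IsIso.hom_inv_id, Functor.map_id_apply]
  have hiso : IsIso (Sigma.desc g) := isIso_sigma_desc.{max u v, 0} g hbij
  refine ⟨n, (asIso (Sigma.desc g)).symm, ?_⟩
  rw [Iso.symm_hom, Iso.inv_comp_eq]
  apply Sigma.hom_ext
  intro k
  rw [Sigma.ι_desc, asIso_hom, Sigma.ι_desc_assoc, hgf]

/-- A trivial cover whose source is transitive is an isomorphism. -/
lemma isIso_of_isTrivialCover {M : Type u₁} [Category.{v₁} M] {T Z : Core M ⥤ Type w}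
    (hT : IsTransitiveCoreSet T) (hZ : IsTransitiveCoreSet Z) {f : T ⟶ Z}
    (hf : IsTrivialCover f) : IsIso f := by
  obtain ⟨n, e, rfl⟩ := hf
  have key : ∀ c (t t' : T.obj c), (e.hom ≫ Sigma.desc (fun _ => 𝟙 Z)).app c t =
      (e.hom ≫ Sigma.desc (fun _ => 𝟙 Z)).app c t' → t = t' := by
    intro c t t' h
    have hd : ∀ k (a : Z.obj c), (Sigma.desc (fun _ : Fin n => 𝟙 Z)).app c
        ((Sigma.ι (fun _ : Fin n => Z) k).app c a) = a := fun k a =>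
      congrArg (fun α => α.app c a) (Sigma.ι_desc (fun _ : Fin n => 𝟙 Z) k)
    obtain ⟨k, a, ha⟩ := exists_sigma_ι.{w, 0} (fun _ : Fin n => Z) (e.hom.app c t)
    obtain ⟨k', a', ha'⟩ := exists_sigma_ι.{w, 0} (fun _ : Fin n => Z) (e.hom.app c t')
    change (Sigma.desc (fun _ : Fin n => 𝟙 Z)).app c (e.hom.app c t) =
      (Sigma.desc (fun _ : Fin n => 𝟙 Z)).app c (e.hom.app c t') at h
    rw [← ha, ← ha', hd, hd] at h
    subst h
    obtain ⟨s, hs⟩ := hT.2 _ _ t t'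
    have h1 : e.hom.app c t' = (Sigma.ι (fun _ : Fin n => Z) k).app c (Z.map s a) := by
      rw [← hs, NatTrans.naturality_apply, ← ha, NatTrans.naturality_apply]
    obtain rfl : k = k' := sigma_ι_index_eq.{w, 0} (fun _ : Fin n => Z) (h1.symm.trans ha'.symm)
    have h2 := congrArg (e.inv.app c) (ha.symm.trans ha')
    rwa [e.hom_inv_id_app_apply, e.hom_inv_id_app_apply] at h2
  have : ∀ c, IsIso ((e.hom ≫ Sigma.desc (fun _ : Fin n => 𝟙 Z)).app c) := by
    intro c
    rw [isIso_iff_bijective]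
    refine ⟨fun t t' h => key c t t' h, fun z => ?_⟩
    obtain ⟨d, ⟨t⟩⟩ := hT.1
    obtain ⟨s, hs⟩ := hZ.2 _ _ ((e.hom ≫ Sigma.desc (fun _ : Fin n => 𝟙 Z)).app d t) z
    exact ⟨T.map s t, by rw [NatTrans.naturality_apply, hs]⟩
  exact NatIso.isIso_of_isIso_app _

lemma isTransitive_of_iso {M : Type u₁} [Category.{v₁} M] {T Z : Core M ⥤ Type w}
    (hT : IsTransitiveCoreSet T) (e : T ≅ Z) : IsTransitiveCoreSet Z := by
  obtain ⟨⟨c, ⟨t⟩⟩, h⟩ := hT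
  refine ⟨⟨c, ⟨e.hom.app c t⟩⟩, fun c d z y => ?_⟩
  obtain ⟨s, hs⟩ := h c d (e.inv.app c z) (e.inv.app d y)
  refine ⟨s, ?_⟩
  have := congrArg (e.hom.app d) hs
  rwa [NatTrans.naturality_apply, e.inv_hom_id_app_apply, e.inv_hom_id_app_apply] at this

lemma isSmoothCoreSet_of_iso {M : Type u₁} [Category.{v₁} M] {N : NonArchStructure.{w} M}
    {T Z : Core M ⥤ Type w} (hT : IsSmoothCoreSet N T) (e : T ≅ Z) : IsSmoothCoreSet N Z := by
  intro c z
  have h : {s : Aut c.of | Z.map (CoreHom.mk s : c ⟶ c) z = z} =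
      {s : Aut c.of | T.map (CoreHom.mk s : c ⟶ c) (e.inv.app c z) = e.inv.app c z} := by
    ext s
    change _ = _ ↔ _ = _
    rw [← NatTrans.naturality_apply]
    exact ((e.symm.app c).toEquiv.injective.eq_iff).symm
  exact h ▸ hT c _

theorem embeddingB (hexact : EquivalenceRelationsEffective E) (hΩ : Ω.IsUniversalHomogeneous)
    (hfin : FinitelyPowered E) : EmbeddingB Ω where
  full := setB_full hΩ hfin
  faithful := setB_faithful hΩ hfin
  essImage_iff Z := by
    constructor
    · rintro ⟨X, ⟨e⟩⟩
      have hZ := isTransitive_of_iso (setB_transitive hΩ hfin X) e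
      exact ⟨isSmoothCoreSet_of_iso (setB_smooth hfin X) e, hZ,
        isSimplyConnected_of_iso_setB hΩ hfin e hZ⟩
    · rintro ⟨hsm, htr, hsc⟩
      obtain ⟨⟨⟨l⟩, ⟨z⟩⟩, -⟩ := id htr
      obtain ⟨X₀, ⟨x₀⟩⟩ := (pts_flat l).nonempty
      obtain ⟨W, w, -, hw, -, hwz⟩ := exists_generic_stab_le hfin hsm z x₀
      obtain ⟨X, q, hq, hst, hfib⟩ := exists_quotient_stab hexact hΩ hfin hw hwz
      let X' : Surj E := ⟨X⟩
      have hx := hw.map (pts_flat l) hq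
      let x : ((setB Ω).obj X').obj ⟨l⟩ := ptB _ hx
      have hX := setB_transitive hΩ hfin X'
      obtain ⟨φ, hφ⟩ := exists_hom_of_stab_le hX (t := x) (y := z)
        (fun s hs => hst s.iso (congrArg valB hs))
      have hcov : IsFiniteCover (nonArch Ω) φ := by
        refine ⟨setB_smooth hfin X', fun c y => ?_⟩
        by_cases hne : ∃ b, φ.app c b = y
        · obtain ⟨b, rfl⟩ := hne
          obtain ⟨s, rfl⟩ := hX.2 _ _ x b
          have hfin' : {a : ((setB Ω).obj X').obj ⟨l⟩ | φ.app _ a = z}.Finite := by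
            refine Set.Finite.of_finite_image (f := valB) (hfib.subset ?_)
              (fun _ _ _ _ h => valB_injective h)
            rintro _ ⟨a, ha, rfl⟩
            obtain ⟨r, rfl⟩ := hX.2 _ _ x a
            refine ⟨r.iso, ?_, rfl⟩
            change φ.app _ _ = z at ha
            rwa [NatTrans.naturality_apply, hφ] at ha
          refine (hfin'.image (((setB Ω).obj X').map s)).subset ?_
          intro a ha
          refine ⟨((setB Ω).obj X').map (inv s) a, ?_, ?_⟩
          · change φ.app _ _ = z
            change φ.app _ a = φ.app _ _ at ha
            rw [NatTrans.naturality_apply, ha, NatTrans.naturality_apply, hφ,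
              ← Functor.map_comp_apply, IsIso.hom_inv_id, Functor.map_id_apply]
          · rw [← Functor.map_comp_apply, IsIso.inv_hom_id, Functor.map_id_apply]
        · convert Set.finite_empty
          exact Set.eq_empty_of_forall_notMem fun b hb => hne ⟨b, hb⟩
      have := isIso_of_isTrivialCover hX htr (hsc _ φ hcov)
      exact ⟨X', ⟨asIso φ⟩⟩

end EmbeddingB

/-! ### The embedding `𝔄` -/

section EmbeddingA

variable {E : Type u} [Category.{v} E] [Regular E] {Ω : ProFamily E}

variable (Ω) in
/-- Each `𝔄(X)` is generated by each surjection `Ω_λ ⟶ X`: every morphism `Ω_μ ⟶ X` lifts to a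
morphism `Ω_μ ⟶ Ω_λ`. -/
def PointsLift : Prop :=
  ∀ (l m : MCat Ω) (X : E) (x : ((pts Ω).obj l).obj X) (y : ((pts Ω).obj m).obj X),
    IsGeneric _ x → ∃ s : l ⟶ m, act s x = y

/-- A map from a monogenic set is given by the image of a generator. -/
lemma exists_hom_of_generates {M : Type u₁} [Category.{v₁} M] {Z Y : M ⥤ Type w} {l : M}
    {z : Z.obj l} (hz : Generates Z z) {y : Y.obj l}
    (h : ∀ (m : M) (s t : l ⟶ m), Z.map s z = Z.map t z → Y.map s y = Y.map t y) :
    ∃ φ : Z ⟶ Y, φ.app l z = y := by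
  choose s hs using hz
  refine ⟨{ app := fun m => ↾(fun a => Y.map (s m a) y)
            naturality := fun m n r => ?_ }, ?_⟩
  · ext a
    change Y.map (s n (Z.map r a)) y = Y.map r (Y.map (s m a) y)
    rw [← Functor.map_comp_apply]
    apply h
    rw [hs, Functor.map_comp_apply, hs]
  · change Y.map (s l z) y = y
    rw [h l (s l z) (𝟙 l) (by rw [hs, Functor.map_id_apply]), Functor.map_id_apply]

/-- An element that is mapped to a generic element by the action is generic. -/
lemma isGeneric_of_act {l m : MCat Ω} (s : l ⟶ m) {X : E} {x : ((pts Ω).obj l).obj X}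
    (h : IsGeneric _ (act s x)) : IsGeneric _ x := by
  rintro Y f b rfl
  exact h f (act s b) (map_act s f b)

lemma generates_of_isGeneric (hL : PointsLift Ω) {l : MCat Ω} {X : E}
    {x : ((pts Ω).obj l).obj X} (hx : IsGeneric _ x) :
    Generates ((setA Ω).obj X) (l := l) x :=
  fun m y => hL l m X x y hx

lemma isGeneric_of_generates (hΩ : Ω.IsUniversalHomogeneous) (hfin : FinitelyPowered E)
    {l : MCat Ω} {X : E} {x : ((pts Ω).obj l).obj X}
    (hx : Generates ((setA Ω).obj X) (l := l) x) : IsGeneric _ x := by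
  obtain ⟨y, hy⟩ := exists_generic hΩ hfin (X := X) (l := objType X) rfl
  obtain ⟨s, rfl⟩ := hx _ y
  exact isGeneric_of_act s hy

lemma setA_faithful (hΩ : Ω.IsUniversalHomogeneous) (hfin : FinitelyPowered E) :
    (setA Ω).Faithful where
  map_injective {X Y} f g h := by
    obtain ⟨x, hx⟩ := exists_generic hΩ hfin (X := X) (l := objType X) rfl
    have h1 := congrArg (fun α => (α.app (objType X : MCat Ω)) x) h
    exact hx.hom_ext (pts_flat _) h1

lemma setA_full (hΩ : Ω.IsUniversalHomogeneous) (hfin : FinitelyPowered E) (hL : PointsLift Ω) :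
    (setA Ω).Full where
  map_surjective {X Y} φ := by
    obtain ⟨l, hl⟩ : ∃ l : MCat Ω, objType X = l := ⟨_, rfl⟩
    obtain ⟨x, hx⟩ := exists_generic hΩ hfin hl
    have hnat : ∀ {m : MCat Ω} (s : l ⟶ m), φ.app m (act s x) = act s (φ.app l x) :=
      fun s => NatTrans.naturality_apply φ s x
    obtain ⟨f, hf⟩ := exists_map_eq_of_stab_le hΩ hfin (y := φ.app l x) hx (by
      intro s hs
      rw [← hnat, hs])
    refine ⟨f, NatTrans.ext (funext fun m => ?_)⟩
    ext y
    obtain ⟨s, rfl⟩ := hL l m X x y hx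
    refine Eq.trans ?_ (hnat s).symm
    rw [← hf]
    exact map_act s f x

/-- Suppose that `z` is controlled by `w` and that the stabilizer of the image `q w` of `w` in a
quotient fixes `z`. Then `z` is controlled by `q w`. -/
lemma control_of_stab (hΩ : Ω.IsUniversalHomogeneous) (hL : PointsLift Ω) {Z : MCat Ω ⥤ Type w}
    {l : MCat Ω} {z : Z.obj l} {W X : E} {w : ((pts Ω).obj l).obj W} (hw : IsGeneric _ w)
    {q : W ⟶ X} (hq : IsRegularEpi q)
    (hwz : ∀ (m : MCat Ω) (s t : l ⟶ m), act s w = act t w → Z.map s z = Z.map t z)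
    (hst : ∀ s : l ≅ l, act s.hom (((pts Ω).obj l).map q w) = ((pts Ω).obj l).map q w →
      Z.map s.hom z = z)
    (m : MCat Ω) (s t : l ⟶ m)
    (h : act s (((pts Ω).obj l).map q w) = act t (((pts Ω).obj l).map q w)) :
    Z.map s z = Z.map t z := by
  rw [← map_act, ← map_act] at h
  obtain ⟨d, hd₁, hd₂⟩ := (pts_flat m).exists_pullback q q _ _ h
  obtain ⟨c, hc, -⟩ := (pts_rich hΩ l).lift (pullback.fst q q) inferInstance w hw
  obtain ⟨σ, hσ⟩ := exists_aut hΩ hw (hc.map (pts_flat l) (f := pullback.fst q q) inferInstance)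
  obtain ⟨τ, hτ⟩ := exists_aut hΩ hw (hc.map (pts_flat l) (f := pullback.snd q q) inferInstance)
  obtain ⟨r, rfl⟩ := hL l m _ c d hc
  rw [map_act, ← hσ, act_act] at hd₁
  rw [map_act, ← hτ, act_act] at hd₂
  rw [← hwz m _ _ hd₁, ← hwz m _ _ hd₂]
  have h1 : Z.map (σ.hom ≫ τ.inv) z = z := hst (σ ≪≫ τ.symm) (by
    change act (σ.hom ≫ τ.inv) _ = _
    rw [← act_act, ← map_act, hσ, map_map, pullback.condition, ← map_map, ← hτ, map_act,
      act_inv_act])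
  have h2 := congrArg (Z.map (τ.hom ≫ r)) h1
  rw [← Functor.map_comp_apply] at h2
  simpa using h2

theorem embeddingA (hexact : EquivalenceRelationsEffective E) (hΩ : Ω.IsUniversalHomogeneous)
    (hfin : FinitelyPowered E) (hL : PointsLift Ω) : EmbeddingA Ω where
  full := setA_full hΩ hfin hL
  faithful := setA_faithful hΩ hfin
  essImage_iff Z := by
    constructor
    · rintro ⟨X, ⟨e⟩⟩
      have hsurj : ∀ m, Function.Surjective (e.hom.app m) := fun m z =>
        ⟨e.inv.app m z, e.inv_hom_id_app_apply m z⟩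
      refine ⟨(nonArch Ω).of_surjective e.hom hsurj (smooth_setA Ω X), ?_, ?_⟩
      · obtain ⟨l, hl⟩ : ∃ l : MCat Ω, objType X = l := ⟨_, rfl⟩
        obtain ⟨x, hx⟩ := exists_generic hΩ hfin hl
        refine ⟨l, e.hom.app l x, fun m z => ?_⟩
        obtain ⟨y, rfl⟩ := hsurj m z
        obtain ⟨s, rfl⟩ := generates_of_isGeneric hL hx m y
        exact ⟨s, (NatTrans.naturality_apply e.hom s x).symm⟩
      · intro Z' f hZ' ⟨l, z', hz'⟩ hf hgf
        have hfz : Generates Z (f.app l z') := by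
          intro m y
          obtain ⟨y', rfl⟩ := hf m y
          obtain ⟨s, rfl⟩ := hz' m y'
          exact ⟨s, (NatTrans.naturality_apply f s z').symm⟩
        let x : ((pts Ω).obj l).obj X := e.inv.app l (f.app l z')
        have hact : ∀ {m : MCat Ω} (s : l ⟶ m), act s x = e.inv.app m (f.app m (Z'.map s z')) := by
          intro m s
          rw [NatTrans.naturality_apply f, NatTrans.naturality_apply e.inv]
          rfl
        have hxgen : Generates ((setA Ω).obj X) (l := l) x := by
          intro m y
          obtain ⟨s, hs⟩ := hfz m (e.hom.app m y)
          refine ⟨s, (hact s).trans ?_⟩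
          rw [NatTrans.naturality_apply, hs]
          exact e.hom_inv_id_app_apply m y
        have hx := isGeneric_of_generates hΩ hfin hxgen
        obtain ⟨V, v, hv, hvz⟩ := exists_generic_control Ω hfin hZ' z'
        obtain ⟨W, w, p, q, hw, rfl, hwx⟩ := (pts_flat l).exists_generic_dominate hfin v x
        have hwz : ∀ (m : MCat Ω) (s t : l ⟶ m), act s w = act t w →
            Z'.map s z' = Z'.map t z' :=
          fun m s t h => hvz m s t (by rw [← map_act, ← map_act, h])
        have hstab := stab_le_of_finite (Y := Core.inclusion _ ⋙ Z') (y := z') hΩ hfin hw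
          (fun s hs => (hwz l s.hom (𝟙 l) (hs.trans (act_id l w).symm)).trans
            (Functor.map_id_apply Z' l z')) (hx q w hwx) ((hgf l _ hfz).subset (by
              rintro _ ⟨s, hs, rfl⟩
              refine ⟨fun m y => ?_, ?_⟩
              · obtain ⟨r, rfl⟩ := hz' m y
                refine ⟨s.inv ≫ r, ?_⟩
                change Z'.map (s.inv ≫ r) (Z'.map s.hom z') = Z'.map r z'
                rw [← Functor.map_comp_apply, s.hom_inv_id_assoc]
              · rw [hwx, hact] at hs
                have := congrArg (e.hom.app l) hs
                rwa [e.inv_hom_id_app_apply, e.inv_hom_id_app_apply] at this))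
        have hctrl := control_of_stab hΩ hL hw (hx q w hwx) hwz hstab
        rw [hwx] at hctrl
        have : ∀ m, IsIso (f.app m) := by
          intro m
          rw [isIso_iff_bijective]
          refine ⟨fun a b hab => ?_, hf m⟩
          obtain ⟨s, rfl⟩ := hz' m a
          obtain ⟨t, rfl⟩ := hz' m b
          exact hctrl m s t (by rw [hact, hact, hab])
        exact NatIso.isIso_of_isIso_app _
    · rintro ⟨hsm, ⟨l, z, hz⟩, hsc⟩
      obtain ⟨W, w, hw, hwz⟩ := exists_generic_control Ω hfin hsm z
      obtain ⟨X, q, hq, hst, hfib⟩ := exists_quotient_stab (Y := Core.inclusion _ ⋙ Z) (y := z)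
        hexact hΩ hfin hw (fun s hs => (hwz l s.hom (𝟙 l) (hs.trans (act_id l w).symm)).trans
          (Functor.map_id_apply Z l z))
      have hx := hw.map (pts_flat l) hq
      have hctrl := control_of_stab hΩ hL hw hq hwz hst
      set x := ((pts Ω).obj l).map q w
      have hxgen := generates_of_isGeneric hL hx
      obtain ⟨φ, hφ⟩ := exists_hom_of_generates hxgen hctrl
      have hφs : ∀ {m : MCat Ω} (s : l ⟶ m), φ.app m (act s x) = Z.map s z := by
        intro m s
        rw [← hφ]
        exact NatTrans.naturality_apply φ s x
      have hsurj : ∀ m, Function.Surjective (φ.app m) := by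
        intro m y
        obtain ⟨s, rfl⟩ := hz m y
        exact ⟨act s x, hφs s⟩
      have := hsc _ φ (smooth_setA Ω X) ⟨l, x, hxgen⟩ hsurj (by
        intro m y hy
        by_cases hne : ∃ a, Generates ((setA Ω).obj X) a ∧ φ.app m a = y
        · obtain ⟨a, ha, rfl⟩ := hne
          have ha' := isGeneric_of_generates hΩ hfin ha
          obtain rfl : l = m := (objType_eq _ hx).symm.trans (objType_eq _ ha')
          obtain ⟨s, rfl⟩ := exists_aut hΩ hx ha'
          refine (hfib.image (act s.hom)).subset ?_
          rintro b ⟨hb, hbφ⟩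
          obtain ⟨t, rfl⟩ := exists_aut hΩ hx (isGeneric_of_generates hΩ hfin hb)
          rw [hφs, hφs] at hbφ
          refine ⟨act s.inv (act t.hom x), ⟨t ≪≫ s.symm, ?_, (act_act _ _ _).symm⟩,
            act_act_inv s _⟩
          change Z.map (t.hom ≫ s.inv) z = z
          rw [Functor.map_comp_apply, hbφ, ← Functor.map_comp_apply, s.hom_inv_id,
            Functor.map_id_apply]
        · convert Set.finite_empty
          exact Set.eq_empty_of_forall_notMem fun a ha => hne ⟨a, ha⟩)
      exact ⟨X, ⟨asIso φ⟩⟩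

end EmbeddingA

/-! ### Maps between functors of points from directed graphs -/

section Graph

variable {E : Type u} [Category.{v} E] {A B : E ⥤ Type w}

/-- A relation between elements of `A` and elements of `B` defines a map if it is total and any
two pairs in it come from a common pair whose first entry is generic. -/
lemma exists_natTrans_of_graph (hA : IsFlat A) (Γ : ∀ X : E, A.obj X → B.obj X → Prop)
    (hdir : ∀ {X X' : E} {a b a' b'}, Γ X a b → Γ X' a' b' → ∃ (V : E) (c : A.obj V) (d : B.obj V)
      (f : V ⟶ X) (f' : V ⟶ X'), IsGeneric A c ∧ A.map f c = a ∧ B.map f d = b ∧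
        A.map f' c = a' ∧ B.map f' d = b')
    (htot : ∀ {X : E} (a : A.obj X), ∃ b, Γ X a b) :
    ∃ φ : A ⟶ B, ∀ (X : E) (a : A.obj X) (b : B.obj X), Γ X a b → φ.app X a = b := by
  have key : ∀ {X Y : E} (r : X ⟶ Y) {a b b'}, Γ X a b → Γ Y (A.map r a) b' → B.map r b = b' := by
    intro X Y r a b b' h h'
    obtain ⟨V, c, d, f, f', hc, rfl, rfl, h1, rfl⟩ := hdir h h'
    rw [map_map] at h1
    rw [map_map, hc.hom_ext hA h1]
  choose φ hφ using @htot
  refine ⟨{ app := fun X => ↾(fun a => φ a)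
            naturality := fun X Y r => ?_ }, fun X a b h => ?_⟩
  · ext a
    exact (key r (hφ a) (hφ _)).symm
  · have := key (𝟙 X) (hφ a) (by simpa using h)
    simpa using this

/-- A relation that satisfies the conditions of `exists_natTrans_of_graph` in both directions
defines an isomorphism. -/
lemma exists_natIso_of_graph (hA : IsFlat A) (hB : IsFlat B)
    (Γ : ∀ X : E, A.obj X → B.obj X → Prop)
    (hdir : ∀ {X X' : E} {a b a' b'}, Γ X a b → Γ X' a' b' → ∃ (V : E) (c : A.obj V) (d : B.obj V)
      (f : V ⟶ X) (f' : V ⟶ X'), IsGeneric A c ∧ IsGeneric B d ∧ A.map f c = a ∧ B.map f d = b ∧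
        A.map f' c = a' ∧ B.map f' d = b')
    (htot : ∀ {X : E} (a : A.obj X), ∃ b, Γ X a b)
    (htot' : ∀ {X : E} (b : B.obj X), ∃ a, Γ X a b) :
    ∃ φ : A ≅ B, ∀ (X : E) (a : A.obj X) (b : B.obj X), Γ X a b → φ.hom.app X a = b := by
  obtain ⟨φ, hφ⟩ := exists_natTrans_of_graph hA Γ (fun h h' => by
    obtain ⟨V, c, d, f, f', hc, -, h⟩ := hdir h h'
    exact ⟨V, c, d, f, f', hc, h⟩) htot
  obtain ⟨ψ, hψ⟩ := exists_natTrans_of_graph hB (fun X b a => Γ X a b) (fun h h' => by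
    obtain ⟨V, c, d, f, f', -, hd, h₁, h₂, h₃, h₄⟩ := hdir h h'
    exact ⟨V, d, c, f, f', hd, h₂, h₁, h₄, h₃⟩) htot'
  refine ⟨{ hom := φ, inv := ψ, hom_inv_id := ?_, inv_hom_id := ?_ }, hφ⟩
  · ext X a
    obtain ⟨b, hb⟩ := htot a
    change ψ.app X (φ.app X a) = a
    rw [hφ X a b hb, hψ X b a hb]
  · ext X b
    obtain ⟨a, ha⟩ := htot' b
    change φ.app X (ψ.app X b) = b
    rw [hψ X b a ha, hφ X a b ha]

/-- A relation between elements of `A` and `B` constructed in countably many steps: the `n`-th step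
replaces a pair by a pair above it that has the property `D n`. -/
lemma exists_graph_of_steps (Q : ∀ V : E, A.obj V → B.obj V → Prop)
    (D : ℕ → ∀ V : E, A.obj V → B.obj V → Prop)
    (step : ∀ (n : ℕ) (V : E) (v : A.obj V) (w : B.obj V), Q V v w → ∃ (V' : E) (v' : A.obj V')
      (w' : B.obj V') (p : V' ⟶ V), Q V' v' w' ∧ A.map p v' = v ∧ B.map p w' = w ∧ D n V' v' w')
    {X : E} {x : A.obj X} {y : B.obj X} (hxy : Q X x y) :
    ∃ Γ : ∀ X : E, A.obj X → B.obj X → Prop, Γ X x y ∧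
      (∀ {X Y : E} (f : X ⟶ Y) {a b}, Γ X a b → Γ Y (A.map f a) (B.map f b)) ∧
      (∀ {X X' : E} {a b a' b'}, Γ X a b → Γ X' a' b' → ∃ (V : E) (c : A.obj V) (d : B.obj V)
        (f : V ⟶ X) (f' : V ⟶ X'), Q V c d ∧ A.map f c = a ∧ B.map f d = b ∧
        A.map f' c = a' ∧ B.map f' d = b') ∧
      ∀ n, ∃ (V : E) (v : A.obj V) (w : B.obj V), Γ V v w ∧ D n V v w := by
  let S := {p : Σ V : E, A.obj V × B.obj V // Q p.1 p.2.1 p.2.2}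
  have step' : ∀ (n : ℕ) (p : S), ∃ (p' : S) (f : p'.1.1 ⟶ p.1.1), A.map f p'.1.2.1 = p.1.2.1 ∧
      B.map f p'.1.2.2 = p.1.2.2 ∧ D n p'.1.1 p'.1.2.1 p'.1.2.2 := by
    rintro n ⟨⟨V, v, w⟩, h⟩
    obtain ⟨V', v', w', p, hQ, h₁, h₂, h₃⟩ := step n V v w h
    exact ⟨⟨⟨V', v', w'⟩, hQ⟩, p, h₁, h₂, h₃⟩
  choose next f hf₁ hf₂ hD using step'
  let p : ℕ → S := fun n => Nat.rec ⟨⟨X, x, y⟩, hxy⟩ next n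
  have hle : ∀ {m n : ℕ}, m ≤ n → ∃ g : (p n).1.1 ⟶ (p m).1.1,
      A.map g (p n).1.2.1 = (p m).1.2.1 ∧ B.map g (p n).1.2.2 = (p m).1.2.2 := by
    intro m n h
    induction h with
    | refl => exact ⟨𝟙 _, by simp, by simp⟩
    | step _ ih =>
      rename_i n _
      obtain ⟨g, h₁, h₂⟩ := ih
      refine ⟨f n (p n) ≫ g, ?_, ?_⟩
      · rw [← map_map, ← h₁]
        exact congrArg _ (hf₁ n (p n))
      · rw [← map_map, ← h₂]
        exact congrArg _ (hf₂ n (p n))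
  refine ⟨fun X a b => ∃ (n : ℕ) (g : (p n).1.1 ⟶ X), A.map g (p n).1.2.1 = a ∧
    B.map g (p n).1.2.2 = b, ⟨0, 𝟙 X, ?_, ?_⟩, ?_, ?_, ?_⟩
  · exact A.map_id_apply X x
  · exact B.map_id_apply X y
  · rintro X Y f a b ⟨n, g, rfl, rfl⟩
    exact ⟨n, g ≫ f, by rw [map_map], by rw [map_map]⟩
  · rintro X X' a b a' b' ⟨n, g, rfl, rfl⟩ ⟨n', g', rfl, rfl⟩
    obtain ⟨h, h₁, h₂⟩ := hle (le_max_left n n')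
    obtain ⟨h', h₁', h₂'⟩ := hle (le_max_right n n')
    refine ⟨_, _, _, h ≫ g, h' ≫ g', (p (max n n')).2, ?_, ?_, ?_, ?_⟩
    · rw [← map_map, h₁]
    · rw [← map_map, h₂]
    · rw [← map_map, h₁']
    · rw [← map_map, h₂']
  · intro n
    exact ⟨_, _, _, ⟨n + 1, 𝟙 _, A.map_id_apply _ _, B.map_id_apply _ _⟩, hD n (p n)⟩

end Graph

/-! ### Sequential pro-objects -/

section Sequential

variable {E : Type u} [Category.{v} E] [Regular E] {A B : E ⥤ Type w} {l m : Subobject (⊤_ E)}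

/-- Each element of `A` comes from a member of a sequence of elements. This holds for the functor of
points of a sequential pro-object. -/
def HasCofinalSequence (A : E ⥤ Type w) : Prop :=
  ∃ (Y : ℕ → E) (u : ∀ n, A.obj (Y n)), ∀ (X : E) (a : A.obj X), ∃ (n : ℕ) (f : Y n ⟶ X),
    A.map f (u n) = a

/-- A pair `(v, w)` with `v` generic can be lifted in such a way that a given element `y` comes
from the first entry. -/
lemma exists_forth (hfin : FinitelyPowered E) (hA : IsFlat A) (hB : IsRich m B) {V Y : E}
    {v : A.obj V} (w : B.obj V) (hv : IsGeneric A v) (y : A.obj Y) :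
    ∃ (V' : E) (v' : A.obj V') (w' : B.obj V') (p : V' ⟶ V) (f : V' ⟶ Y), IsGeneric A v' ∧
      (IsGeneric B w → IsGeneric B w') ∧ A.map p v' = v ∧ B.map p w' = w ∧ A.map f v' = y := by
  obtain ⟨V', v', p, f, hv', rfl, rfl⟩ := hA.exists_generic_dominate hfin v y
  obtain ⟨w', hw', rfl⟩ := hB.exists_lift_generic hfin p (hv p v' rfl) w
  exact ⟨V', v', w', p, f, hv', hw', rfl, rfl, rfl⟩

/-- Lifting of morphisms in the sequential case. -/
lemma HasCofinalSequence.exists_natTrans (hA' : HasCofinalSequence A) (hfin : FinitelyPowered E)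
    (hA : IsFlat A) (hB : IsRich m B) {X : E} {x : A.obj X} (hx : IsGeneric A x) (y : B.obj X) :
    ∃ φ : A ⟶ B, φ.app X x = y := by
  obtain ⟨Y, u, hu⟩ := hA'
  obtain ⟨Γ, hΓ, hmap, hdir, htot⟩ := exists_graph_of_steps (A := A) (B := B)
    (fun V v _ => IsGeneric A v) (fun n V v _ => ∃ f : V ⟶ Y n, A.map f v = u n)
    (fun n V v w hv => by
      obtain ⟨V', v', w', p, f, hv', -, h₁, h₂, h₃⟩ := exists_forth hfin hA hB w hv (u n)
      exact ⟨V', v', w', p, hv', h₁, h₂, f, h₃⟩) (x := x) (y := y) hx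
  obtain ⟨φ, hφ⟩ := exists_natTrans_of_graph hA Γ hdir (fun {Z} a => by
    obtain ⟨n, g, rfl⟩ := hu Z a
    obtain ⟨V, v, w, h, f, hf⟩ := htot n
    rw [← hf]
    exact ⟨_, hmap g (hmap f h)⟩)
  exact ⟨φ, hφ X x y hΓ⟩

/-- Back-and-forth in the sequential case. -/
lemma HasCofinalSequence.exists_natIso (hA' : HasCofinalSequence A) (hB' : HasCofinalSequence B)
    (hfin : FinitelyPowered E) (hA : IsRich l A) (hB : IsRich m B) {X : E} {x : A.obj X}
    (hx : IsGeneric A x) {y : B.obj X} (hy : IsGeneric B y) :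
    ∃ φ : A ≅ B, φ.hom.app X x = y := by
  obtain ⟨Y, u, hu⟩ := hA'
  obtain ⟨Y', u', hu'⟩ := hB'
  obtain ⟨Γ, hΓ, hmap, hdir, htot⟩ := exists_graph_of_steps (A := A) (B := B)
    (fun V v w => IsGeneric A v ∧ IsGeneric B w)
    (fun n V v w => (∃ f : V ⟶ Y n, A.map f v = u n) ∧ ∃ f : V ⟶ Y' n, B.map f w = u' n)
    (fun n V v w hv => by
      obtain ⟨V₁, v₁, w₁, p₁, f₁, hv₁, hw₁, rfl, rfl, h₁⟩ :=
        exists_forth hfin hA.flat hB w hv.1 (u n)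
      obtain ⟨V₂, w₂, v₂, p₂, f₂, hw₂, hv₂, rfl, rfl, h₂⟩ :=
        exists_forth hfin hB.flat hA v₁ (hw₁ hv.2) (u' n)
      exact ⟨V₂, v₂, w₂, p₂ ≫ p₁, ⟨hv₂ hv₁, hw₂⟩, by rw [map_map], by rw [map_map],
        ⟨p₂ ≫ f₁, by rw [← map_map, h₁]⟩, f₂, h₂⟩) (x := x) (y := y) ⟨hx, hy⟩
  obtain ⟨φ, hφ⟩ := exists_natIso_of_graph hA.flat hB.flat Γ (fun h h' => by
      obtain ⟨V, c, d, f, f', hc, h⟩ := hdir h h'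
      exact ⟨V, c, d, f, f', hc.1, hc.2, h⟩)
    (fun {Z} a => by
      obtain ⟨n, g, rfl⟩ := hu Z a
      obtain ⟨V, v, w, h, ⟨f, hf⟩, -⟩ := htot n
      rw [← hf]
      exact ⟨_, hmap g (hmap f h)⟩)
    (fun {Z} b => by
      obtain ⟨n, g, rfl⟩ := hu' Z b
      obtain ⟨V, v, w, h, -, f, hf⟩ := htot n
      rw [← hf]
      exact ⟨_, hmap g (hmap f h)⟩)
  exact ⟨φ, hφ X x y hΓ⟩

omit [Regular E] in
lemma hasCofinalSequence_points {P : ProObj.{w} E} (e : P.J ≌ ℕᵒᵖ) :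
    HasCofinalSequence P.points := by
  refine ⟨fun n => P.diag.obj (e.inverse.obj (op n)), fun n => P.proj _, fun X a => ?_⟩
  obtain ⟨j, f, rfl⟩ := ProObj.exists_map_proj a
  refine ⟨(e.functor.obj j).unop, P.diag.map (e.unitInv.app j) ≫ f, ?_⟩
  rw [← map_map]
  congr 1
  exact ProObj.map_map_proj P (e.unitInv.app j)

lemma pointsLift_of_isSequential {Ω : ProFamily E} (hfin : FinitelyPowered E)
    (hΩ : Ω.IsUniversalHomogeneous) (hseq : Ω.IsSequential) : PointsLift Ω := by
  intro l m X x y hx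
  obtain ⟨e⟩ := hseq l
  obtain ⟨φ, hφ⟩ := (hasCofinalSequence_points (P := proInE Ω l) e).exists_natTrans hfin
    (pts_flat l) (pts_rich hΩ m) hx y
  obtain ⟨s, hs⟩ := exists_act_eq φ
  exact ⟨s, (hs X x).trans hφ⟩

end Sequential

/-! ### Pro-objects that lift along countably many surjections -/

section Chain

variable {E : Type u} [Category.{v} E] [Regular E]

/-- The functor `A` satisfies the lifting condition of `IsRich` for the morphism `f`. -/
def LiftsGeneric (A : E ⥤ Type w) {Z X : E} (f : Z ⟶ X) : Prop :=
  ∀ a : A.obj X, IsGeneric A a → ∃ b : A.obj Z, IsGeneric A b ∧ A.map f b = a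

/-- Given a surjection `f : Z ⟶ X`, there is a surjection `p : Y' ⟶ Y` such that each surjection
`Y ⟶ X` lifts to `Y' ⟶ Z`. Since there are finitely many morphisms `Y ⟶ X`, they can be treated one
by one. -/
lemma exists_lift_all (hfin : FinitelyPowered E) (Y : E) {Z X : E} (f : Z ⟶ X)
    (hf : IsRegularEpi f) : ∃ (Y' : E) (p : Y' ⟶ Y), IsRegularEpi p ∧
      ∀ g : Y ⟶ X, IsRegularEpi g → ∃ h : Y' ⟶ Z, IsRegularEpi h ∧ h ≫ f = p ≫ g := by
  have := finite_hom hfin Y X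
  have key : ∀ s : Set (Y ⟶ X), s.Finite → ∃ (Y' : E) (p : Y' ⟶ Y), IsRegularEpi p ∧
      ∀ g ∈ s, IsRegularEpi g → ∃ h : Y' ⟶ Z, IsRegularEpi h ∧ h ≫ f = p ≫ g := by
    intro s hs
    induction s, hs using Set.Finite.induction_on with
    | empty => exact ⟨Y, 𝟙 Y, inferInstance, by simp⟩
    | insert _ _ ih =>
      rename_i g₀ s _ _
      obtain ⟨Y', p, hp, h⟩ := ih
      refine ⟨pullback f (p ≫ g₀), pullback.snd f (p ≫ g₀) ≫ p,
        isRegularEpi_comp inferInstance hp, fun g hg hg' => ?_⟩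
      obtain rfl | hg := hg
      · have := isRegularEpi_comp hp hg'
        exact ⟨pullback.fst f _, inferInstance, by rw [pullback.condition, Category.assoc]⟩
      · obtain ⟨k, hk, e⟩ := h g hg hg'
        exact ⟨pullback.snd f _ ≫ k, isRegularEpi_comp inferInstance hk, by
          rw [Category.assoc, Category.assoc, e]⟩
  obtain ⟨Y', p, hp, h⟩ := key Set.univ Set.finite_univ
  exact ⟨Y', p, hp, fun g => h g trivial⟩

instance : IsCofiltered (AsSmall.{w} ℕᵒᵖ) := IsCofiltered.of_equivalence AsSmall.equiv

/-- A sequential pro-object of `E^s_λ` whose functor of points lifts generic elements along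
countably many given surjections. Each surjection is treated infinitely often, so that
eventually all surjections from the pro-object are lifted. -/
lemma exists_sequential_lift (hfin : FinitelyPowered E) (l : Subobject (⊤_ E))
    (S : Set (Arrow E)) (hS : S.Countable) (hS' : ∀ f ∈ S, IsRegularEpi f.hom) :
    ∃ P : ProObj.{w} (SurjOfType l), P.IsSequential ∧
      ∀ f ∈ S, LiftsGeneric (P.push (SurjOfType.incl l)).points f.hom := by
  obtain ⟨f, hf, hfS⟩ : ∃ f : ℕ → Arrow E, (∀ k, IsRegularEpi (f k).hom) ∧
      ∀ g ∈ S, ∃ k, f k = g := by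
    obtain ⟨f, hf⟩ := (hS.insert (Arrow.mk (𝟙 (l : E)))).exists_eq_range (Set.insert_nonempty _ _)
    refine ⟨f, fun k => ?_, fun g hg => ?_⟩
    · have : f k ∈ insert (Arrow.mk (𝟙 (l : E))) S := hf ▸ Set.mem_range_self k
      obtain h | h := this
      · rw [h]
        change IsRegularEpi (𝟙 (l : E))
        infer_instance
      · exact hS' _ h
    · have : g ∈ Set.range f := hf ▸ Set.mem_insert_of_mem _ hg
      exact this
  have step : ∀ (k : ℕ) (Y : SurjOfType l), ∃ (Y' : SurjOfType l) (p : Y' ⟶ Y),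
      ∀ g : Y.obj.obj ⟶ (f k).right, IsRegularEpi g →
        ∃ h : Y'.obj.obj ⟶ (f k).left, IsRegularEpi h ∧
          h ≫ (f k).hom = (SurjOfType.incl l).map p ≫ g := by
    intro k Y
    obtain ⟨Y', p, hp, h⟩ := exists_lift_all hfin Y.obj.obj (f k).hom (hf k)
    exact ⟨⟨⟨Y'⟩, (objType_eq_of_isRegularEpi hp).trans Y.property⟩, ProObj.surjMk p hp, h⟩
  choose next p hp using step
  have hl : objType (l : E) = l := objType_eq_iff.2 ⟨𝟙 _, inferInstance⟩
  let Y : ℕ → SurjOfType l := fun n => Nat.rec ⟨⟨(l : E)⟩, hl⟩ (fun n => next n.unpair.1) n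
  let F : ℕᵒᵖ ⥤ SurjOfType l := Functor.ofOpSequence (X := Y) (fun n => p n.unpair.1 (Y n))
  let P : ProObj.{w} (SurjOfType l) := { J := AsSmall.{w} ℕᵒᵖ, diag := AsSmall.down ⋙ F }
  refine ⟨P, ⟨AsSmall.equiv.symm⟩, fun g hg a ha => ?_⟩
  obtain ⟨k, rfl⟩ := hfS g hg
  obtain ⟨j, q, hq, rfl⟩ :=
    (ProObj.HomTo.isSurj_iff_isGeneric (ProObj.isRegularEpi_push_map P) a).2 ha
  -- a stage `n ≥ j` at which lifts along `f k` are added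
  obtain ⟨n, hn, hjn⟩ : ∃ n : ℕ, n.unpair.1 = k ∧ (AsSmall.down.obj j).unop ≤ n :=
    ⟨Nat.pair k (AsSmall.down.obj j).unop, by simp, Nat.right_le_pair _ _⟩
  subst hn
  let D := (P.push (SurjOfType.incl l)).diag
  let N : ℕ → (P.push (SurjOfType.incl l)).J := fun n => AsSmall.up.obj (op n)
  let t : N n ⟶ j := ULift.up (homOfLE hjn).op
  let r : N (n + 1) ⟶ N n := ULift.up (homOfLE (Nat.le_add_right n 1)).op
  have hr : D.map r = (SurjOfType.incl l).map (p n.unpair.1 (Y n)) :=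
    congrArg (SurjOfType.incl l).map (Functor.ofOpSequence_map_homOfLE_succ _ n)
  obtain ⟨h, hh, e⟩ := hp n.unpair.1 (Y n) (D.map t ≫ q)
    (isRegularEpi_comp (ProObj.isRegularEpi_push_map P t) hq)
  let h' : D.obj (N (n + 1)) ⟶ (f n.unpair.1).left := h
  refine ⟨ProObj.HomTo.mk (P.push (SurjOfType.incl l)) (N (n + 1)) h', ?_, ?_⟩
  · rw [← ProObj.HomTo.isSurj_iff_isGeneric (ProObj.isRegularEpi_push_map P)]
    exact ⟨N (n + 1), h', hh, rfl⟩
  · refine (ProObj.HomTo.mk_eq_iff _ _).2 ⟨N (n + 1), 𝟙 _, r ≫ t, ?_⟩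
    have e' : h' ≫ (f n.unpair.1).hom = D.map r ≫ D.map t ≫ q := by
      refine e.trans ?_
      rw [← hr]
      rfl
    change D.map (𝟙 (N (n + 1))) ≫ h' ≫ (f n.unpair.1).hom = D.map (r ≫ t) ≫ q
    rw [D.map_id, Category.id_comp, D.map_comp, Category.assoc, e']

/-- If there are countably many isomorphism classes, a sequential pro-object can lift along all
surjections, and then it is universal and homogeneous by back-and-forth. -/
lemma exists_universalHomogeneous_isSequential (hfin : FinitelyPowered E)
    (hE : CountablyManyIsoClasses E) :
    ∃ Ω : ProFamily E, Ω.IsUniversalHomogeneous ∧ Ω.IsSequential := by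
  have : Countable (Quotient (isIsomorphicSetoid E)) := hE
  -- surjections between chosen representatives of the isomorphism classes
  let R : Quotient (isIsomorphicSetoid E) → E := Quotient.out
  have e : ∀ X : E, Nonempty (X ≅ R (Quotient.mk _ X)) := fun X =>
    (Quotient.exact (s := isIsomorphicSetoid E) (Quotient.out_eq (Quotient.mk _ X))).map Iso.symm
  have := fun x y => finite_hom hfin (R x) (R y)
  let S : Set (Arrow E) := Set.range fun t : Σ (x y : Quotient (isIsomorphicSetoid E)),
    {f : R x ⟶ R y // IsRegularEpi f} => Arrow.mk t.2.2.1
  have hS : S.Countable := Set.countable_range _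
  have key : ∀ l : Subobject (⊤_ E), ∃ P : ProObj.{max u v} (SurjOfType l), P.IsSequential ∧
      P.IsUniversal ∧ P.IsHomogeneous := by
    intro l
    obtain ⟨P, ⟨hseq⟩, hP⟩ := exists_sequential_lift.{max u v} hfin l S hS (by
      rintro _ ⟨⟨x, y, f, hf⟩, rfl⟩
      exact hf)
    have hflat := ProObj.points_isFlat (P.push (SurjOfType.incl l))
    have hrich : IsRich l (P.push (SurjOfType.incl l)).points :=
      { flat := hflat
        objType_eq := ProObj.objType_eq_of_isGeneric P
        lift := by
          intro X Z f hf a ha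
          obtain ⟨eX⟩ := e X
          obtain ⟨eZ⟩ := e Z
          have h₁ : IsRegularEpi eX.hom := Regular.isRegularEpi_of_extremalEpi _
          have h₂ : IsRegularEpi eZ.inv := Regular.isRegularEpi_of_extremalEpi _
          obtain ⟨b, hb, h⟩ := hP (Arrow.mk (eZ.inv ≫ f ≫ eX.hom))
            ⟨⟨_, _, _, isRegularEpi_comp h₂ (isRegularEpi_comp hf h₁)⟩, rfl⟩ _ (ha.map hflat h₁)
          refine ⟨_, hb.map hflat h₂, ?_⟩
          have h' := congrArg ((P.push (SurjOfType.incl l)).points.map eX.inv) h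
          rw [map_map, map_map] at h'
          rw [map_map]
          simpa using h' }
    have hcof := hasCofinalSequence_points (P := P.push (SurjOfType.incl l)) hseq
    exact ⟨P, ⟨hseq⟩, ProObj.isUniversal_and_isHomogeneous hfin P hrich
      fun x y hx hy => hcof.exists_natIso hcof hfin hrich hrich hx hy⟩
  choose Ω h₁ h₂ using key
  exact ⟨Ω, h₂, h₁⟩

end Chain

/-! ### Ultraproducts of flat functors -/

section Ultraproduct

variable {E : Type u} [Category.{v} E] {I : Type w} (U : Ultrafilter I) (A : I → E ⥤ Type w)

/-- Families of elements of the sets `A i X` that are defined for almost all `i`. Since some of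
these sets may be empty, the families are not required to be defined everywhere. -/
def PartialFamily (X : E) : Type w :=
  {a : ∀ i, Option ((A i).obj X) // ∀ᶠ i in U, (a i).isSome}

/-- Equality almost everywhere. -/
instance partialFamilySetoid (X : E) : Setoid (PartialFamily U A X) where
  r a b := ∀ᶠ i in U, a.1 i = b.1 i
  iseqv :=
    { refl := fun _ => Filter.Eventually.of_forall fun _ => rfl
      symm := fun h => h.mono fun _ h => h.symm
      trans := fun h h' => by
        filter_upwards [h, h'] with i h h'
        exact h.trans h' }

/-- The ultraproduct of a family of functors `E ⥤ Type`, formed objectwise. -/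
def ultraproduct : E ⥤ Type w where
  obj X := Quotient (partialFamilySetoid U A X)
  map {X Y} f := ↾(Quotient.map
    (fun a => ⟨fun i => (a.1 i).map ((A i).map f), a.2.mono fun i h => by simpa using h⟩)
    (fun a b h => Filter.Eventually.mono (p := fun i => a.1 i = b.1 i) h fun i h => by
      change (a.1 i).map _ = (b.1 i).map _
      rw [h]))
  map_id X := by
    ext a
    obtain ⟨a, rfl⟩ := Quotient.exists_rep a
    refine Quotient.sound (Filter.Eventually.of_forall fun i => ?_)
    change (a.1 i).map _ = a.1 i
    cases a.1 i <;> simp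
  map_comp f g := by
    ext a
    obtain ⟨a, rfl⟩ := Quotient.exists_rep a
    refine Quotient.sound (Filter.Eventually.of_forall fun i => ?_)
    change (a.1 i).map _ = ((a.1 i).map _).map _
    cases a.1 i <;> simp

variable {U A}

/-- `b` is the `i`-th entry of a chosen representative of `β`. -/
def IsEntry {X : E} (β : (ultraproduct U A).obj X) (i : I) (b : (A i).obj X) : Prop :=
  (Quotient.out β : PartialFamily U A X).1 i = some b

lemma IsEntry.eq {X : E} {β : (ultraproduct U A).obj X} {i : I} {b c : (A i).obj X}
    (hb : IsEntry β i b) (hc : IsEntry β i c) : b = c := by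
  have := hb.symm.trans hc
  simpa using this

/-- The property `P i` holds for almost all entries of `β`. -/
def Holds {X : E} (β : (ultraproduct U A).obj X) (P : ∀ i, (A i).obj X → Prop) : Prop :=
  ∀ᶠ i in U, ∃ b, IsEntry β i b ∧ P i b

lemma holds_isEntry {X : E} (β : (ultraproduct U A).obj X) : Holds β (IsEntry β) := by
  refine (Quotient.out β : PartialFamily U A X).2.mono fun i h => ?_
  obtain ⟨b, hb⟩ := Option.isSome_iff_exists.1 h
  exact ⟨b, hb, hb⟩

section

variable {X Y : E} {β γ : (ultraproduct U A).obj X} {P Q : ∀ i, (A i).obj X → Prop}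

lemma holds_mk (a : PartialFamily U A X) (h : ∀ᶠ i in U, ∃ b, a.1 i = some b ∧ P i b) :
    Holds (Quotient.mk _ a : (ultraproduct U A).obj X) P := by
  have h' : ∀ᶠ i in U, (Quotient.out (Quotient.mk (partialFamilySetoid U A X) a)).1 i = a.1 i :=
    Quotient.mk_out a
  filter_upwards [h, h'] with i ⟨b, hb, hP⟩ h'
  exact ⟨b, h'.trans hb, hP⟩

lemma Holds.and_mono {R : ∀ i, (A i).obj X → Prop} (h : Holds β P) (h' : Holds β Q)
    (hR : ∀ᶠ i in U, ∀ b, P i b → Q i b → R i b) : Holds β R := by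
  filter_upwards [h, h', hR] with i ⟨b, hb, hP⟩ ⟨c, hc, hQ⟩ hR
  obtain rfl := hb.eq hc
  exact ⟨b, hb, hR b hP hQ⟩

lemma Holds.mono (h : Holds β P) (hQ : ∀ᶠ i in U, ∀ b, P i b → Q i b) : Holds β Q :=
  h.and_mono h (hQ.mono fun _ h b hb _ => h b hb)

lemma Holds.eventually_exists (h : Holds β P) : ∀ᶠ i in U, ∃ b, P i b :=
  Filter.Eventually.mono h fun _ ⟨b, _, hb⟩ => ⟨b, hb⟩

lemma exists_holds (h : ∀ᶠ i in U, ∃ b, P i b) : ∃ β : (ultraproduct U A).obj X, Holds β P := by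
  classical
  refine ⟨Quotient.mk _ ⟨fun i => if h : ∃ b, P i b then some h.choose else none, ?_⟩,
    holds_mk _ ?_⟩
  · filter_upwards [h] with i h
    simp [h]
  · filter_upwards [h] with i h
    exact ⟨h.choose, dif_pos h, h.choose_spec⟩

lemma Holds.ext (h : Holds β P) (h' : Holds γ Q)
    (he : ∀ᶠ i in U, ∀ b c, P i b → Q i c → b = c) : β = γ := by
  refine (Quotient.out_eq (s := partialFamilySetoid U A X) β).symm.trans
    (Eq.trans (Quotient.sound ?_) (Quotient.out_eq (s := partialFamilySetoid U A X) γ))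
  refine (show ∀ᶠ i in (U : Filter I), (Quotient.out β : PartialFamily U A X).1 i =
    (Quotient.out γ : PartialFamily U A X).1 i from ?_)
  filter_upwards [h, h', he] with i ⟨b, hb, hP⟩ ⟨c, hc, hQ⟩ he
  exact hb.trans ((congrArg some (he b c hP hQ)).trans hc.symm)

lemma holds_or_not (β : (ultraproduct U A).obj X) (P : ∀ i, (A i).obj X → Prop) :
    Holds β P ∨ Holds β fun i b => ¬ P i b := by
  refine Ultrafilter.eventually_or.1 
    (Filter.Eventually.mono (holds_isEntry β) fun i ⟨b, hb, _⟩ => ?_)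
  by_cases h : P i b
  · exact Or.inl ⟨b, hb, h⟩
  · exact Or.inr ⟨b, hb, h⟩

lemma Holds.map {f : X ⟶ Y} {R : ∀ i, (A i).obj Y → Prop}
    (h : Holds β fun i b => R i ((A i).map f b)) : Holds ((ultraproduct U A).map f β) R := by
  have h' : Quotient.mk (partialFamilySetoid U A X) (Quotient.out β) = β := Quotient.out_eq β
  rw [← h']
  refine holds_mk _ (Filter.Eventually.mono h fun i ⟨b, hb, hR⟩ => ⟨_, ?_, hR⟩)
  change ((Quotient.out β).1 i).map _ = _
  rw [show (Quotient.out β).1 i = some b from hb]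
  rfl

lemma holds_map_iff {f : X ⟶ Y} {R : ∀ i, (A i).obj Y → Prop} :
    Holds ((ultraproduct U A).map f β) R ↔ Holds β fun i b => R i ((A i).map f b) := by
  refine ⟨fun h => ?_, Holds.map⟩
  obtain h' | h' := holds_or_not β fun i b => R i ((A i).map f b)
  · exact h'
  · have h'' := Holds.map (R := fun i c => ¬ R i c) h'
    have h₀ := h.and_mono h'' (R := fun _ _ => False)
      (Filter.Eventually.of_forall fun i b h h' => h' h)
    obtain ⟨i, b, h₀⟩ := h₀.eventually_exists.exists
    exact h₀.elim

end

section

variable [Regular E]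

lemma IsFlat.exists_prod {B : E ⥤ Type w} (hB : IsFlat B) {X Y : E} (a : B.obj X) (b : B.obj Y) :
    ∃ c : B.obj (X ⨯ Y), B.map prod.fst c = a ∧ B.map prod.snd c = b := by
  obtain ⟨Z, c, f, g, rfl, rfl⟩ := hB.dominate a b
  exact ⟨B.map (prod.lift f g) c, by rw [map_map, prod.lift_fst], by rw [map_map, prod.lift_snd]⟩

lemma IsFlat.exists_equalizer {B : E ⥤ Type w} (hB : IsFlat B) {X Y : E} (f g : X ⟶ Y)
    (a : B.obj X) (h : B.map f a = B.map g a) :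
    ∃ c : B.obj (equalizer f g), B.map (equalizer.ι f g) c = a := by
  obtain ⟨Z, c, r, rfl, hr⟩ := hB.equalize f g a h
  exact ⟨B.map (equalizer.lift r hr) c, by rw [map_map, equalizer.lift_ι]⟩

lemma isFlat_ultraproduct (hA : ∀ i, IsFlat (A i)) : IsFlat (ultraproduct U A) where
  nonempty := by
    refine ⟨⊤_ E, ?_⟩
    obtain ⟨β, -⟩ := exists_holds (U := U) (A := A) (X := ⊤_ E) (P := fun _ _ => True)
      (Filter.Eventually.of_forall fun i => by
        obtain ⟨X, ⟨a⟩⟩ := (hA i).nonempty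
        exact ⟨(A i).map (terminal.from X) a, trivial⟩)
    exact ⟨β⟩
  dominate {X Y} β γ := by
    obtain ⟨δ, hδ⟩ := exists_holds (U := U) (A := A) (X := X ⨯ Y)
      (P := fun i c => IsEntry β i ((A i).map prod.fst c) ∧ IsEntry γ i ((A i).map prod.snd c)) (by
        filter_upwards [(holds_isEntry β).eventually_exists, (holds_isEntry γ).eventually_exists]
          with i ⟨a, ha⟩ ⟨b, hb⟩
        obtain ⟨c, rfl, rfl⟩ := (hA i).exists_prod a b
        exact ⟨c, ha, hb⟩)
    refine ⟨X ⨯ Y, δ, prod.fst, prod.snd, ?_, ?_⟩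
    · exact (hδ.mono (Filter.Eventually.of_forall fun i b h => h.1)).map.ext (holds_isEntry β)
        (Filter.Eventually.of_forall fun i b c => IsEntry.eq)
    · exact (hδ.mono (Filter.Eventually.of_forall fun i b h => h.2)).map.ext (holds_isEntry γ)
        (Filter.Eventually.of_forall fun i b c => IsEntry.eq)
  equalize {X Y} f g β h := by
    have h₁ : Holds ((ultraproduct U A).map f β)
        fun i c => ∃ b, IsEntry β i b ∧ (A i).map f b = c :=
      ((holds_isEntry β).mono (Filter.Eventually.of_forall fun i b hb => ⟨b, hb, rfl⟩)).map
    rw [h, holds_map_iff] at h₁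
    obtain ⟨δ, hδ⟩ := exists_holds (U := U) (A := A) (X := equalizer f g)
      (P := fun i c => IsEntry β i ((A i).map (equalizer.ι f g) c)) (by
        filter_upwards [(h₁.and_mono (holds_isEntry β) (R := fun i b => IsEntry β i b ∧
          (A i).map f b = (A i).map g b) (Filter.Eventually.of_forall
            fun i b ⟨b', hb', e⟩ hb => by
              obtain rfl := hb'.eq hb
              exact ⟨hb, e⟩)).eventually_exists] with i ⟨b, hb, e⟩
        obtain ⟨c, rfl⟩ := (hA i).exists_equalizer f g b e
        exact ⟨c, hb⟩)
    exact ⟨_, δ, equalizer.ι f g, hδ.map.ext (holds_isEntry β)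
      (Filter.Eventually.of_forall fun i b c => IsEntry.eq), equalizer.condition f g⟩

lemma exists_subobject_of_not_isGeneric {B : E ⥤ Type w} {X : E} {b : B.obj X}
    (hb : ¬ IsGeneric B b) :
    ∃ Y : Subobject X, ¬ IsRegularEpi Y.arrow ∧ ∃ c, B.map Y.arrow c = b := by
  unfold IsGeneric at hb
  push Not at hb
  obtain ⟨Z, f, c, rfl, hf⟩ := hb
  obtain ⟨J, e, m, he, hm, rfl⟩ := exists_isRegularEpi_mono_fac f
  refine ⟨Subobject.mk m, fun h => hf ?_, B.map (e ≫ (Subobject.underlyingIso m).inv) c, ?_⟩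
  · rw [← Subobject.underlyingIso_hom_comp_eq_mk m] at h
    exact isRegularEpi_comp he (isRegularEpi_of_comp h)
  · rw [map_map, Category.assoc, Subobject.underlyingIso_arrow]

/-- An element of an ultraproduct is generic if and only if almost all its entries are. As there are
finitely many proper subobjects, entries that come from proper subobjects come from the same one
almost everywhere. -/
lemma isGeneric_ultraproduct_iff (hfin : FinitelyPowered E) {X : E}
    (β : (ultraproduct U A).obj X) :
    IsGeneric (ultraproduct U A) β ↔ Holds β fun i b => IsGeneric (A i) b := by
  constructor
  · intro h
    refine (holds_or_not β _).resolve_right fun h' => ?_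
    have := hfin X
    have hex : ∀ᶠ i in (U : Filter I), ∃ Y : Subobject X, ¬ IsRegularEpi Y.arrow ∧
        ∃ c, IsEntry β i ((A i).map Y.arrow c) := by
      refine Filter.Eventually.mono h' fun i ⟨b, hb, hb'⟩ => ?_
      obtain ⟨Y, hY, c, rfl⟩ := exists_subobject_of_not_isGeneric hb'
      exact ⟨Y, hY, c, hb⟩
    obtain ⟨Y, hY⟩ := Ultrafilter.eventually_exists_iff.1 hex
    obtain ⟨i, hi, -⟩ := hY.exists
    obtain ⟨γ, hγ⟩ := exists_holds (U := U) (A := A) (X := (Y : E))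
      (P := fun i c => IsEntry β i ((A i).map Y.arrow c)) (hY.mono fun i h => h.2)
    exact hi (h Y.arrow γ (hγ.map.ext (holds_isEntry β)
      (Filter.Eventually.of_forall fun i b c => IsEntry.eq)))
  · rintro h Y f γ rfl
    obtain ⟨i, c, hc⟩ := (holds_map_iff.1 h).eventually_exists.exists
    exact hc f c rfl

variable {l : Subobject (⊤_ E)}

/-- The ultraproduct is rich if, for each surjection, almost all factors satisfy the lifting
condition. -/
lemma isRich_ultraproduct (hfin : FinitelyPowered E) (hA : ∀ i, IsFlat (A i))
    (htype : ∀ i {X : E} (a : (A i).obj X), IsGeneric (A i) a → objType X = l)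
    (hlift : ∀ {Z X : E} (f : Z ⟶ X), IsRegularEpi f → ∀ᶠ i in (U : Filter I),
      LiftsGeneric (A i) f) : IsRich l (ultraproduct U A) where
  flat := isFlat_ultraproduct hA
  objType_eq β hβ := by
    obtain ⟨i, b, hb⟩ := ((isGeneric_ultraproduct_iff hfin β).1 hβ).eventually_exists.exists
    exact htype i b hb
  lift {X Z} f hf β hβ := by
    have hβ' := (isGeneric_ultraproduct_iff hfin β).1 hβ
    obtain ⟨γ, hγ⟩ := exists_holds (U := U) (A := A) (X := Z)
      (P := fun i c => IsGeneric (A i) c ∧ IsEntry β i ((A i).map f c)) (by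
        filter_upwards [hlift f hf, hβ'] with i h ⟨b, hb, hb'⟩
        obtain ⟨c, hc, rfl⟩ := h b hb'
        exact ⟨c, hc, hb⟩)
    refine ⟨γ, (isGeneric_ultraproduct_iff hfin γ).2
      (hγ.mono (Filter.Eventually.of_forall fun i b h => h.1)), ?_⟩
    exact (hγ.mono (Filter.Eventually.of_forall fun i b h => h.2)).map.ext (holds_isEntry β)
      (Filter.Eventually.of_forall fun i b c => IsEntry.eq)

variable {B : E ⥤ Type w}

lemma IsRich.ultrapower (hfin : FinitelyPowered E) (hB : IsRich l B) (U : Ultrafilter I) :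
    IsRich l (ultraproduct U fun _ => B) :=
  isRich_ultraproduct hfin (fun _ => hB.flat) (fun _ => hB.objType_eq)
    (fun f hf => Filter.Eventually.of_forall fun _ => hB.lift f hf)

end

/-- The diagonal embedding in an ultrapower. -/
def ultraDiag (U : Ultrafilter I) (B : E ⥤ Type w) : B ⟶ ultraproduct U fun _ => B where
  app X := ↾fun a => Quotient.mk (partialFamilySetoid U (fun _ => B) X)
    ⟨fun _ => some a, Filter.Eventually.of_forall fun _ => rfl⟩

lemma holds_ultraDiag {B : E ⥤ Type w} {X : E} (a : B.obj X) :
    Holds ((ultraDiag U B).app X a) fun _ b => b = a :=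
  holds_mk _ (Filter.Eventually.of_forall fun _ => ⟨a, rfl, rfl⟩)

lemma ultraDiag_injective {B : E ⥤ Type w} (X : E) :
    Function.Injective ((ultraDiag U B).app X) := by
  intro a b h
  have h' := holds_ultraDiag (U := U) a
  rw [h] at h'
  obtain ⟨i, c, h₁, h₂⟩ := (h'.and_mono (holds_ultraDiag b) (R := fun _ c => c = a ∧ c = b)
    (Filter.Eventually.of_forall fun _ _ h h' => ⟨h, h'⟩)).eventually_exists.exists
  exact h₁.symm.trans h₂

lemma isGeneric_ultraDiag [Regular E] (hfin : FinitelyPowered E) {B : E ⥤ Type w} {X : E}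
    {a : B.obj X} (ha : IsGeneric B a) : IsGeneric _ ((ultraDiag U B).app X a) := by
  rw [isGeneric_ultraproduct_iff hfin]
  refine (holds_ultraDiag a).mono (Filter.Eventually.of_forall ?_)
  rintro _ _ rfl
  exact ha

end Ultraproduct

/-! ### Extension of partial morphisms to ultrapowers -/

section Extension

variable {E : Type u} [Category.{v} E]

/-- A relation between elements of `A` and `B` is a directed graph if it is nonempty and any two
pairs in it come from a pair in it whose first entry is generic. Such a relation is a partially
defined morphism from `A` to `B`. -/
structure IsDirectedGraph {A B : E ⥤ Type w} (Γ : ∀ X : E, A.obj X → B.obj X → Prop) : Prop where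
  nonempty : ∃ (X : E) (a : A.obj X) (b : B.obj X), Γ X a b
  dir : ∀ {X X' : E} {a b a' b'}, Γ X a b → Γ X' a' b' → ∃ (V : E) (c : A.obj V) (d : B.obj V)
    (f : V ⟶ X) (f' : V ⟶ X'), IsGeneric A c ∧ Γ V c d ∧ A.map f c = a ∧ B.map f d = b ∧
      A.map f' c = a' ∧ B.map f' d = b'

/-- A finite approximation of a morphism from `A` to `B`: a generic element `q` of `A` and a
prospective image `p` of `q`, which has to be generic if `G` holds. -/
structure Approximation (A B : E ⥤ Type w) (G : Prop) where
  /-- the object that carries the elements -/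
  Z : E
  /-- the generic element of `A` -/
  q : A.obj Z
  /-- its image in `B` -/
  p : B.obj Z
  isGeneric_q : IsGeneric A q
  isGeneric_p : G → IsGeneric B p

/-- The approximation `π` sends `a` to `b`. -/
def Approximation.Sends {A B : E ⥤ Type w} {G : Prop} (π : Approximation A B G) {X : E}
    (a : A.obj X) (b : B.obj X) : Prop :=
  ∃ g : π.Z ⟶ X, A.map g π.q = a ∧ B.map g π.p = b

variable {A B : E ⥤ Type w} {G : Prop}

lemma Approximation.Sends.eq {π : Approximation A B G} (hA : IsFlat A) {X Y : E} (f : X ⟶ Y)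
    {a : A.obj X} {b : B.obj X} {c : B.obj Y} (h : π.Sends a b) (h' : π.Sends (A.map f a) c) :
    B.map f b = c := by
  obtain ⟨g, rfl, rfl⟩ := h
  obtain ⟨g', h', rfl⟩ := h'
  rw [map_map] at h'
  rw [map_map, π.isGeneric_q.hom_ext hA h']

lemma Approximation.Sends.map {π : Approximation A B G} {X Y : E} {a : A.obj X} {b : B.obj X}
    (h : π.Sends a b) (f : X ⟶ Y) : π.Sends (A.map f a) (B.map f b) := by
  obtain ⟨g, rfl, rfl⟩ := h
  exact ⟨g ≫ f, (map_map _ _ _).symm, (map_map _ _ _).symm⟩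

variable [Regular E] {m : Subobject (⊤_ E)}

/-- Approximations that are compatible with a directed graph are defined on arbitrarily large
finite sets of elements. -/
lemma exists_filter_approximation (hfin : FinitelyPowered E) (hA : IsFlat A) (hB : IsRich m B)
    (Γ : ∀ X : E, A.obj X → B.obj X → Prop) (hΓ : IsDirectedGraph Γ)
    (hG : G → ∀ {X : E} {a : A.obj X} {b : B.obj X}, Γ X a b → IsGeneric A a → IsGeneric B b) :
    ∃ F : Filter (Approximation A B G), F.NeBot ∧
      (∀ {X : E} {a : A.obj X} {b : B.obj X}, Γ X a b → ∀ᶠ π in F, π.Sends a b) ∧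
      ∀ {X : E} (a : A.obj X), ∀ᶠ π in F, ∃ b, π.Sends a b := by
  let K := {t : Σ X : E, A.obj X × B.obj X // Γ t.1 t.2.1 t.2.2} × Σ X : E, A.obj X
  let S : K → Set (Approximation A B G) := fun k =>
    {π | π.Sends k.1.1.2.1 k.1.1.2.2 ∧ ∃ b, π.Sends k.2.2 b}
  obtain ⟨X₀, a₀, b₀, h₀⟩ := hΓ.nonempty
  let t₀ : {t : Σ X : E, A.obj X × B.obj X // Γ t.1 t.2.1 t.2.2} := ⟨⟨X₀, a₀, b₀⟩, h₀⟩
  have hne : Nonempty K := ⟨(t₀, ⟨X₀, a₀⟩)⟩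
  refine ⟨⨅ k, Filter.principal (S k), ?_, ?_, ?_⟩
  · refine Filter.iInf_neBot_of_directed' ?_ ?_
    · rintro ⟨⟨⟨X, a, b⟩, h⟩, ⟨W, r⟩⟩ ⟨⟨⟨X', a', b'⟩, h'⟩, ⟨W', r'⟩⟩
      obtain ⟨V, c, d, f, f', hc, hV, h₁, h₂, h₃, h₄⟩ := hΓ.dir h h'
      obtain ⟨W'', r'', g, g', -, rfl, rfl⟩ := hA.exists_generic_dominate hfin r r'
      refine ⟨⟨⟨⟨V, c, d⟩, hV⟩, ⟨W'', r''⟩⟩, ?_, ?_⟩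
      all_goals
        refine Filter.principal_mono.2 ?_
        rintro π ⟨hπ, e, he⟩
      · exact ⟨h₁ ▸ h₂ ▸ hπ.map f, _, he.map g⟩
      · exact ⟨h₃ ▸ h₄ ▸ hπ.map f', _, he.map g'⟩
    · rintro ⟨⟨⟨X, a, b⟩, h⟩, ⟨W, r⟩⟩
      obtain ⟨V, c, d, f, -, hc, hV, h₁, h₂, -, -⟩ := hΓ.dir h h
      obtain ⟨Z, q, g, g', hq, rfl, rfl⟩ := hA.exists_generic_dominate hfin c r
      obtain ⟨p, hp, rfl⟩ := hB.exists_lift_generic hfin g (hc g q rfl) d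
      have hπ : Approximation.Sends ⟨Z, q, p, hq, fun hG' => hp (hG hG' hV hc)⟩
        (A.map g q) (B.map g p) := ⟨g, rfl, rfl⟩
      exact Filter.principal_neBot_iff.2 ⟨_, h₁ ▸ h₂ ▸ hπ.map f, _, g', rfl, rfl⟩
  · intro X a b h
    refine Filter.mem_iInf_of_mem (⟨⟨X, a, b⟩, h⟩, ⟨X, a⟩) (Filter.mem_principal.2 ?_)
    exact fun π hπ => hπ.1
  · intro X a
    refine Filter.mem_iInf_of_mem (t₀, ⟨X, a⟩) (Filter.mem_principal.2 ?_)
    exact fun π hπ => hπ.2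

/-- A family of approximations defines a morphism to an ultrapower. -/
lemma exists_natTrans_ultrapower (hfin : FinitelyPowered E) (hA : IsFlat A)
    (hB : IsFlat B) {I : Type w} (U : Ultrafilter I) (π : I → Approximation A B G)
    (hπ : ∀ {X : E} (a : A.obj X), ∀ᶠ i in (U : Filter I), ∃ b, (π i).Sends a b) :
    ∃ s : A ⟶ ultraproduct U fun _ => B,
      (∀ {X : E} (a : A.obj X) (b : B.obj X), (∀ᶠ i in (U : Filter I), (π i).Sends a b) →
        s.app X a = (ultraDiag U B).app X b) ∧
      (G → ∀ {X : E} (a : A.obj X), IsGeneric A a → IsGeneric _ (s.app X a)) := by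
  have hmap : ∀ {X Y : E} (f : X ⟶ Y) (a : A.obj X) (β : (ultraproduct U fun _ => B).obj X)
      (γ : (ultraproduct U fun _ => B).obj Y), (Holds β fun i b => (π i).Sends a b) →
      (Holds γ fun i b => (π i).Sends (A.map f a) b) → (ultraproduct U fun _ => B).map f β = γ := by
    intro X Y f a β γ hβ hγ
    exact (Holds.map (R := fun i c => ∃ b, (π i).Sends a b ∧ B.map f b = c)
      (hβ.mono (Filter.Eventually.of_forall fun i b h => ⟨b, h, rfl⟩))).ext hγ
      (Filter.Eventually.of_forall fun i c c' ⟨b, hb, e⟩ hc' => e.symm.trans (hb.eq hA f hc'))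
  obtain ⟨s, hs⟩ := exists_natTrans_of_graph (B := ultraproduct U fun _ => B) hA
    (fun X a β => Holds β fun i b => (π i).Sends a b) (by
      intro X X' a β a' β' hβ hβ'
      obtain ⟨V, c, f, f', hc, rfl, rfl⟩ := hA.exists_generic_dominate hfin a a'
      obtain ⟨γ, hγ⟩ := exists_holds (U := U) (A := fun _ => B) (hπ c)
      exact ⟨V, c, γ, f, f', hc, rfl, hmap f c γ β hγ hβ, rfl, hmap f' c γ β' hγ hβ'⟩)
    (fun a => exists_holds (U := U) (A := fun _ => B) (hπ a))
  refine ⟨s, fun {X} a b h => hs X a _ ?_, fun hG X a ha => ?_⟩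
  · refine (holds_ultraDiag b).mono (h.mono ?_)
    rintro i h _ rfl
    exact h
  · obtain ⟨β, hβ⟩ := exists_holds (U := U) (A := fun _ => B) (hπ a)
    rw [hs X a β hβ, isGeneric_ultraproduct_iff hfin]
    refine hβ.mono (Filter.Eventually.of_forall ?_)
    rintro i _ ⟨g, rfl, rfl⟩
    exact ((π i).isGeneric_p hG).map hB (ha g _ rfl)

/-- A partially defined morphism between members of a family of functors. -/
structure ExtensionProblem {Λ : Type w} (A : Λ → E ⥤ Type w) where
  /-- the index of the source -/
  l : Λ
  /-- the index of the target -/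
  m : Λ
  /-- the graph of the partially defined morphism -/
  Γ : ∀ X : E, (A l).obj X → (A m).obj X → Prop
  isDirectedGraph : IsDirectedGraph Γ

end Extension

section OneStep

variable {E : Type u} [Category.{v} E] [Regular E]

/-- The morphism `d` is an embedding that preserves generic elements. -/
structure IsGenericEmbedding {A B : E ⥤ Type w} (d : A ⟶ B) : Prop where
  injective : ∀ X, Function.Injective (d.app X)
  isGeneric : ∀ {X : E} {a : A.obj X}, IsGeneric A a → IsGeneric B (d.app X a)

/-- In a suitable ultrapower, all partially defined morphisms between members of a given family of
functors can be extended. -/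
lemma exists_extension (hfin : FinitelyPowered E)
    (A : Subobject (⊤_ E) → E ⥤ Type (max u v)) (hA : ∀ l, IsRich l (A l)) :
    ∃ (A' : Subobject (⊤_ E) → E ⥤ Type (max u v)) (d : ∀ l, A l ⟶ A' l), (∀ l, IsRich l (A' l)) ∧
      (∀ l, IsGenericEmbedding (d l)) ∧
      ∀ (l m : Subobject (⊤_ E)) (Γ : ∀ X : E, (A l).obj X → (A m).obj X → Prop),
        IsDirectedGraph Γ → ∃ s : A l ⟶ A' m,
          (∀ {X : E} {a : (A l).obj X} {b : (A m).obj X}, Γ X a b →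
            s.app X a = (d m).app X b) ∧
          ((∀ {X : E} {a : (A l).obj X} {b : (A m).obj X}, Γ X a b → IsGeneric _ a →
            IsGeneric _ b) → ∀ {X : E} {a : (A l).obj X}, IsGeneric _ a →
              IsGeneric _ (s.app X a)) := by
  let G : ExtensionProblem A → Prop := fun t => ∀ {X : E} {a : (A t.l).obj X} {b : (A t.m).obj X},
    t.Γ X a b → IsGeneric _ a → IsGeneric _ b
  have key : ∀ t : ExtensionProblem A, _ := fun t => exists_filter_approximation (G := G t) hfin
    (hA t.l).flat (hA t.m) t.Γ t.isDirectedGraph fun h => h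
  choose F hF h₁ h₂ using key
  -- a single ultrapower for all the problems
  let U : Ultrafilter (∀ t : ExtensionProblem A, Approximation (A t.l) (A t.m) (G t)) :=
    Ultrafilter.of (Filter.pi F)
  have hU : ∀ t {P : Approximation (A t.l) (A t.m) (G t) → Prop}, (∀ᶠ π in F t, P π) →
      ∀ᶠ i in (U : Filter (∀ t : ExtensionProblem A, Approximation (A t.l) (A t.m) (G t))),
        P (i t) := fun t P h =>
    (Filter.tendsto_eval_pi F t).eventually h |>.filter_mono (Ultrafilter.of_le _)
  refine ⟨fun l => ultraproduct U fun _ => A l, fun l => ultraDiag U (A l),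
    fun l => (hA l).ultrapower hfin U, fun l => ⟨ultraDiag_injective, isGeneric_ultraDiag hfin⟩,
    fun l m Γ hΓ => ?_⟩
  let t : ExtensionProblem A := ⟨l, m, Γ, hΓ⟩
  obtain ⟨s, hs, hs'⟩ := exists_natTrans_ultrapower hfin (hA l).flat (hA m).flat U
    (fun i => i t) (fun a => hU t (h₂ t a))
  exact ⟨s, fun h => hs _ _ (hU t (h₁ t h)), fun hG _ _ ha => hs' hG _ ha⟩

/-- Rich functors exist: an ultraproduct of functors that lift along finitely many surjections. -/
lemma exists_isRich (hfin : FinitelyPowered E) (l : Subobject (⊤_ E)) :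
    ∃ A : E ⥤ Type (max u v), IsRich l A := by
  have key : ∀ S : Finset (Arrow E), _ := fun S => exists_sequential_lift.{max u v} hfin l
    {f | f ∈ S ∧ IsRegularEpi f.hom} (S.countable_toSet.mono fun f hf => hf.1) fun f hf => hf.2
  choose P _ hP using key
  refine ⟨ultraproduct (Ultrafilter.of Filter.atTop)
    fun S => ((P S).push (SurjOfType.incl l)).points, isRich_ultraproduct hfin
      (fun S => ProObj.points_isFlat _) (fun S => ProObj.objType_eq_of_isGeneric _) ?_⟩
  intro Z X f hf
  refine Filter.Eventually.filter_mono (Ultrafilter.of_le _) ?_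
  filter_upwards [Filter.eventually_ge_atTop {Arrow.mk f}] with S hS
  exact hP S (Arrow.mk f) ⟨Finset.singleton_subset_iff.1 hS, hf⟩

end OneStep

/-! ### Unions of sequences of functors -/

section Union

variable {E : Type u} [Category.{v} E]

/-- The functor `B`, with the maps `ι n : A n ⟶ B`, is the union of the sequence of functors `A n`
with the transition maps `d n`. -/
structure IsUnion {A : ℕ → E ⥤ Type w} (d : ∀ n, A n ⟶ A (n + 1)) {B : E ⥤ Type w}
    (ι : ∀ n, A n ⟶ B) : Prop where
  comp : ∀ (n : ℕ) {X : E} (a : (A n).obj X), (ι (n + 1)).app X ((d n).app X a) = (ι n).app X a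
  exists_eq : ∀ {X : E} (b : B.obj X), ∃ (n : ℕ) (a : (A n).obj X), (ι n).app X a = b
  injective : ∀ (n : ℕ) (X : E), Function.Injective ((ι n).app X)

lemma exists_isUnion {A : ℕ → E ⥤ Type w} (d : ∀ n, A n ⟶ A (n + 1))
    (hd : ∀ n X, Function.Injective ((d n).app X)) :
    ∃ (B : E ⥤ Type w) (ι : ∀ n, A n ⟶ B), IsUnion d ι := by
  let F : ℕ ⥤ E ⥤ Type w := Functor.ofSequence d
  have hF : ∀ {m n : ℕ} (f : m ⟶ n) (X : E), Function.Injective ((F.map f).app X) := by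
    intro m n f X
    have h := leOfHom f
    induction h with
    | refl =>
      have : f = 𝟙 _ := Subsingleton.elim _ _
      rw [this, F.map_id]
      exact fun a b h => h
    | step h ih =>
      rename_i n
      have : f = homOfLE h ≫ homOfLE (Nat.le_add_right n 1) := Subsingleton.elim _ _
      rw [this, F.map_comp]
      intro a b hab
      refine ih (homOfLE h) (hd n X ?_)
      have e : F.map (homOfLE (Nat.le_add_right n 1)) = d n :=
        Functor.ofSequence_map_homOfLE_succ d n
      rw [← e]
      exact hab
  refine ⟨colimit F, fun n => colimit.ι F n, ?_, ?_, ?_⟩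
  · intro n X a
    have e : F.map (homOfLE (Nat.le_add_right n 1)) = d n :=
      Functor.ofSequence_map_homOfLE_succ d n
    have h := colimit.w F (homOfLE (Nat.le_add_right n 1))
    rw [e] at h
    exact congrArg (fun t : A n ⟶ colimit F => t.app X a) h
  · intro X b
    obtain ⟨n, a, h⟩ := Types.jointly_surjective _
      (isColimitOfPreserves ((evaluation E (Type w)).obj X) (colimit.isColimit F)) b
    exact ⟨n, a, h⟩
  · intro n X a b h
    obtain ⟨k, f, g, e⟩ := (Types.FilteredColimit.isColimit_eq_iff _
      (isColimitOfPreserves ((evaluation E (Type w)).obj X) (colimit.isColimit F))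
      (i := n) (j := n) (xi := a) (xj := b)).1 h
    obtain rfl : f = g := Subsingleton.elim _ _
    exact hF f X e

namespace IsUnion

variable {A A' : ℕ → E ⥤ Type w} {d : ∀ n, A n ⟶ A (n + 1)} {d' : ∀ n, A' n ⟶ A' (n + 1)}
  {B B' : E ⥤ Type w} {ι : ∀ n, A n ⟶ B} {ι' : ∀ n, A' n ⟶ B'}

lemma exists_eq_of_le (h : IsUnion d ι) {m n : ℕ} (hmn : m ≤ n) {X : E} (a : (A m).obj X) :
    ∃ a' : (A n).obj X, (ι n).app X a' = (ι m).app X a := by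
  induction hmn with
  | refl => exact ⟨a, rfl⟩
  | step _ ih =>
    obtain ⟨a', ha'⟩ := ih
    exact ⟨_, (h.comp _ a').trans ha'⟩

lemma exists_common (h : IsUnion d ι) (N : ℕ) {X Y : E} (b : B.obj X) (c : B.obj Y) :
    ∃ n, N ≤ n ∧ ∃ (a : (A n).obj X) (a' : (A n).obj Y), (ι n).app X a = b ∧
      (ι n).app Y a' = c := by
  obtain ⟨m, a, rfl⟩ := h.exists_eq b
  obtain ⟨m', a', rfl⟩ := h.exists_eq c
  obtain ⟨a₁, h₁⟩ := h.exists_eq_of_le (show m ≤ N + m + m' by omega) a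
  obtain ⟨a₂, h₂⟩ := h.exists_eq_of_le (show m' ≤ N + m + m' by omega) a'
  exact ⟨N + m + m', by omega, a₁, a₂, h₁, h₂⟩

lemma succ (h : IsUnion d ι) : IsUnion (fun n => d (n + 1)) (fun n => ι (n + 1)) where
  comp n := h.comp (n + 1)
  exists_eq b := by
    obtain ⟨n, a, rfl⟩ := h.exists_eq b
    exact ⟨n, _, h.comp n a⟩
  injective n := h.injective (n + 1)

lemma add (h : IsUnion d ι) (m : ℕ) : IsUnion (fun n => d (m + n)) (fun n => ι (m + n)) where
  comp n := h.comp (m + n)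
  exists_eq b := by
    obtain ⟨n, a, rfl⟩ := h.exists_eq b
    exact ⟨n, h.exists_eq_of_le (Nat.le_add_left n m) a⟩
  injective n := h.injective (m + n)

lemma double (h : IsUnion d ι) :
    IsUnion (A := fun n => A (2 * n)) (fun n => d (2 * n) ≫ d (2 * n + 1)) (fun n => ι (2 * n)) where
  comp n X a := (h.comp (2 * n + 1) _).trans (h.comp (2 * n) a)
  exists_eq b := by
    obtain ⟨n, a, rfl⟩ := h.exists_eq b
    exact ⟨n, h.exists_eq_of_le (by omega) a⟩
  injective n := h.injective (2 * n)

/-- Maps between the members of two sequences define a map between the unions. -/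
lemma exists_natTrans (h : IsUnion d ι) (h' : IsUnion d' ι') (s : ∀ n, A n ⟶ A' n)
    (hs : ∀ (n : ℕ) {X : E} (a : (A n).obj X),
      (s (n + 1)).app X ((d n).app X a) = (d' n).app X ((s n).app X a)) :
    ∃ φ : B ⟶ B', ∀ (n : ℕ) {X : E} (a : (A n).obj X),
      φ.app X ((ι n).app X a) = (ι' n).app X ((s n).app X a) := by
  have raise : ∀ {m n : ℕ}, m ≤ n → ∀ {X : E} (a : (A m).obj X), ∃ a' : (A n).obj X,
      (ι n).app X a' = (ι m).app X a ∧
        (ι' n).app X ((s n).app X a') = (ι' m).app X ((s m).app X a) := by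
    intro m n hmn X a
    induction hmn with
    | refl => exact ⟨a, rfl, rfl⟩
    | step _ ih =>
      obtain ⟨a', h₁, h₂⟩ := ih
      refine ⟨_, (h.comp _ a').trans h₁, ?_⟩
      rw [hs, h'.comp, h₂]
  have key : ∀ {m n : ℕ} {X Y : E} (f : X ⟶ Y) (a : (A m).obj X) (b : (A n).obj Y),
      B.map f ((ι m).app X a) = (ι n).app Y b →
      B'.map f ((ι' m).app X ((s m).app X a)) = (ι' n).app Y ((s n).app Y b) := by
    intro m n X Y f a b e
    obtain ⟨a', h₁, h₂⟩ := raise (le_max_left m n) a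
    obtain ⟨b', h₃, h₄⟩ := raise (le_max_right m n) b
    rw [← h₁, ← h₃, ← NatTrans.naturality_apply] at e
    rw [← h₂, ← h₄, ← h.injective _ _ e, ← NatTrans.naturality_apply, ← NatTrans.naturality_apply]
  choose n a ha using @h.exists_eq
  refine ⟨{ app := fun X => ↾fun b => (ι' (n b)).app X ((s (n b)).app X (a b))
            naturality := fun X Y f => ?_ }, fun m X b => ?_⟩
  · ext b
    exact (key f _ _ ((congrArg (B.map f) (ha b)).trans (ha _).symm)).symm
  · have := key (𝟙 X) (a ((ι m).app X b)) b (by rw [ha]; simp)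
    simpa using this

lemma isGeneric_iff (h : IsUnion d ι) (hd : ∀ n, IsGenericEmbedding (d n)) {n : ℕ} {X : E}
    (a : (A n).obj X) : IsGeneric B ((ι n).app X a) ↔ IsGeneric (A n) a := by
  constructor
  · rintro ha Y f b rfl
    exact ha f _ (NatTrans.naturality_apply (ι n) f b).symm
  · intro ha Y f β hβ
    obtain ⟨m, b, rfl⟩ := h.exists_eq β
    obtain ⟨b', hb'⟩ := h.exists_eq_of_le (le_max_left m n) b
    obtain ⟨a', ha', hgen⟩ : ∃ a' : (A (max m n)).obj X,
        (ι (max m n)).app X a' = (ι n).app X a ∧ IsGeneric _ a' := by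
      have hmn := le_max_right m n
      revert hmn
      generalize max m n = N
      intro hmn
      induction hmn with
      | refl => exact ⟨a, rfl, ha⟩
      | step _ ih =>
        obtain ⟨a', h₁, h₂⟩ := ih
        exact ⟨_, (h.comp _ a').trans h₁, (hd _).isGeneric h₂⟩
    refine hgen f b' (h.injective _ _ ?_)
    rw [ha', ← hβ, ← hb']
    exact NatTrans.naturality_apply (ι _) f b'

lemma isRich [Regular E] {l : Subobject (⊤_ E)} (h : IsUnion d ι)
    (hd : ∀ n, IsGenericEmbedding (d n)) (hA : ∀ n, IsRich l (A n)) : IsRich l B where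
  flat :=
    { nonempty := by
        obtain ⟨X, ⟨a⟩⟩ := (hA 0).flat.nonempty
        exact ⟨X, ⟨(ι 0).app X a⟩⟩
      dominate := fun β γ => by
        obtain ⟨n, -, a, b, rfl, rfl⟩ := h.exists_common 0 β γ
        obtain ⟨Z, c, f, g, rfl, rfl⟩ := (hA n).flat.dominate a b
        exact ⟨Z, (ι n).app Z c, f, g, (NatTrans.naturality_apply (ι n) f c).symm,
          (NatTrans.naturality_apply (ι n) g c).symm⟩
      equalize := fun f g β e => by
        obtain ⟨n, a, rfl⟩ := h.exists_eq β
        rw [← NatTrans.naturality_apply, ← NatTrans.naturality_apply] at e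
        obtain ⟨Z, c, r, rfl, hr⟩ := (hA n).flat.equalize f g a (h.injective n _ e)
        exact ⟨Z, (ι n).app Z c, r, (NatTrans.naturality_apply (ι n) r c).symm, hr⟩ }
  objType_eq β hβ := by
    obtain ⟨n, a, rfl⟩ := h.exists_eq β
    exact (hA n).objType_eq a ((h.isGeneric_iff hd a).1 hβ)
  lift f hf β hβ := by
    obtain ⟨n, a, rfl⟩ := h.exists_eq β
    obtain ⟨b, hb, rfl⟩ := (hA n).lift f hf a ((h.isGeneric_iff hd a).1 hβ)
    exact ⟨_, (h.isGeneric_iff hd b).2 hb, (NatTrans.naturality_apply (ι n) f b).symm⟩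

end IsUnion

end Union

/-! ### Rich functors with lifting of morphisms and homogeneity -/

section Tower

variable (E : Type u) [Category.{v} E] [Regular E]

/-- A sequence of families of rich functors such that each partially defined morphism between
members of one family extends to a morphism to a member of the next family. -/
structure Tower where
  /-- the families of functors -/
  A : ℕ → Subobject (⊤_ E) → E ⥤ Type (max u v)
  /-- the transition maps -/
  d : ∀ n l, A n l ⟶ A (n + 1) l
  isRich : ∀ n l, IsRich l (A n l)
  isGenericEmbedding : ∀ n l, IsGenericEmbedding (d n l)
  extend : ∀ (n : ℕ) (l m : Subobject (⊤_ E)) (Γ : ∀ X : E, (A n l).obj X → (A n m).obj X → Prop),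
    IsDirectedGraph Γ → ∃ s : A n l ⟶ A (n + 1) m,
      (∀ {X : E} {a : (A n l).obj X} {b : (A n m).obj X}, Γ X a b →
        s.app X a = (d n m).app X b) ∧
      ((∀ {X : E} {a : (A n l).obj X} {b : (A n m).obj X}, Γ X a b → IsGeneric _ a →
        IsGeneric _ b) → ∀ {X : E} {a : (A n l).obj X}, IsGeneric _ a → IsGeneric _ (s.app X a))

variable {E}

lemma exists_tower (hfin : FinitelyPowered E) : Nonempty (Tower E) := by
  choose A₀ hA₀ using exists_isRich (E := E) hfin
  let S := {A : Subobject (⊤_ E) → E ⥤ Type (max u v) // ∀ l, IsRich l (A l)}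
  choose A' d h₁ h₂ h₃ using fun A : S => exists_extension hfin A.1 A.2
  let A : ℕ → S := fun n => Nat.rec ⟨A₀, hA₀⟩ (fun _ A => ⟨A' A, h₁ A⟩) n
  exact ⟨⟨fun n => (A n).1, fun n => d (A n), fun n => (A n).2, fun n => h₂ (A n),
    fun n => h₃ (A n)⟩⟩

namespace Tower

variable (T : Tower E)

/-- The tower that starts at the `m`-th family. -/
def add (m : ℕ) : Tower E where
  A n := T.A (m + n)
  d n := T.d (m + n)
  isRich n := T.isRich (m + n)
  isGenericEmbedding n := T.isGenericEmbedding (m + n)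
  extend n := T.extend (m + n)

variable {T}

lemma isDirectedGraph_of_pair {l m : Subobject (⊤_ E)} {n : ℕ} {X : E} {x : (T.A n l).obj X}
    (y : (T.A n m).obj X) (hx : IsGeneric _ x) :
    IsDirectedGraph fun Y a b => ∃ f : X ⟶ Y, (T.A n l).map f x = a ∧ (T.A n m).map f y = b where
  nonempty := ⟨X, _, _, 𝟙 X, rfl, rfl⟩
  dir := by
    rintro Y Y' _ _ _ _ ⟨f, rfl, rfl⟩ ⟨f', rfl, rfl⟩
    exact ⟨X, x, y, f, f', hx, ⟨𝟙 X, (T.A n l).map_id_apply X x, (T.A n m).map_id_apply X y⟩,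
      rfl, rfl, rfl, rfl⟩

lemma isDirectedGraph_of_natTrans (hfin : FinitelyPowered E) {A B C : E ⥤ Type w} (hA : IsFlat A)
    (s : A ⟶ B) (t : A ⟶ C) (hs : ∀ {X : E} {a : A.obj X}, IsGeneric A a → IsGeneric B (s.app X a)) :
    IsDirectedGraph fun X b c => ∃ a : A.obj X, s.app X a = b ∧ t.app X a = c where
  nonempty := by
    obtain ⟨X, ⟨a⟩⟩ := hA.nonempty
    exact ⟨X, _, _, a, rfl, rfl⟩
  dir := by
    rintro Y Y' _ _ _ _ ⟨a, rfl, rfl⟩ ⟨a', rfl, rfl⟩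
    obtain ⟨V, c, f, f', hc, rfl, rfl⟩ := hA.exists_generic_dominate hfin a a'
    exact ⟨V, s.app V c, t.app V c, f, f', hs hc, ⟨c, rfl, rfl⟩,
      (NatTrans.naturality_apply s f c).symm, (NatTrans.naturality_apply t f c).symm,
      (NatTrans.naturality_apply s f' c).symm, (NatTrans.naturality_apply t f' c).symm⟩

variable {l m : Subobject (⊤_ E)} {B B' : E ⥤ Type (max u v)} {ι : ∀ n, T.A n l ⟶ B}
  {ι' : ∀ n, T.A n m ⟶ B'}

/-- A morphism between unions of towers with a prescribed value at a generic element. -/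
lemma exists_natTrans (hfin : FinitelyPowered E) (h : IsUnion (fun n => T.d n l) ι)
    (h' : IsUnion (fun n => T.d n m) ι') {X : E} {x : (T.A 0 l).obj X} (hx : IsGeneric _ x)
    (y : (T.A 0 m).obj X) : ∃ φ : B ⟶ B', φ.app X ((ι 0).app X x) = (ι' 0).app X y := by
  obtain ⟨s₀, h₀, -⟩ := T.extend 0 l m _ (isDirectedGraph_of_pair y hx)
  have step : ∀ (n : ℕ) (s : T.A n l ⟶ T.A (n + 1) m), ∃ s' : T.A (n + 1) l ⟶ T.A (n + 2) m,
      ∀ {X : E} (a : (T.A n l).obj X),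
        s'.app X ((T.d n l).app X a) = (T.d (n + 1) m).app X (s.app X a) := by
    intro n s
    obtain ⟨s', hs', -⟩ := T.extend (n + 1) l m _ (isDirectedGraph_of_natTrans hfin
      (T.isRich n l).flat (T.d n l) s (T.isGenericEmbedding n l).isGeneric)
    exact ⟨s', fun a => hs' ⟨a, rfl, rfl⟩⟩
  choose next hnext using step
  let s : ∀ n, T.A n l ⟶ T.A (n + 1) m := fun n => Nat.rec s₀ next n
  obtain ⟨φ, hφ⟩ := h.exists_natTrans h'.succ s (fun n X a => hnext n (s n) a)
  refine ⟨φ, (hφ 0 x).trans ?_⟩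
  rw [← h'.comp 0 y]
  exact congrArg _ (h₀ ⟨𝟙 X, (T.A 0 l).map_id_apply X x, (T.A 0 m).map_id_apply X y⟩)

/-- Homogeneity of the union of a tower. Each of the morphisms `s n` extends the inverse of the
previous one, so that those with even index define an automorphism of the union, and those with odd
index its inverse. -/
lemma exists_natIso (hfin : FinitelyPowered E) (h : IsUnion (fun n => T.d n l) ι) {X : E}
    {x y : (T.A 0 l).obj X} (hx : IsGeneric _ x) (hy : IsGeneric _ y) :
    ∃ φ : B ≅ B, φ.hom.app X ((ι 0).app X x) = (ι 0).app X y := by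
  let S : ℕ → Type (max u v) := fun n => {s : T.A n l ⟶ T.A (n + 1) l //
    ∀ {X : E} {a : (T.A n l).obj X}, IsGeneric _ a → IsGeneric _ (s.app X a)}
  obtain ⟨s₀, h₀, hs₀⟩ := T.extend 0 l l _ (isDirectedGraph_of_pair y hx)
  have step : ∀ (n : ℕ) (s : S n), ∃ s' : S (n + 1), ∀ {X : E} (a : (T.A n l).obj X),
      s'.1.app X (s.1.app X a) = (T.d (n + 1) l).app X ((T.d n l).app X a) := by
    intro n s
    obtain ⟨s', hs', hgen⟩ := T.extend (n + 1) l l _ (isDirectedGraph_of_natTrans hfin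
      (T.isRich n l).flat s.1 (T.d n l) s.2)
    refine ⟨⟨s', hgen ?_⟩, fun a => hs' ⟨a, rfl, rfl⟩⟩
    rintro Y _ _ ⟨a, rfl, rfl⟩ ha
    refine (T.isGenericEmbedding n l).isGeneric ?_
    rintro Z f b rfl
    exact ha f _ (NatTrans.naturality_apply s.1 f b).symm
  choose next hnext using step
  let t : ∀ n, S n := fun n => Nat.rec ⟨s₀, hs₀ (by
    rintro Y _ _ ⟨f, rfl, rfl⟩ hf
    exact hy.map (T.isRich 0 l).flat (hf f x rfl))⟩ next n
  let s : ∀ n, T.A n l ⟶ T.A (n + 1) l := fun n => (t n).1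
  have hs : ∀ (n : ℕ) {X : E} (a : (T.A n l).obj X),
      (s (n + 1)).app X ((s n).app X a) = (T.d (n + 1) l).app X ((T.d n l).app X a) :=
    fun n X a => hnext n (t n) a
  have hs' : ∀ (n : ℕ) {X : E} (a : (T.A n l).obj X),
      (s (n + 2)).app X ((T.d (n + 1) l).app X ((T.d n l).app X a)) =
        (T.d (n + 2) l).app X ((T.d (n + 1) l).app X ((s n).app X a)) := by
    intro n X a
    rw [← hs, hs (n + 1)]
  obtain ⟨φ, hφ⟩ := h.double.exists_natTrans h.succ.double (fun n => s (2 * n))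
    (fun n X a => hs' (2 * n) a)
  obtain ⟨ψ, hψ⟩ := h.succ.double.exists_natTrans h.succ.succ.double (fun n => s (2 * n + 1))
    (fun n X a => hs' (2 * n + 1) a)
  refine ⟨⟨φ, ψ, ?_, ?_⟩, ?_⟩
  · ext Y b
    obtain ⟨n, a, rfl⟩ := h.double.exists_eq b
    change ψ.app Y (φ.app Y _) = _
    refine (congrArg _ (hφ n a)).trans ((hψ n _).trans ?_)
    exact (congrArg _ (hs (2 * n) a)).trans ((h.comp (2 * n + 1) _).trans (h.comp (2 * n) a))
  · ext Y b
    obtain ⟨n, a, rfl⟩ := h.succ.double.exists_eq b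
    change φ.app Y (ψ.app Y _) = _
    refine (congrArg _ (hψ n a)).trans ((hφ (n + 1) _).trans ?_)
    exact (congrArg _ (hs (2 * n + 1) a)).trans
      ((h.comp (2 * n + 2) _).trans (h.comp (2 * n + 1) a))
  · refine (hφ 0 x).trans ?_
    rw [← h.comp 0 y]
    exact congrArg _ (h₀ ⟨𝟙 X, (T.A 0 l).map_id_apply X x, (T.A 0 l).map_id_apply X y⟩)

end Tower

/-- There are rich functors that are homogeneous and between which morphisms can be lifted. -/
lemma exists_homogeneous_family (hfin : FinitelyPowered E) :
    ∃ B : Subobject (⊤_ E) → E ⥤ Type (max u v), (∀ l, IsRich l (B l)) ∧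
      (∀ l {X : E} (x y : (B l).obj X), IsGeneric _ x → IsGeneric _ y →
        ∃ φ : B l ≅ B l, φ.hom.app X x = y) ∧
      ∀ l m {X : E} (x : (B l).obj X) (y : (B m).obj X), IsGeneric _ x →
        ∃ φ : B l ⟶ B m, φ.app X x = y := by
  obtain ⟨T⟩ := exists_tower hfin
  choose B ι h using fun l => exists_isUnion (fun n => T.d n l)
    (fun n => (T.isGenericEmbedding n l).injective)
  have hgen : ∀ l {n : ℕ} {X : E} (a : (T.A n l).obj X), _ := fun l _ _ a =>
    (h l).isGeneric_iff (fun n => T.isGenericEmbedding n l) a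
  refine ⟨B, fun l => (h l).isRich (fun n => T.isGenericEmbedding n l) (fun n => T.isRich n l),
    fun l X x y hx hy => ?_, fun l m X x y hx => ?_⟩
  · obtain ⟨n, -, x, y, rfl, rfl⟩ := (h l).exists_common 0 x y
    exact Tower.exists_natIso (T := T.add n) hfin ((h l).add n) ((hgen l x).1 hx) ((hgen l y).1 hy)
  · obtain ⟨n, x, rfl⟩ := (h l).exists_eq x
    obtain ⟨n', y, rfl⟩ := (h m).exists_eq y
    obtain ⟨x', hx'⟩ := (h l).exists_eq_of_le (le_max_left n n') x
    obtain ⟨y', hy'⟩ := (h m).exists_eq_of_le (le_max_right n n') y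
    rw [← hx'] at hx ⊢
    rw [← hy']
    exact Tower.exists_natTrans (T := T.add (max n n')) hfin ((h l).add _) ((h m).add _)
      ((hgen l x').1 hx) y'

end Tower

/-! ### Pro-objects from rich functors -/

section OfFunctor

variable {E : Type u} [Category.{v} E] {A : E ⥤ Type w}

/-- The generic elements of `A`, ordered by domination. -/
def Generic (A : E ⥤ Type w) : Type (max u w) := Σ X : E, {a : A.obj X // IsGeneric A a}

instance : Preorder (Generic A) where
  le x y := ∃ f : x.1 ⟶ y.1, A.map f x.2.1 = y.2.1
  le_refl x := ⟨𝟙 _, A.map_id_apply _ _⟩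
  le_trans := by
    rintro x y z ⟨f, hf⟩ ⟨g, hg⟩
    exact ⟨f ≫ g, by rw [← map_map, hf, hg]⟩

/-- The morphism that realizes a relation between generic elements. -/
def Generic.map {x y : Generic A} (h : x ⟶ y) : x.1 ⟶ y.1 := (leOfHom h).choose

lemma Generic.map_apply {x y : Generic A} (h : x ⟶ y) : A.map (Generic.map h) x.2.1 = y.2.1 :=
  (leOfHom h).choose_spec

lemma Generic.map_comp_apply {x y : Generic A} (h : x ⟶ y) {X : E} (f : y.1 ⟶ X) :
    A.map (Generic.map h ≫ f) x.2.1 = A.map f y.2.1 := by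
  rw [← map_map, Generic.map_apply]

variable [Regular E] {l : Subobject (⊤_ E)}

lemma isCofiltered_generic (hfin : FinitelyPowered E) (hA : IsFlat A) :
    IsCofiltered (Generic A) := by
  have : Nonempty (Generic A) := by
    obtain ⟨X, ⟨a⟩⟩ := hA.nonempty
    obtain ⟨Y, m, b, -, hb, -⟩ := IsFlat.exists_generic hfin a
    exact ⟨⟨Y, b, hb⟩⟩
  have : IsCodirectedOrder (Generic A) := ⟨fun x y => by
    obtain ⟨Z, c, f, g, hc, hf, hg⟩ := hA.exists_generic_dominate hfin x.2.1 y.2.1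
    exact ⟨⟨Z, c, hc⟩, ⟨f, hf⟩, ⟨g, hg⟩⟩⟩
  infer_instance

/-- The pro-object of `E^s_λ` indexed by the generic elements of a rich functor. -/
def IsRich.proObj (hfin : FinitelyPowered E) (hA : IsRich l A) :
    ProObj.{max u w} (SurjOfType l) :=
  have := isCofiltered_generic hfin hA.flat
  { J := Generic A
    diag :=
      { obj := fun x => ⟨⟨x.1⟩, hA.objType_eq x.2.1 x.2.2⟩
        map := fun {x y} h => ProObj.surjMk (Generic.map h)
          (y.2.2 (Generic.map h) x.2.1 (Generic.map_apply h))
        map_id := fun x => by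
          apply (SurjOfType.incl l).map_injective
          exact x.2.2.hom_ext hA.flat ((Generic.map_apply (𝟙 x)).trans
            (A.map_id_apply _ _).symm)
        map_comp := fun {x y z} h k => by
          apply (SurjOfType.incl l).map_injective
          refine x.2.2.hom_ext hA.flat ((Generic.map_apply (h ≫ k)).trans ?_)
          change _ = A.map (Generic.map h ≫ Generic.map k) x.2.1
          rw [← map_map, Generic.map_apply, Generic.map_apply] } }

end OfFunctor

section

variable {E : Type u} [Category.{v} E] [Regular E] {l : Subobject (⊤_ E)}
  {A : E ⥤ Type (max u v)}

/-- The evaluation of a point of the pro-object indexed by the generic elements of `A`. -/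
def IsRich.evalPoint (hfin : FinitelyPowered E) (hA : IsRich l A) {X : E} :
    ((hA.proObj hfin).push (SurjOfType.incl l)).HomTo X → A.obj X :=
  Quotient.lift (fun p : Σ x : Generic A, x.1 ⟶ X => A.map p.2 p.1.2.1) (by
    rintro ⟨x, f⟩ ⟨y, g⟩ ⟨z, h, k, e⟩
    change Generic.map h ≫ f = Generic.map k ≫ g at e
    exact (Generic.map_comp_apply h f).symm.trans
      ((congrArg (fun t : z.1 ⟶ X => A.map t z.2.1) e).trans (Generic.map_comp_apply k g)))

lemma IsRich.evalPoint_bijective (hfin : FinitelyPowered E) (hA : IsRich l A) {X : E} :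
    Function.Bijective (hA.evalPoint hfin (X := X)) := by
  constructor
  · intro p q h
    obtain ⟨x, f, rfl⟩ := ProObj.HomTo.ind p
    obtain ⟨y, g, rfl⟩ := ProObj.HomTo.ind q
    change A.map (X := x.1) f x.2.1 = A.map (X := y.1) g y.2.1 at h
    obtain ⟨Z, c, r, s, hc, hr, hs⟩ := hA.flat.exists_generic_dominate hfin x.2.1 y.2.1
    let z : Generic A := ⟨Z, c, hc⟩
    let i : z ⟶ x := homOfLE ⟨r, hr⟩
    let j : z ⟶ y := homOfLE ⟨s, hs⟩
    refine (ProObj.HomTo.mk_eq_iff _ _).2 ⟨z, i, j, ?_⟩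
    change Generic.map i ≫ f = Generic.map j ≫ g
    exact hc.hom_ext hA.flat ((Generic.map_comp_apply i f).trans
      (h.trans (Generic.map_comp_apply j g).symm))
  · intro a
    obtain ⟨Y, m, b, -, hb, rfl⟩ := IsFlat.exists_generic hfin a
    exact ⟨ProObj.HomTo.mk _ (show Generic A from ⟨Y, b, hb⟩) m, rfl⟩

/-- A rich functor is the functor of points of the pro-object indexed by its generic elements. -/
def IsRich.pointsIso (hfin : FinitelyPowered E) (hA : IsRich l A) :
    ((hA.proObj hfin).push (SurjOfType.incl l)).points ≅ A :=
  NatIso.ofComponents (fun X => (Equiv.ofBijective _ (hA.evalPoint_bijective hfin)).toIso)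
    (fun {X Y} f => by
      ext p
      obtain ⟨x, g, rfl⟩ := ProObj.HomTo.ind p
      exact (map_map (X := x.1) g f x.2.1).symm)

lemma IsRich.of_iso {B : E ⥤ Type w} {A : E ⥤ Type w} (hA : IsRich l A) (e : B ≅ A) :
    IsRich l B where
  flat :=
    { nonempty := by
        obtain ⟨X, ⟨a⟩⟩ := hA.flat.nonempty
        exact ⟨X, ⟨e.inv.app X a⟩⟩
      dominate := fun {X Y} a b => by
        obtain ⟨Z, c, f, g, hf, hg⟩ := hA.flat.dominate (e.hom.app X a) (e.hom.app Y b)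
        refine ⟨Z, e.inv.app Z c, f, g, ?_, ?_⟩
        · rw [← NatTrans.naturality_apply, hf, e.hom_inv_id_app_apply]
        · rw [← NatTrans.naturality_apply, hg, e.hom_inv_id_app_apply]
      equalize := fun {X Y} f g a h => by
        obtain ⟨Z, c, r, hr, hfg⟩ := hA.flat.equalize f g (e.hom.app X a) (by
          rw [← NatTrans.naturality_apply, ← NatTrans.naturality_apply, h])
        refine ⟨Z, e.inv.app Z c, r, ?_, hfg⟩
        rw [← NatTrans.naturality_apply, hr, e.hom_inv_id_app_apply] }
  objType_eq a ha := hA.objType_eq _ ((IsGeneric.iso_iff e a).2 ha)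
  lift {X Z} f hf a ha := by
    obtain ⟨b, hb, h⟩ := hA.lift f hf _ ((IsGeneric.iso_iff e a).2 ha)
    refine ⟨e.inv.app Z b, (IsGeneric.iso_iff e.symm b).2 hb, ?_⟩
    rw [← NatTrans.naturality_apply, h, e.hom_inv_id_app_apply]

/-- There are universal homogeneous pro-objects between which morphisms can be lifted. -/
lemma exists_universalHomogeneous_pointsLift (hfin : FinitelyPowered E) :
    ∃ Ω : ProFamily E, Ω.IsUniversalHomogeneous ∧ PointsLift Ω := by
  obtain ⟨B, hB, hiso, hlift⟩ := exists_homogeneous_family hfin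
  let Ω : ProFamily E := fun l => (hB l).proObj hfin
  let e : ∀ l, ((Ω l).push (SurjOfType.incl l)).points ≅ B l := fun l => (hB l).pointsIso hfin
  refine ⟨Ω, fun l => ?_, fun l m X x y hx => ?_⟩
  · refine ProObj.isUniversal_and_isHomogeneous hfin (Ω l) ((hB l).of_iso (e l))
      fun {X} x y hx hy => ?_
    obtain ⟨φ, hφ⟩ := hiso l ((e l).hom.app X x) ((e l).hom.app X y)
      ((IsGeneric.iso_iff (e l) x).2 hx) ((IsGeneric.iso_iff (e l) y).2 hy)
    refine ⟨e l ≪≫ φ ≪≫ (e l).symm, ?_⟩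
    change (e l).inv.app X (φ.hom.app X ((e l).hom.app X x)) = y
    rw [hφ, (e l).hom_inv_id_app_apply]
  · obtain ⟨φ, hφ⟩ := hlift l m ((e l).hom.app X x) ((e m).hom.app X y)
      ((IsGeneric.iso_iff (e l) x).2 hx)
    obtain ⟨s, hs⟩ := exists_act_eq (Ω := Ω) (l := l) (m := m) ((e l).hom ≫ φ ≫ (e m).inv)
    refine ⟨s, (hs X x).trans ?_⟩
    change (e m).inv.app X (φ.app X ((e l).hom.app X x)) = y
    rw [hφ]
    exact (e m).hom_inv_id_app_apply X y

end

end ProOlig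

end

open ProOlig in
theorem theorem1p1 (E : Type u) [Category.{v} E] [Regular E]
    (hexact : EquivalenceRelationsEffective E) (hfin : FinitelyPowered E) :
    (∃ Ω : ProFamily E, Ω.IsUniversalHomogeneous ∧ EmbeddingA Ω) ∧
    (CountablyManyIsoClasses E →
      ∃ Ω : ProFamily E, Ω.IsUniversalHomogeneous ∧ Ω.IsSequential) ∧
    (∀ Ω : ProFamily E, Ω.IsUniversalHomogeneous → Ω.IsSequential → EmbeddingA Ω) ∧
    (∀ Ω : ProFamily E, Ω.IsUniversalHomogeneous →
      IsProOligomorphic (nonArch Ω) ∧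
      (∀ l : MCat Ω, (nonArch Ω).autTopology l = surjTopology Ω l) ∧
      EmbeddingB Ω ∧
      ∀ X : E, IsIso (decompositionMap Ω X)) := by
  obtain ⟨Ω, hΩ, hL⟩ := exists_universalHomogeneous_pointsLift hfin
  exact ⟨⟨Ω, hΩ, embeddingA hexact hΩ hfin hL⟩,
    exists_universalHomogeneous_isSequential hfin,
    fun Ω h hs => embeddingA hexact h hfin (pointsLift_of_isSequential hfin h hs),
    fun Ω h => ⟨isProOligomorphic_nonArch h hfin, autTopology_eq hfin, embeddingB hexact h hfin,
      isIso_decompositionMap hfin⟩⟩
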